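/- Fix integers $d,n\ge 1$ with $nd$ even. Let $\mathcal G_{n,d}$ be the random $d$-regular graph of the configuration model: a uniformly random perfect matching $M$ of the $nd$ labelled half-edges attached to the vertex set $V=[n]$, $d$ half-edges per vertex (self-loops and multiple edges allowed). A frozen model configuration on a graph $G$ is a pair $(\eta,\mathfrak m)$, where $\eta\in\{0,1,f\}^V$ and $\mathfrak m$ is a set of edges of $G$ with both endpoints in $\{v:\eta_v=f\}$, such that (i) every vertex with $\eta_v=1$ neighbours only vertices of spin $0$; (ii) every vertex with $\eta_v=0$ is joined by at least two edges to vertices of spin $1$; (iii) every vertex with $\eta_v=f$ neighbours only vertices of spin $0$ or $f$, and lies in exactly one edge of $\mathfrak m$, so that $\mathfrak m$ is a perfect matching of the vertices of spin $f$. For an integer $k\ge 0$ let $\mathbf Z_k$ be the number of frozen model configurations on $\mathcal G_{n,d}$ with $$|\{v:\eta_v=1\}|+\tfrac12|\{v:\eta_v=f\}|=k\qquad\text{and}\qquad |\{v:\eta_v=f\}|\le d^{-3/2}n .$$ Let $\alpha_{\rm lbd}=\frac{(5/3)\log d}{d}$ and $\alpha_{\rm ubd}=\frac{2\log d}{d}$.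 The first moment exponent of the frozen model is $$\Phi_\star(\alpha)=\Phi_{\star,d}(\alpha)=\lim \frac1n\log\mathbb E\,\mathbf Z_k ,$$ the limit being taken as $n\to\infty$ with $nd$ even and $k/n\to\alpha$. For comparison, let $$\Phi_d(\alpha)=H(\alpha)-d\Big[\tfrac12(1-2\alpha)\log(1-2\alpha)-(1-\alpha)\log(1-\alpha)\Big],\qquad 0\le\alpha\le\tfrac12,$$ with $H(\alpha)=-\alpha\log\alpha-(1-\alpha)\log(1-\alpha)$; this is the first moment exponent of the number of independent sets of density $\alpha$ in $\mathcal G_{n,d}$. Let $\alpha_{\rm fm}=\inf\{\alpha\in(0,\tfrac12]:\Phi_d(\alpha)<0\}$ be the corresponding first moment threshold. **Proposition.** There are absolute constants $d_0$ and $C$ such that the following holds for all $d\ge d_0$. (a) For every $\alpha\in[\alpha_{\rm lbd},\alpha_{\rm ubd}]$ the limit defining $\Phi_\star(\alpha)$ exists, the equation $$\alpha=q\,\frac{1+(d/2-1)(1-q)^{d-1}}{1+q-(1-q)^{d-1}}$$ has a unique solution $q$ in the interval $\big[1.6\,\tfrac{\log d}{d},\,3\,\tfrac{\log d}{d}\big]$,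 and with this $q$ and $\lambda=q\,\dfrac{1-(1-q)^{d-1}}{(1-q)^d}$, $$\Phi_\star(\alpha)=-\log\big[1-q(1-1/\lambda)\big]-(d/2-1)\log\big[1-q^2(1-1/\lambda)\big]-\alpha\log\lambda .$$ (b) $\Phi_\star$ is strictly decreasing on $[\alpha_{\rm lbd},\alpha_{\rm ubd}]$ and has a unique zero $\alpha_\star$ there, which lies in the interior of the interval. (c) The gap between the thresholds satisfies $$\alpha_{\rm fm}-\alpha_\star=\Big(\frac{2\log d}{e\,d}\Big)^2\Big[1+O\Big(\frac{\log\log d}{\log d}\Big)\Big],$$ that is, $\Big|\alpha_{\rm fm}-\alpha_\star-\big(\tfrac{2\log d}{e d}\big)^2\Big|\le C\,\frac{\log\log d}{\log d}\,\big(\tfrac{2\log d}{e d}\big)^2$. -/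

import Mathlib

open Filter Topology

/-- The three spins of the frozen model. -/
inductive FrozenSpin : Type
  | zero
  | one
  | free
  deriving DecidableEq

instance : Fintype FrozenSpin where
  elems := {.zero, .one, .free}
  complete := by intro x; cases x <;> simp

/-- A `d`-regular graph of the configuration model on the vertex set `Fin n`: a perfect matching of
the `n * d` labelled half-edges, encoded as a fixed-point-free involution. The half-edge `(v, i)` is
incident to the vertex `v`; self-loops and multiple edges are allowed. -/
abbrev ConfigGraph (n d : ℕ) : Type :=
  {M : Equiv.Perm (Fin n × Fin d) // (∀ h, M (M h) = h) ∧ ∀ h, M h ≠ h}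

namespace ConfigGraph

/-- The other endpoint of the edge containing the half-edge `h`. -/
def nbr {n d : ℕ} (G : ConfigGraph n d) (h : Fin n × Fin d) : Fin n := (G.1 h).1

/-- `(η, m)` is a (weighted) frozen model configuration on `G`. A set of edges of `G` is encoded by
the set `m` of its half-edges, which is closed under the matching `G`. The edges in `m` form a
perfect matching of the free vertices (an edge of `m` is never a self-loop, since its two
half-edges are distinct and each free vertex carries exactly one half-edge of `m`). -/
structure IsFrozenConfig {n d : ℕ} (G : ConfigGraph n d) (η : Fin n → FrozenSpin)
    (m : Finset (Fin n × Fin d)) : Prop where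
  /-- an occupied vertex neighbours only unoccupied vertices -/
  one_nbr : ∀ h : Fin n × Fin d, η h.1 = .one → η (G.nbr h) = .zero
  /-- at least two edges join an unoccupied vertex to occupied vertices -/
  zero_nbr : ∀ v : Fin n, η v = .zero →
    2 ≤ (Finset.univ.filter fun i : Fin d => η (G.nbr (v, i)) = .one).card
  /-- a free vertex neighbours only unoccupied or free vertices -/
  free_nbr : ∀ h : Fin n × Fin d, η h.1 = .free → η (G.nbr h) = .zero ∨ η (G.nbr h) = .free
  /-- `m` consists of whole edges of `G` -/
  closed : ∀ h ∈ m, G.1 h ∈ m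
  /-- `m` only involves free vertices -/
  matched_free : ∀ h ∈ m, η h.1 = .free
  /-- every free vertex is matched by exactly one edge of `m` -/
  free_matched : ∀ v : Fin n, η v = .free → ∃! i : Fin d, (v, i) ∈ m

end ConfigGraph

noncomputable section

open Classical in
/-- The truncated frozen model partition function: the number of frozen model configurations on `G`
whose intensity `#{v | η v = one} + #{v | η v = free} / 2` equals `k`, and which have at most
`d ^ (-3/2) * n` free vertices. -/
def frozenPartition {n d : ℕ} (G : ConfigGraph n d) (k : ℕ) : ℕ :=
  (Finset.univ.filter fun z : (Fin n → FrozenSpin) × Finset (Fin n × Fin d) =>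
    G.IsFrozenConfig z.1 z.2 ∧
    2 * (Finset.univ.filter fun v => z.1 v = .one).card
      + (Finset.univ.filter fun v => z.1 v = .free).card = 2 * k ∧
    ((Finset.univ.filter fun v => z.1 v = .free).card : ℝ) ≤ (d : ℝ) ^ (-(3 / 2) : ℝ) * n).card

/-- The first moment of the truncated frozen model partition function at intensity `k`, over the
uniformly random `d`-regular graph of the configuration model on `n` vertices. -/
def expectedFrozenPartition (d n k : ℕ) : ℝ :=
  (∑ G : ConfigGraph n d, (frozenPartition G k : ℝ)) / (Fintype.card (ConfigGraph n d) : ℝ)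

/-- Pairs `(n, k)` with `n → ∞` along values with `n * d` even, and `k / n → α`. -/
def intensityFilter (d : ℕ) (α : ℝ) : Filter (ℕ × ℕ) :=
  comap (fun p : ℕ × ℕ => (p.1, (p.2 : ℝ) / (p.1 : ℝ))) (atTop ×ˢ 𝓝 α)
    ⊓ 𝓟 {p : ℕ × ℕ | Even (p.1 * d)}

/-- The normalized logarithm of the first moment. -/
def logFirstMoment (d : ℕ) (p : ℕ × ℕ) : ℝ :=
  Real.log (expectedFrozenPartition d p.1 p.2) / (p.1 : ℝ)

/-- The first moment exponent of the frozen model, `lim n⁻¹ log E Z_{nα}` (its existence is part of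
the theorem). -/
def PhiStar (d : ℕ) (α : ℝ) : ℝ :=
  limUnder (intensityFilter d α) (logFirstMoment d)

/-- The first moment exponent of independent sets of density `α` (for `0 ≤ α ≤ 1/2`). -/
def PhiIS (d : ℕ) (α : ℝ) : ℝ :=
  Real.binEntropy α
    - d * (1 / 2 * (1 - 2 * α) * Real.log (1 - 2 * α) - (1 - α) * Real.log (1 - α))

/-- The first moment threshold of independent sets; densities above `1/2` do not occur. -/
def alphaFM (d : ℕ) : ℝ :=
  sInf {α : ℝ | 0 < α ∧ α ≤ 1 / 2 ∧ PhiIS d α < 0}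

def alphaLbd (d : ℕ) : ℝ := (5 / 3) * Real.log d / d

def alphaUbd (d : ℕ) : ℝ := 2 * Real.log d / d

def lambdaOf (d : ℕ) (q : ℝ) : ℝ :=
  q * ((1 - (1 - q) ^ (d - 1)) / (1 - q) ^ d)

def alphaOf (d : ℕ) (q : ℝ) : ℝ :=
  q * ((1 + ((d : ℝ) / 2 - 1) * (1 - q) ^ (d - 1)) / (1 + q - (1 - q) ^ (d - 1)))

def explicitExponent (d : ℕ) (q lam α : ℝ) : ℝ :=
  -Real.log (1 - q * (1 - 1 / lam))
    - ((d : ℝ) / 2 - 1) * Real.log (1 - q ^ 2 * (1 - 1 / lam))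
    - α * Real.log lam

/-- `q` solves the equation relating it to `α`, on the interval `1.6 ≤ q d / log d ≤ 3`. -/
def IsSolutionQ (d : ℕ) (α q : ℝ) : Prop :=
  1.6 * (Real.log d / d) ≤ q ∧ q ≤ 3 * (Real.log d / d) ∧ α = alphaOf d q

end

/-! The first moment is computed exactly and its exponent is found by matching bounds. Give each
vertex a local state: occupied, unoccupied with its set of half-edges towards occupied vertices
("tokens"), or free with its half-edge in the matching. The number of graphs compatible with a
family of states depends only on the numbers `n₁` and `nf` of occupied and free vertices and on the
total number of tokens, which must equal `d * n₁` (`card_labelledMatching_edgeLabels`). Hence only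
families of states with given totals remain to be counted.

From above they are counted by a Chernoff bound (`card_mul_weight_le`), which gives the rate
`frozenRate`; from below by one type class (`factorial_le_card_typeClass`, `exists_rounding`). Both
give the same exponent at the stationary point with token probability `q`. Relative to this point
the rate is an affine function of the intensity plus entropy terms. Their linear parts cancel and
their quadratic part is nonpositive when the free density is at most `d^(-3/2)` (`frozenRate_le`,
`quadratic_form_nonpos`).

This upper bound holds for every `q` in the range, whatever the intensity. So `PhiStar` lies below
each line `starDual d q - α log λ(q)` and touches it at `α = alphaOf d q` (`PhiStar_le`,
`PhiStar_alphaOf`). Since `0 < log λ ≤ d`, it is strictly decreasing and Lipschitz, without any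
differentiation.

For the gap put `y = (1-q)^(d-1)`. Relative to independent sets, demanding two tokens at every
unoccupied vertex costs about `y(1 + dq)` in the exponent, and the free vertices, of density about
`dq·y`, give back half of that density. Thus `PhiIS - PhiStar = y·dq/2 + O(y)` (`PhiIS_sub_bounds`).
At the threshold of independent sets `dα = 2 - 2 log α` up to a small error, so `dq/2 ≈ log d` and
`y ≈ e^(-dα) = (α/e)² ≈ (2 log d/(e d))²`. There `PhiStar ≈ -y log d`, while its slope is `-log λ ≈
-log d`. Its zero therefore lies about `y` to the left (`exists_threshold`). -/

/-! ### Perfect matchings compatible with labels on the half-edges. -/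

/-- The number of fixed-point-free involutions of a set of `N` elements. -/
def matchingCount (N : ℕ) : ℕ :=
  if Even N then N.factorial / (2 ^ (N / 2) * (N / 2).factorial) else 0

/-- These are exactly the permutations whose cycle type consists of `N / 2` twos, so the formula for
the size of a conjugacy class gives the count. -/
theorem card_fixedPointFree_involutions (X : Type*) [Fintype X] :
    Nat.card {M : Equiv.Perm X // (∀ h, M (M h) = h) ∧ ∀ h, M h ≠ h} =
      matchingCount (Fintype.card X) := by
  classical
  have key : ∀ M : Equiv.Perm X, ((∀ h, M (M h) = h) ∧ ∀ h, M h ≠ h) →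
      ∃ n, Fintype.card X = 2 * n ∧ M.cycleType = Multiset.replicate n 2 := by
    rintro M ⟨h1, h2⟩
    have hp : M ^ 2 = 1 := by
      ext x; simp [pow_two, h1]
    have : Fact (Nat.Prime 2) := ⟨Nat.prime_two⟩
    have h3 := Equiv.Perm.cycleType_of_pow_prime_eq_one hp
    have h4 : M.support = Finset.univ := by
      ext x; simp [h2]
    have h5 := M.sum_cycleType
    rw [h3, h4] at h5
    refine ⟨_, ?_, h3⟩
    simp at h5
    rw [← h5]; ring
  have key2 : ∀ n, Fintype.card X = 2 * n → ∀ M : Equiv.Perm X,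
      M.cycleType = Multiset.replicate n 2 → ((∀ h, M (M h) = h) ∧ ∀ h, M h ≠ h) := by
    intro n hn M hM
    have h4 : M.support = Finset.univ := by
      apply Finset.eq_univ_of_card
      rw [← M.sum_cycleType, hM, hn]; simp [mul_comm]
    have h6 : M ^ 2 = 1 := by
      rw [← orderOf_dvd_iff_pow_eq_one, ← Equiv.Perm.lcm_cycleType, hM]
      apply Multiset.lcm_dvd.2
      intro b hb
      rw [Multiset.eq_of_mem_replicate hb]
    constructor
    · intro h
      have := congrArg (fun f : Equiv.Perm X => f h) h6
      simpa [pow_two] using this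
    · intro h
      have : h ∈ M.support := by rw [h4]; simp
      exact Equiv.Perm.mem_support.1 this
  unfold matchingCount
  split_ifs with hev
  · obtain ⟨n, hn⟩ := hev
    have hn : Fintype.card X = 2 * n := by omega
    have hiff : ∀ M : Equiv.Perm X, ((∀ h, M (M h) = h) ∧ ∀ h, M h ≠ h) ↔
        M.cycleType = Multiset.replicate n 2 := by
      intro M
      refine ⟨fun h => ?_, key2 n hn M⟩
      obtain ⟨m, hm, h⟩ := key M h
      have : m = n := by omega
      rw [h, this]
    rw [Nat.card_congr (Equiv.subtypeEquivRight hiff), Nat.card_eq_fintype_card,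
      Fintype.card_subtype, Equiv.Perm.card_of_cycleType, hn, if_pos]
    · have h2 : 2 * n / 2 = n := by omega
      rw [h2]
      congr 1
      by_cases h0 : n = 0
      · subst h0; simp
      · simp [Multiset.toFinset_replicate, h0, mul_comm]
    · constructor
      · simp [mul_comm]
      · intro a ha; rw [Multiset.eq_of_mem_replicate ha]
  · rw [Nat.card_eq_fintype_card, Fintype.card_eq_zero_iff]
    refine ⟨fun M => hev ?_⟩
    obtain ⟨n, hn, -⟩ := key M.1 M.2
    exact ⟨n, by omega⟩

/-- Labels of half-edges: `occ` at an occupied vertex, `tok` matched to an occupied vertex,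
`mat` in the matching of the free vertices, `bulk` otherwise. -/
inductive EdgeLabel : Type
  | occ
  | tok
  | mat
  | bulk
  deriving DecidableEq

/-- The label of the other half of an edge. -/
def EdgeLabel.swap : EdgeLabel → EdgeLabel
  | .occ => .tok
  | .tok => .occ
  | .mat => .mat
  | .bulk => .bulk

/-- Perfect matchings compatible with a labelling. -/
abbrev LabelledMatching {X : Type*} (L : X → EdgeLabel) : Type _ :=
  {M : Equiv.Perm X // (∀ h, M (M h) = h) ∧ (∀ h, M h ≠ h) ∧ ∀ h, L (M h) = (L h).swap}

/-- A labelled matching splits along a set of labels closed under `swap`. -/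
def LabelledMatching.split {X : Type*} (L : X → EdgeLabel) (p : EdgeLabel → Prop)
    [DecidablePred p] (hp : ∀ l, p l.swap ↔ p l) :
    LabelledMatching L ≃ LabelledMatching (fun x : {x // p (L x)} => L x) ×
      LabelledMatching (fun x : {x // ¬ p (L x)} => L x) where
  toFun M :=
    (⟨M.1.subtypePerm (fun x => by rw [M.2.2.2, hp]), by
      refine ⟨fun h => ?_, fun h h' => ?_, fun h => ?_⟩
      · ext; simp [M.2.1]
      · exact M.2.2.1 h.1 (by simpa [Subtype.ext_iff] using h')
      · simp [M.2.2.2]⟩,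
     ⟨M.1.subtypePerm (fun x => by rw [M.2.2.2, hp]), by
      refine ⟨fun h => ?_, fun h h' => ?_, fun h => ?_⟩
      · ext; simp [M.2.1]
      · exact M.2.2.1 h.1 (by simpa [Subtype.ext_iff] using h')
      · simp [M.2.2.2]⟩)
  invFun N :=
    ⟨Equiv.Perm.subtypeCongr N.1.1 N.2.1, by
      have e1 : ∀ (x : X) (hx : p (L x)),
          Equiv.Perm.subtypeCongr N.1.1 N.2.1 x = N.1.1 ⟨x, hx⟩ := fun x hx =>
        Equiv.Perm.subtypeCongr.left_apply (p := fun x => p (L x)) N.1.1 N.2.1 hx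
      have e2 : ∀ (x : X) (hx : ¬ p (L x)),
          Equiv.Perm.subtypeCongr N.1.1 N.2.1 x = N.2.1 ⟨x, hx⟩ := fun x hx =>
        Equiv.Perm.subtypeCongr.right_apply (p := fun x => p (L x)) N.1.1 N.2.1 hx
      refine ⟨fun h => ?_, fun h => ?_, fun h => ?_⟩
      · by_cases hx : p (L h)
        · rw [e1 h hx, e1 _ (N.1.1 ⟨h, hx⟩).2]
          exact congrArg Subtype.val (N.1.2.1 ⟨h, hx⟩)
        · rw [e2 h hx, e2 _ (N.2.1 ⟨h, hx⟩).2]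
          exact congrArg Subtype.val (N.2.2.1 ⟨h, hx⟩)
      · by_cases hx : p (L h)
        · rw [e1 h hx]
          exact fun h' => N.1.2.2.1 ⟨h, hx⟩ (Subtype.ext h')
        · rw [e2 h hx]
          exact fun h' => N.2.2.2.1 ⟨h, hx⟩ (Subtype.ext h')
      · by_cases hx : p (L h)
        · rw [e1 h hx]
          exact N.1.2.2.2 ⟨h, hx⟩
        · rw [e2 h hx]
          exact N.2.2.2.2 ⟨h, hx⟩⟩
  left_inv M := by
    apply Subtype.ext
    ext x
    by_cases hx : p (L x)
    · exact Equiv.Perm.subtypeCongr.left_apply (p := fun x => p (L x)) _ _ hx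
    · exact Equiv.Perm.subtypeCongr.right_apply (p := fun x => p (L x)) _ _ hx
  right_inv N := by
    refine Prod.ext (Subtype.ext ?_) (Subtype.ext ?_)
    · ext x
      simp
    · ext x
      simp

/-- Matchings between the two sides `occ` and `tok`. -/
def LabelledMatching.bipartite {X : Type*} (L : X → EdgeLabel)
    (hL : ∀ x, L x ≠ .occ ↔ L x = .tok) :
    LabelledMatching L ≃ ({x // L x = .occ} ≃ {x // L x = .tok}) where
  toFun M :=
    { toFun := fun x => ⟨M.1 x, by rw [M.2.2.2, x.2]; rfl⟩
      invFun := fun x => ⟨M.1 x, by rw [M.2.2.2, x.2]; rfl⟩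
      left_inv := fun x => Subtype.ext (M.2.1 x)
      right_inv := fun x => Subtype.ext (M.2.1 x) }
  invFun e :=
    ⟨{ toFun := fun x => if h : L x = .occ then (e ⟨x, h⟩).1 else
          (e.symm ⟨x, (hL x).1 h⟩).1
       invFun := fun x => if h : L x = .occ then (e ⟨x, h⟩).1 else
          (e.symm ⟨x, (hL x).1 h⟩).1
       left_inv := by
        intro x
        by_cases h : L x = .occ
        · have := (hL _).2 (e ⟨x, h⟩).2
          simp [h, this]
        · have := (e.symm ⟨x, (hL x).1 h⟩).2
          simp [h, this]
       right_inv := by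
        intro x
        by_cases h : L x = .occ
        · have := (hL _).2 (e ⟨x, h⟩).2
          simp [h, this]
        · have := (e.symm ⟨x, (hL x).1 h⟩).2
          simp [h, this] }, by
      have main : ∀ x, L (if h : L x = .occ then (e ⟨x, h⟩).1 else
          (e.symm ⟨x, (hL x).1 h⟩).1) = (L x).swap := by
        intro x
        by_cases h : L x = .occ
        · rw [dif_pos h, (e ⟨x, h⟩).2, h]; rfl
        · rw [dif_neg h, (e.symm ⟨x, (hL x).1 h⟩).2, (hL x).1 h]; rfl
      refine ⟨fun x => ?_, fun x hx => ?_, main⟩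
      · by_cases h : L x = .occ
        · have := (hL _).2 (e ⟨x, h⟩).2
          simp [h, this]
        · have := (e.symm ⟨x, (hL x).1 h⟩).2
          simp [h, this]
      · have h1 := main x
        simp only [Equiv.coe_fn_mk] at hx
        rw [hx] at h1
        by_cases h : L x = .occ
        · rw [h] at h1; cases h1
        · rw [(hL x).1 h] at h1; cases h1⟩
  left_inv M := by
    apply Subtype.ext
    ext x
    simp
  right_inv e := by
    ext x
    simp [x.2]

theorem card_labelledMatching_bipartite {X : Type*} [Fintype X] (L : X → EdgeLabel)
    (hL : ∀ x, L x ≠ .occ ↔ L x = .tok) :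
    Nat.card (LabelledMatching L) =
      if Nat.card {x // L x = .occ} = Nat.card {x // L x = .tok}
      then (Nat.card {x // L x = .occ}).factorial else 0 := by
  classical
  rw [Nat.card_congr (LabelledMatching.bipartite L hL)]
  simp only [Nat.card_eq_fintype_card]
  split_ifs with h
  · rw [Fintype.card_equiv (Fintype.equivOfCardEq h)]
  · rw [Fintype.card_eq_zero_iff]
    exact ⟨fun e => h (Fintype.card_congr e)⟩

theorem card_labelledMatching_const {X : Type*} [Fintype X] (L : X → EdgeLabel)
    (l : EdgeLabel) (hl : l.swap = l) (hL : ∀ x, L x = l) :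
    Nat.card (LabelledMatching L) = matchingCount (Nat.card X) := by
  rw [Nat.card_eq_fintype_card (α := X), ← card_fixedPointFree_involutions X]
  refine Nat.card_congr (Equiv.subtypeEquivRight fun M => ?_)
  simp [hL, hl]

/-- The number of perfect matchings compatible with a labelling. -/
theorem card_labelledMatching {X : Type*} [Fintype X] (L : X → EdgeLabel) :
    Nat.card (LabelledMatching L) =
      if Nat.card {x // L x = .occ} = Nat.card {x // L x = .tok}
      then (Nat.card {x // L x = .occ}).factorial * matchingCount (Nat.card {x // L x = .mat})
        * matchingCount (Nat.card {x // L x = .bulk}) else 0 := by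
  classical
  -- `swap` preserves `{occ, tok}`, `{mat}` and `{bulk}`. A compatible matching is thus a bijection
  -- from `occ` to `tok` together with arbitrary perfect matchings of the other two classes.
  rw [Nat.card_congr (LabelledMatching.split L (fun l => l = .occ ∨ l = .tok)
    (by intro l; cases l <;> simp [EdgeLabel.swap])), Nat.card_prod,
    card_labelledMatching_bipartite _ (by
      rintro ⟨x, hx⟩
      rcases hx with hx | hx <;> simp [hx]),
    Nat.card_congr (LabelledMatching.split (fun x : {x // ¬ (L x = .occ ∨ L x = .tok)} => L x)
      (fun l => l = .mat) (by intro l; cases l <;> simp [EdgeLabel.swap])), Nat.card_prod,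
    card_labelledMatching_const _ .mat rfl (fun x => x.2),
    card_labelledMatching_const _ .bulk rfl (by
      rintro ⟨⟨x, h1⟩, h2⟩
      simp only at h2 ⊢
      cases h : L x <;> first | rfl | exact absurd h h2 | exact absurd (Or.inl h) h1 | exact absurd (Or.inr h) h1)]
  have e1 : Nat.card {x : {x // L x = .occ ∨ L x = .tok} // L x = .occ} =
      Nat.card {x // L x = .occ} :=
    Nat.card_congr (Equiv.subtypeSubtypeEquivSubtype (fun h => Or.inl h))
  have e2 : Nat.card {x : {x // L x = .occ ∨ L x = .tok} // L x = .tok} =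
      Nat.card {x // L x = .tok} :=
    Nat.card_congr (Equiv.subtypeSubtypeEquivSubtype (fun h => Or.inr h))
  have e3 : Nat.card {x : {x // ¬ (L x = .occ ∨ L x = .tok)} // L x = .mat} =
      Nat.card {x // L x = .mat} :=
    Nat.card_congr (Equiv.subtypeSubtypeEquivSubtype
      (p := fun x => ¬ (L x = .occ ∨ L x = .tok)) (q := fun x => L x = .mat)
      (fun {x} h => by rw [h]; simp))
  have e4 : Nat.card {x : {x // ¬ (L x = .occ ∨ L x = .tok)} // ¬ L x = .mat} =
      Nat.card {x // L x = .bulk} := by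
    refine Nat.card_congr ((Equiv.subtypeSubtypeEquivSubtypeInter
      (fun x => ¬ (L x = .occ ∨ L x = .tok)) (fun x => ¬ L x = .mat)).trans
      (Equiv.subtypeEquivRight fun x => ?_))
    cases h : L x <;> simp
  rw [e1, e2, e3, e4]
  split_ifs <;> ring

/-! ### Encoding frozen configurations by local states. -/

/-- Local states of a vertex: occupied; unoccupied, together with the set of its half-edges matched
to occupied vertices; free, together with its half-edge in the matching. -/
abbrev LocalState (d : ℕ) : Type := Unit ⊕ {A : Finset (Fin d) // 2 ≤ A.card} ⊕ Fin d

/-- No clause for `bulk` is needed: it is what remains when the other labels are excluded on both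
halves. -/
theorem EdgeLabel.eq_swap_of_imp {l l' : EdgeLabel} (a : l' = .occ → l = .tok)
    (b : l' = .tok → l = .occ) (c : l' = .mat → l = .mat) (a' : l = .occ → l' = .tok)
    (b' : l = .tok → l' = .occ) (c' : l = .mat → l' = .mat) : l' = l.swap := by
  cases l <;> cases l' <;> first
    | rfl
    | exact absurd (a rfl) (by decide)
    | exact absurd (b rfl) (by decide)
    | exact absurd (c rfl) (by decide)
    | exact absurd (a' rfl) (by decide)
    | exact absurd (b' rfl) (by decide)
    | exact absurd (c' rfl) (by decide)

namespace LocalState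

/-- The spin of a local state. -/
def spin {d : ℕ} : LocalState d → FrozenSpin
  | .inl _ => .one
  | .inr (.inl _) => .zero
  | .inr (.inr _) => .free

/-- The labels of the half-edges of a local state. -/
def label {d : ℕ} : LocalState d → Fin d → EdgeLabel
  | .inl _, _ => .occ
  | .inr (.inl A), i => if i ∈ A.1 then .tok else .bulk
  | .inr (.inr j), i => if i = j then .mat else .bulk

variable {d : ℕ} (s : LocalState d) (i : Fin d)

theorem label_eq_occ : s.label i = .occ ↔ s.spin = .one := by
  rcases s with _ | A | j <;> simp only [label, spin] <;> (try split_ifs) <;> simp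

theorem spin_of_tok (h : s.label i = .tok) : s.spin = .zero := by
  rcases s with _ | A | j <;> simp only [label, spin] at * <;>
    first | cases h | split_ifs at h

theorem spin_of_mat (h : s.label i = .mat) : s.spin = .free := by
  rcases s with _ | A | j <;> simp only [label, spin] at * <;>
    first | cases h | split_ifs at h

theorem spin_of_bulk (h : s.label i = .bulk) : s.spin = .zero ∨ s.spin = .free := by
  rcases s with _ | A | j <;> simp only [label, spin] at * <;> simp at *

/-- The number of half-edges matched to occupied vertices. -/
def tokens : LocalState d → ℕ
  | .inr (.inl A) => A.1.card
  | _ => 0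

end LocalState

/-- The labelling of the half-edges given by local states. -/
def edgeLabels {n d : ℕ} (σ : Fin n → LocalState d) (h : Fin n × Fin d) : EdgeLabel :=
  (σ h.1).label h.2

open Classical in
/-- Configurations of local states with intensity `k` and few free vertices. -/
noncomputable def admissibleStates (n d k : ℕ) : Finset (Fin n → LocalState d) :=
  Finset.univ.filter fun σ =>
    2 * (Finset.univ.filter fun v => (σ v).spin = .one).card
      + (Finset.univ.filter fun v => (σ v).spin = .free).card = 2 * k ∧
    ((Finset.univ.filter fun v => (σ v).spin = .free).card : ℝ) ≤ (d : ℝ) ^ (-(3 / 2) : ℝ) * n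

/-- The frozen model configuration given by local states. -/
def frozenOfStates {n d : ℕ} (σ : Fin n → LocalState d) :
    (Fin n → FrozenSpin) × Finset (Fin n × Fin d) :=
  (fun v => (σ v).spin, Finset.univ.filter fun h => edgeLabels σ h = .mat)

theorem isFrozenConfig_frozenOfStates {n d : ℕ} (G : ConfigGraph n d) (σ : Fin n → LocalState d)
    (hσ : ∀ h, edgeLabels σ (G.1 h) = (edgeLabels σ h).swap) :
    G.IsFrozenConfig (frozenOfStates σ).1 (frozenOfStates σ).2 where
  one_nbr h h1 := by
    have h2 : edgeLabels σ h = .occ := ((σ h.1).label_eq_occ h.2).2 h1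
    have h3 := hσ h
    rw [h2] at h3
    exact LocalState.spin_of_tok _ _ h3
  zero_nbr v hv := by
    change (σ v).spin = .zero at hv
    rcases hs : σ v with _ | A | j
    · rw [hs] at hv; simp [LocalState.spin] at hv
    · refine A.2.trans (Finset.card_le_card fun i hi => ?_)
      simp only [Finset.mem_filter, Finset.mem_univ, true_and]
      have h3 := hσ (v, i)
      have h2 : edgeLabels σ (v, i) = .tok := by simp [edgeLabels, hs, LocalState.label, hi]
      rw [h2] at h3
      exact ((σ _).label_eq_occ _).1 h3
    · rw [hs] at hv; simp [LocalState.spin] at hv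
  free_nbr h h1 := by
    simp only [frozenOfStates] at h1 ⊢
    have h3 := hσ h
    cases h2 : edgeLabels σ h with
    | occ =>
      have := ((σ h.1).label_eq_occ h.2).1 h2
      rw [this] at h1; cases h1
    | tok =>
      have := LocalState.spin_of_tok _ _ h2
      rw [this] at h1; cases h1
    | mat =>
      rw [h2] at h3
      exact Or.inr (LocalState.spin_of_mat _ _ h3)
    | bulk =>
      rw [h2] at h3
      exact LocalState.spin_of_bulk _ _ h3
  closed h hh := by
    simp only [frozenOfStates, Finset.mem_filter, Finset.mem_univ, true_and] at hh ⊢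
    rw [hσ, hh]; rfl
  matched_free h hh := by
    simp only [frozenOfStates, Finset.mem_filter, Finset.mem_univ, true_and] at hh ⊢
    exact LocalState.spin_of_mat _ _ hh
  free_matched v hv := by
    simp only [frozenOfStates, Finset.mem_filter, Finset.mem_univ, true_and] at hv ⊢
    rcases hs : σ v with _ | A | j
    · rw [hs] at hv; simp [LocalState.spin] at hv
    · rw [hs] at hv; simp [LocalState.spin] at hv
    · refine ⟨j, by simp [edgeLabels, hs, LocalState.label], fun i hi => ?_⟩
      simp only [edgeLabels, hs, LocalState.label] at hi
      by_contra h
      rw [if_neg h] at hi; cases hi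

/-- The pair of spins and matching forgets the token sets. They are recovered from `G`, as the
partners of the occupied half-edges. -/
theorem frozenOfStates_injOn {n d : ℕ} (G : ConfigGraph n d) (σ τ : Fin n → LocalState d)
    (hσ : ∀ h, edgeLabels σ (G.1 h) = (edgeLabels σ h).swap)
    (hτ : ∀ h, edgeLabels τ (G.1 h) = (edgeLabels τ h).swap)
    (h : frozenOfStates σ = frozenOfStates τ) : σ = τ := by
  have h1 : ∀ v, (σ v).spin = (τ v).spin := fun v => congrFun (congrArg Prod.fst h) v
  have h2 : ∀ x, edgeLabels σ x = .mat ↔ edgeLabels τ x = .mat := by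
    intro x
    have := Finset.ext_iff.1 (congrArg Prod.snd h) x
    simpa [frozenOfStates] using this
  have h3 : ∀ x, edgeLabels σ x = .occ ↔ edgeLabels τ x = .occ := by
    intro x
    have a := (σ x.1).label_eq_occ x.2
    have b := (τ x.1).label_eq_occ x.2
    rw [h1] at a
    exact a.trans b.symm
  have h4 : ∀ x, edgeLabels σ x = .tok ↔ edgeLabels τ x = .tok := by
    intro x
    have a := h3 (G.1 x)
    rw [hσ, hτ] at a
    cases h5 : edgeLabels σ x <;> cases h6 : edgeLabels τ x <;> simp_all [EdgeLabel.swap]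
  funext v
  have hv := h1 v
  rcases hs : σ v with _ | A | j <;> rcases ht : τ v with _ | B | l <;> rw [hs, ht] at hv <;>
    simp only [LocalState.spin, reduceCtorEq] at hv
  · congr 2
    apply Subtype.ext
    ext i
    have := h4 (v, i)
    simpa [edgeLabels, hs, ht, LocalState.label] using this
  · congr 2
    have := (h2 (v, j)).1 (by simp [edgeLabels, hs, LocalState.label])
    simpa [edgeLabels, ht, LocalState.label] using this

open Classical in
theorem exists_frozenOfStates_eq {n d : ℕ} (G : ConfigGraph n d) (η : Fin n → FrozenSpin)
    (m : Finset (Fin n × Fin d)) (h : G.IsFrozenConfig η m) :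
    ∃ σ : Fin n → LocalState d, (∀ h, edgeLabels σ (G.1 h) = (edgeLabels σ h).swap) ∧
      frozenOfStates σ = (η, m) := by
  -- The token set left implicit is the one whose size `zero_nbr` bounds, namely the half-edges
  -- matched to occupied vertices.
  let σ : Fin n → LocalState d := fun v =>
    if h1 : η v = .one then .inl () else
    if h0 : η v = .zero then .inr (.inl ⟨_, h.zero_nbr v h0⟩) else
    .inr (.inr (h.free_matched v (by cases hv : η v <;> simp_all)).choose)
  have s1 : ∀ v, η v = .one → σ v = .inl () := fun v hv => by simp [σ, hv]
  have s0 : ∀ v (h0 : η v = .zero), σ v = .inr (.inl ⟨_, h.zero_nbr v h0⟩) :=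
    fun v hv => by simp [σ, hv]
  have sf : ∀ v (hf : η v = .free), σ v = .inr (.inr (h.free_matched v hf).choose) :=
    fun v hv => by simp [σ, hv]
  have hspin : ∀ v, (σ v).spin = η v := by
    intro v
    cases hv : η v
    · rw [s0 v hv]; rfl
    · rw [s1 v hv]; rfl
    · rw [sf v hv]; rfl
  have docc : ∀ x, edgeLabels σ x = .occ ↔ η x.1 = .one := by
    intro x
    rw [← hspin]
    exact (σ x.1).label_eq_occ x.2
  have dmat : ∀ x, edgeLabels σ x = .mat ↔ x ∈ m := by
    intro x
    cases hv : η x.1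
    · refine ⟨fun hx => ?_, fun hx => ?_⟩
      · have := LocalState.spin_of_mat _ _ hx
        rw [hspin, hv] at this; cases this
      · have := h.matched_free x hx
        rw [hv] at this; cases this
    · refine ⟨fun hx => ?_, fun hx => ?_⟩
      · have := LocalState.spin_of_mat _ _ hx
        rw [hspin, hv] at this; cases this
      · have := h.matched_free x hx
        rw [hv] at this; cases this
    · have hs := (h.free_matched x.1 hv).choose_spec
      simp only [edgeLabels, sf _ hv, LocalState.label]
      constructor
      · intro hx
        split_ifs at hx with h1
        have h2 := hs.1
        rw [← h1] at h2; exact h2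
      · intro hx
        rw [if_pos (hs.2 x.2 hx)]
  have dtok : ∀ x, edgeLabels σ x = .tok ↔ η x.1 = .zero ∧ η (G.1 x).1 = .one := by
    intro x
    constructor
    · intro hx
      have h1 := LocalState.spin_of_tok _ _ hx
      rw [hspin] at h1
      refine ⟨h1, ?_⟩
      simp only [edgeLabels, s0 _ h1, LocalState.label] at hx
      split_ifs at hx with h2
      exact (Finset.mem_filter.1 h2).2
    · rintro ⟨h1, h2⟩
      simp only [edgeLabels, s0 _ h1, LocalState.label]
      rw [if_pos]
      exact Finset.mem_filter.2 ⟨Finset.mem_univ _, h2⟩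
  have inv : ∀ x, G.1 (G.1 x) = x := G.2.1
  have hto : ∀ x, edgeLabels σ (G.1 x) = .occ → edgeLabels σ x = .tok := by
    intro x hx
    rw [docc] at hx
    have := h.one_nbr _ hx
    rw [ConfigGraph.nbr, inv] at this
    exact (dtok x).2 ⟨this, hx⟩
  have ot : ∀ x, edgeLabels σ (G.1 x) = .tok → edgeLabels σ x = .occ := by
    intro x hx
    rw [dtok, inv] at hx
    exact (docc x).2 hx.2
  have mm : ∀ x, edgeLabels σ (G.1 x) = .mat → edgeLabels σ x = .mat := by
    intro x hx
    rw [dmat] at hx ⊢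
    have := h.closed _ hx
    rwa [inv] at this
  refine ⟨σ, fun x => ?_, ?_⟩
  -- The converse implications are the same three at the partner half-edge, as `G` is an involution.
  · have b1 := hto (G.1 x)
    have b2 := ot (G.1 x)
    have b3 := mm (G.1 x)
    rw [inv] at b1 b2 b3
    exact EdgeLabel.eq_swap_of_imp (hto x) (ot x) (mm x) b1 b2 b3
  · refine Prod.ext (funext hspin) ?_
    ext x
    simp [frozenOfStates, dmat]

open Classical in
-- With tokens recorded in the state, the constraints become a condition on each edge separately, so
-- the sums over graphs and over states can be exchanged.
theorem frozenPartition_eq_card {n d : ℕ} (G : ConfigGraph n d) (k : ℕ) :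
    frozenPartition G k = ((admissibleStates n d k).filter fun σ =>
      ∀ h, edgeLabels σ (G.1 h) = (edgeLabels σ h).swap).card := by
  symm
  refine Finset.card_bij (fun σ _ => frozenOfStates σ) ?_ ?_ ?_
  · intro σ hσ
    simp only [admissibleStates, Finset.mem_filter, Finset.mem_univ, true_and] at hσ ⊢
    exact ⟨isFrozenConfig_frozenOfStates G σ hσ.2, hσ.1.1, hσ.1.2⟩
  · intro σ hσ τ hτ h
    exact frozenOfStates_injOn G σ τ (Finset.mem_filter.1 hσ).2 (Finset.mem_filter.1 hτ).2 h
  · rintro ⟨η, m⟩ hz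
    simp only [Finset.mem_filter, Finset.mem_univ, true_and] at hz
    obtain ⟨σ, h1, h2⟩ := exists_frozenOfStates_eq G η m hz.1
    refine ⟨σ, ?_, h2⟩
    have h3 : ∀ v, (σ v).spin = η v := fun v => congrFun (congrArg Prod.fst h2) v
    simp only [admissibleStates, Finset.mem_filter, Finset.mem_univ, true_and, h3]
    exact ⟨hz.2, h1⟩

theorem sum_frozenPartition (n d k : ℕ) :
    ∑ G : ConfigGraph n d, (frozenPartition G k : ℝ) =
      ∑ σ ∈ admissibleStates n d k, (Nat.card (LabelledMatching (edgeLabels σ)) : ℝ) := by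
  classical
  have h1 : ∀ σ : Fin n → LocalState d, Nat.card (LabelledMatching (edgeLabels σ)) =
      ∑ G : ConfigGraph n d,
        if ∀ h, edgeLabels σ (G.1 h) = (edgeLabels σ h).swap then 1 else 0 := by
    intro σ
    rw [Finset.sum_boole, Nat.cast_id, ← Fintype.card_subtype, ← Nat.card_eq_fintype_card]
    refine Nat.card_congr ?_
    refine (Equiv.subtypeEquivRight fun M => ?_).trans
      (Equiv.subtypeSubtypeEquivSubtypeInter
        (fun M : Equiv.Perm (Fin n × Fin d) => (∀ h, M (M h) = h) ∧ ∀ h, M h ≠ h)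
        (fun M => ∀ h, edgeLabels σ (M h) = (edgeLabels σ h).swap)).symm
    simp [and_assoc]
  rw [← Nat.cast_sum, ← Nat.cast_sum]
  congr 1
  simp only [h1, frozenPartition_eq_card]
  rw [Finset.sum_comm]
  refine Finset.sum_congr rfl fun G _ => ?_
  rw [Finset.card_filter]

/-! ### Label counts and the number of graphs compatible with given states. -/

variable {n d : ℕ} (σ : Fin n → LocalState d)

/-- The number of vertices with a given spin. -/
def spinCount (s : FrozenSpin) : ℕ := (Finset.univ.filter fun v => (σ v).spin = s).card

theorem card_edgeLabels (l : EdgeLabel) : Nat.card {h // edgeLabels σ h = l} =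
    ∑ v, (Finset.univ.filter fun i => (σ v).label i = l).card := by
  classical
  rw [Nat.card_eq_fintype_card, Fintype.card_subtype]
  simp only [Finset.card_filter, Fintype.sum_prod_type]
  rfl

theorem card_edgeLabels_occ :
    Nat.card {h // edgeLabels σ h = .occ} = d * spinCount σ .one := by
  rw [card_edgeLabels, spinCount, Finset.card_filter, Finset.mul_sum]
  refine Finset.sum_congr rfl fun v _ => ?_
  simp only [LocalState.label_eq_occ]
  split_ifs with h <;> simp [h]

theorem card_edgeLabels_tok :
    Nat.card {h // edgeLabels σ h = .tok} = ∑ v, (σ v).tokens := by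
  rw [card_edgeLabels]
  refine Finset.sum_congr rfl fun v _ => ?_
  rcases σ v with _ | A | j <;> simp [LocalState.label, LocalState.tokens, ite_eq_iff]

theorem card_edgeLabels_mat :
    Nat.card {h // edgeLabels σ h = .mat} = spinCount σ .free := by
  rw [card_edgeLabels, spinCount, Finset.card_filter]
  refine Finset.sum_congr rfl fun v _ => ?_
  rcases σ v with _ | A | j <;>
    simp [LocalState.label, LocalState.spin, ite_eq_iff, Finset.filter_eq']

theorem sum_card_edgeLabels : Nat.card {h // edgeLabels σ h = .occ} +
    Nat.card {h // edgeLabels σ h = .tok} + Nat.card {h // edgeLabels σ h = .mat} +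
    Nat.card {h // edgeLabels σ h = .bulk} = n * d := by
  classical
  simp only [Nat.card_eq_fintype_card, Fintype.card_subtype, Finset.card_filter]
  rw [← Finset.sum_add_distrib, ← Finset.sum_add_distrib, ← Finset.sum_add_distrib]
  have : ∀ h : Fin n × Fin d, ((((if edgeLabels σ h = .occ then 1 else 0) +
      (if edgeLabels σ h = .tok then 1 else 0)) + (if edgeLabels σ h = .mat then 1 else 0)) +
      (if edgeLabels σ h = .bulk then 1 else 0)) = 1 := by
    intro h; cases edgeLabels σ h <;> simp
  simp [this]

/-- Every half-edge of an occupied vertex must meet a token, which forces the stated equality of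
totals. The remaining factors see the states only through `n₁` and `nf`. -/
theorem card_labelledMatching_edgeLabels :
    Nat.card (LabelledMatching (edgeLabels σ)) =
      if ∑ v, (σ v).tokens = d * spinCount σ .one then
        (d * spinCount σ .one).factorial * matchingCount (spinCount σ .free) *
          matchingCount (n * d - 2 * (d * spinCount σ .one) - spinCount σ .free) else 0 := by
  have h := sum_card_edgeLabels σ
  rw [card_labelledMatching]
  rw [card_edgeLabels_occ, card_edgeLabels_tok, card_edgeLabels_mat] at *
  by_cases h1 : ∑ v, (σ v).tokens = d * spinCount σ .one
  · rw [if_pos h1.symm, if_pos h1]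
    congr 2
    omega
  · rw [if_neg (Ne.symm h1), if_neg h1]

theorem card_configGraph (n d : ℕ) :
    Fintype.card (ConfigGraph n d) = matchingCount (n * d) := by
  rw [← Nat.card_eq_fintype_card, card_fixedPointFree_involutions]
  simp

/-! ### Stirling bounds with logarithmic error. -/

/-- `N ^ N / N!` is a single term of the series of `exp N`. -/
theorem le_log_factorial (N : ℕ) : N * Real.log N - N ≤ Real.log N.factorial := by
  rcases Nat.eq_zero_or_pos N with rfl | hN
  · simp
  have hN' : (0 : ℝ) < N := by exact_mod_cast hN
  have h := Real.pow_div_factorial_le_exp (N : ℝ) hN'.le N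
  have h1 := Real.log_le_log (by positivity) h
  rw [Real.log_exp, Real.log_div (by positivity) (by positivity), Real.log_pow] at h1
  linarith

theorem one_sub_inv_le_log_div {x y : ℝ} (hx : 0 < x) (hy : 0 < y) :
    1 - y / x ≤ Real.log x - Real.log y := by
  have := Real.one_sub_inv_le_log_of_pos (div_pos hx hy)
  rwa [Real.log_div hx.ne' hy.ne', inv_div] at this

theorem log_sub_log_le {x y : ℝ} (hx : 0 < x) (hy : 0 < y) :
    Real.log x - Real.log y ≤ x / y - 1 := by
  have := Real.log_le_sub_one_of_pos (div_pos hx hy)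
  rwa [Real.log_div hx.ne' hy.ne'] at this

theorem log_factorial_le (N : ℕ) :
    Real.log N.factorial ≤ N * Real.log N - N + 2 * Real.log (N + 1) := by
  induction N with
  | zero => simp
  | succ N ih =>
    rw [Nat.factorial_succ]
    push_cast
    rw [Real.log_mul (by positivity) (by positivity)]
    have h2 := one_sub_inv_le_log_div (x := (N : ℝ) + 1 + 1) (y := N + 1) (by positivity)
      (by positivity)
    have h1 : (N : ℝ) * (Real.log (N + 1) - Real.log N) ≥ N * (1 - N / (N + 1)) := by
      rcases Nat.eq_zero_or_pos N with rfl | hN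
      · simp
      · have hN' : (0 : ℝ) < N := by exact_mod_cast hN
        exact mul_le_mul_of_nonneg_left (one_sub_inv_le_log_div (by positivity) hN') hN'.le
    have h3 : (N : ℝ) * (1 - N / (N + 1)) + 2 * (1 - (N + 1) / (N + 1 + 1)) - 1 ≥ 0 := by
      have : (N : ℝ) * (1 - N / (N + 1)) + 2 * (1 - (N + 1) / (N + 1 + 1)) - 1 =
        N / ((N + 1) * (N + 2)) := by
        field_simp; ring
      rw [this]; positivity
    linarith

theorem two_pow_mul_factorial_dvd (m : ℕ) : 2 ^ m * m.factorial ∣ (2 * m).factorial := by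
  rcases m with _ | m
  · simp
  · rw [← Nat.doubleFactorial_two_mul, show 2 * (m + 1) = (2 * m + 1) + 1 by ring,
      Nat.factorial_eq_mul_doubleFactorial]
    exact Dvd.intro _ rfl

theorem matchingCount_two_mul (m : ℕ) :
    (matchingCount (2 * m) : ℝ) = (2 * m).factorial / (2 ^ m * m.factorial) := by
  unfold matchingCount
  have h2 : 2 * m / 2 = m := by omega
  rw [if_pos (even_two_mul m), h2, Nat.cast_div (two_pow_mul_factorial_dvd m) (by positivity)]
  push_cast; rfl

theorem matchingCount_pos {N : ℕ} (hN : Even N) : 0 < matchingCount N := by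
  obtain ⟨m, rfl⟩ := hN
  rw [← two_mul]
  have : (0 : ℝ) < matchingCount (2 * m) := by
    rw [matchingCount_two_mul]; positivity
  exact_mod_cast this

theorem log_matchingCount_aux (m : ℕ) : Real.log (matchingCount (2 * m)) =
    Real.log (2 * m).factorial - m * Real.log 2 - Real.log m.factorial := by
  rw [matchingCount_two_mul, Real.log_div (by positivity) (by positivity),
    Real.log_mul (by positivity) (by positivity), Real.log_pow]
  ring

theorem mul_log_two_mul (m : ℕ) :
    (m : ℝ) * Real.log 2 + m * Real.log m = m * Real.log ((2 * m : ℕ) : ℝ) := by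
  rcases Nat.eq_zero_or_pos m with rfl | hm
  · simp
  have hN' : (0 : ℝ) < m := by exact_mod_cast hm
  push_cast
  rw [Real.log_mul two_ne_zero hN'.ne']
  ring

theorem log_matchingCount_le {N : ℕ} (hN : Even N) :
    Real.log (matchingCount N) ≤ (N * Real.log N - N) / 2 + 2 * Real.log (N + 1) := by
  obtain ⟨m, rfl⟩ := hN
  rw [← two_mul, log_matchingCount_aux]
  have h1 := log_factorial_le (2 * m)
  have h2 := le_log_factorial m
  have h3 := mul_log_two_mul m
  push_cast at *
  linarith

theorem le_log_matchingCount {N : ℕ} (hN : Even N) :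
    (N * Real.log N - N) / 2 - 2 * Real.log (N + 1) ≤ Real.log (matchingCount N) := by
  obtain ⟨m, rfl⟩ := hN
  rw [← two_mul, log_matchingCount_aux]
  have h1 := le_log_factorial (2 * m)
  have h2 := log_factorial_le m
  have h3 := mul_log_two_mul m
  have h4 : Real.log ((m : ℝ) + 1) ≤ Real.log (2 * m + 1) :=
    Real.log_le_log (by positivity) (by linarith [Nat.cast_nonneg (α := ℝ) m])
  push_cast at *
  linarith

/-! ### Chernoff upper bound for the first moment. -/

/-- The generating polynomial of sets of at least two half-edges. -/
noncomputable def tokenPoly (d : ℕ) (x : ℝ) : ℝ := (1 + x) ^ d - 1 - d * x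

theorem sum_pow_card_of_two_le (d : ℕ) (x : ℝ) :
    ∑ A : {A : Finset (Fin d) // 2 ≤ A.card}, x ^ A.1.card = tokenPoly d x := by
  classical
  have h1 : ∑ A : Finset (Fin d), x ^ A.card = (1 + x) ^ d := by
    have := Fintype.sum_pow_mul_eq_add_pow (Fin d) x (1 : ℝ)
    simpa [add_comm] using this
  have h2 := Fintype.sum_subtype_add_sum_subtype (fun A : Finset (Fin d) => 2 ≤ A.card)
    (fun A => x ^ A.card)
  have h3 : ∑ A : {A : Finset (Fin d) // ¬ 2 ≤ A.card}, x ^ A.1.card = 1 + d * x := by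
    rw [← Finset.sum_subtype (Finset.univ.filter fun A : Finset (Fin d) => ¬ 2 ≤ A.card)
      (by simp) (fun A => x ^ A.card)]
    have : (Finset.univ.filter fun A : Finset (Fin d) => ¬ 2 ≤ A.card) =
        Finset.powersetCard 0 Finset.univ ∪ Finset.powersetCard 1 Finset.univ := by
      ext A
      simp only [Finset.mem_filter, Finset.mem_univ, true_and, Finset.mem_union,
        Finset.mem_powersetCard, Finset.subset_univ]
      omega
    rw [this, Finset.sum_union, Finset.sum_congr rfl (g := fun _ => (1 : ℝ)),
      Finset.sum_congr (s₁ := Finset.powersetCard 1 _) rfl (g := fun _ => x)]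
    · simp
    · intro A hA; rw [(Finset.mem_powersetCard.1 hA).2, pow_one]
    · intro A hA; rw [(Finset.mem_powersetCard.1 hA).2, pow_zero]
    · exact Finset.pairwise_disjoint_powersetCard _ zero_ne_one
  rw [tokenPoly, ← h1, ← h2, h3]
  ring

/-- Weights of local states. -/
def LocalState.weight {d : ℕ} (w₁ w₀ wf x : ℝ) : LocalState d → ℝ
  | .inl _ => w₁
  | .inr (.inl A) => w₀ * x ^ A.1.card
  | .inr (.inr _) => wf

theorem LocalState.sum_weight {d : ℕ} (w₁ w₀ wf x : ℝ) :
    ∑ s : LocalState d, s.weight w₁ w₀ wf x = w₁ + w₀ * tokenPoly d x + d * wf := by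
  rw [Fintype.sum_sum_type, Fintype.sum_sum_type, ← sum_pow_card_of_two_le, Finset.mul_sum]
  simp [LocalState.weight]
  ring

theorem prod_weight {n d : ℕ} (σ : Fin n → LocalState d) (w₁ w₀ wf x : ℝ) :
    ∏ v, (σ v).weight w₁ w₀ wf x = w₁ ^ spinCount σ .one * w₀ ^ spinCount σ .zero *
      wf ^ spinCount σ .free * x ^ ∑ v, (σ v).tokens := by
  simp only [spinCount, Finset.card_filter, ← Finset.prod_pow_eq_pow_sum, ← Finset.prod_mul_distrib]
  refine Finset.prod_congr rfl fun v _ => ?_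
  rcases σ v with _ | A | j <;> simp [LocalState.weight, LocalState.spin, LocalState.tokens]

theorem spinCount_add {n d : ℕ} (σ : Fin n → LocalState d) :
    spinCount σ .one + spinCount σ .zero + spinCount σ .free = n := by
  simp only [spinCount, Finset.card_filter]
  rw [← Finset.sum_add_distrib, ← Finset.sum_add_distrib]
  have : ∀ v, (((if (σ v).spin = .one then 1 else 0) + (if (σ v).spin = .zero then 1 else 0)) +
      (if (σ v).spin = .free then 1 else 0)) = 1 := by
    intro v; cases (σ v).spin <;> simp
  simp [this]

/-- Expand the `n`-th power of the total weight over all families of states: each family with the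
prescribed totals contributes the same product, and all other terms are nonnegative. -/
theorem card_mul_weight_le {n d : ℕ} (n₁ nf T : ℕ) {w₁ w₀ wf x : ℝ} (h₁ : 0 ≤ w₁) (h₀ : 0 ≤ w₀)
    (hf : 0 ≤ wf) (hx : 0 ≤ x) :
    ((Finset.univ.filter fun σ : Fin n → LocalState d =>
      spinCount σ .one = n₁ ∧ spinCount σ .free = nf ∧ ∑ v, (σ v).tokens = T).card : ℝ) *
      (w₁ ^ n₁ * w₀ ^ (n - n₁ - nf) * wf ^ nf * x ^ T) ≤
      (w₁ + w₀ * tokenPoly d x + d * wf) ^ n := by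
  rw [← LocalState.sum_weight, Fintype.sum_pow, ← nsmul_eq_mul, ← Finset.sum_const]
  refine le_trans (Finset.sum_le_sum (g := fun σ => ∏ v, (σ v).weight w₁ w₀ wf x) ?_) ?_
  · intro σ hσ
    simp only [Finset.mem_filter, Finset.mem_univ, true_and] at hσ
    have := spinCount_add σ
    rw [prod_weight, hσ.1, hσ.2.1, hσ.2.2]
    have : spinCount σ .zero = n - n₁ - nf := by omega
    rw [this]
  · refine Finset.sum_le_sum_of_subset_of_nonneg (Finset.subset_univ _) fun σ _ _ =>
      Finset.prod_nonneg fun v _ => ?_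
    rcases σ v with _ | A | j <;> simp only [LocalState.weight] <;> positivity

/-- The exponential rate of the contribution to the first moment of configurations with a density
`a` of occupied vertices and a density `b` of free vertices; `x` is a Chernoff parameter. -/
noncomputable def frozenRate (d : ℕ) (a b x : ℝ) : ℝ :=
  -(a * Real.log a) - (1 - a - b) * Real.log (1 - a - b) - b / 2 * Real.log b + b * Real.log d
    + (1 - a - b) * Real.log (tokenPoly d x) - d * a * Real.log x + d * a * Real.log (d * a)
    + (d * (1 - 2 * a) - b) / 2 * Real.log (d * (1 - 2 * a) - b) - d / 2 * Real.log d

theorem tokenPoly_pos {d : ℕ} (hd : 2 ≤ d) {x : ℝ} (hx : 0 < x) : 0 < tokenPoly d x := by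
  have := one_add_mul_self_lt_rpow_one_add (s := x) (by linarith) hx.ne' (p := d)
    (by exact_mod_cast hd)
  rw [Real.rpow_natCast] at this
  unfold tokenPoly
  linarith

theorem pow_eq_exp_mul_log {w : ℝ} {m : ℕ} (hw : 0 ≤ w) (h : w = 0 → m = 0) :
    w ^ m = Real.exp (m * Real.log w) := by
  rcases hw.eq_or_lt with h0 | h0
  · rw [h h0.symm]; simp
  · rw [mul_comm, ← Real.rpow_def_of_pos h0, Real.rpow_natCast]

theorem mul_log_div_eq {m n : ℝ} (hn : n ≠ 0) :
    m * Real.log (m / n) = m * Real.log m - m * Real.log n := by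
  rcases eq_or_ne m 0 with rfl | hm
  · simp
  · rw [Real.log_div hm hn]; ring

/-- `n` times the rate, in terms of integer counts. -/
theorem mul_frozenRate {d n : ℕ} (hd : 2 ≤ d) (hn : 0 < n) (n₁ nf : ℝ) (x : ℝ) :
    n * frozenRate d (n₁ / n) (nf / n) x =
      -(n₁ * Real.log n₁) - (n - n₁ - nf) * Real.log (n - n₁ - nf) - nf / 2 * Real.log nf
      + nf * Real.log d + (n - n₁ - nf) * Real.log (tokenPoly d x) - d * n₁ * Real.log x
      + d * n₁ * Real.log (d * n₁)
      + (n * d - 2 * (d * n₁) - nf) / 2 * Real.log (n * d - 2 * (d * n₁) - nf)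
      - n * d / 2 * Real.log (n * d) + n * Real.log n := by
  have hn' : (0 : ℝ) < n := by exact_mod_cast hn
  have hd' : (0 : ℝ) < d := by exact_mod_cast (by omega : 0 < d)
  have e1 : (1 : ℝ) - n₁ / n - nf / n = (n - n₁ - nf) / n := by field_simp
  have e2 : (d : ℝ) * (n₁ / n) = (d * n₁) / n := by ring
  have e3 : (d : ℝ) * (1 - 2 * (n₁ / n)) - nf / n = (n * d - 2 * (d * n₁) - nf) / n := by
    field_simp
  unfold frozenRate
  rw [e1, e2, e3]
  have l1 := mul_log_div_eq (m := n₁) hn'.ne'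
  have l2 := mul_log_div_eq (m := (n - n₁ - nf : ℝ)) hn'.ne'
  have l3 := mul_log_div_eq (m := nf) hn'.ne'
  have l4 := mul_log_div_eq (m := (d * n₁ : ℝ)) hn'.ne'
  have l5 := mul_log_div_eq (m := (n * d - 2 * (d * n₁) - nf : ℝ)) hn'.ne'
  rw [Real.log_mul hn'.ne' hd'.ne']
  generalize Real.log (n₁ / n) = A₁ at *
  generalize Real.log ((n - n₁ - nf) / n) = A₂ at *
  generalize Real.log (nf / n) = A₃ at *
  generalize Real.log (d * n₁ / n) = A₄ at *
  generalize Real.log ((n * d - 2 * (d * n₁) - nf) / n) = A₅ at *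
  generalize Real.log (n * d - 2 * (d * n₁) - nf) = B₅ at *
  generalize Real.log (d * n₁) = B₄ at *
  generalize Real.log (n - n₁ - nf) = B₂ at *
  field_simp
  linear_combination (-2) * l1 - 2 * l2 - l3 + 2 * l4 + l5

theorem term_le {d n n₁ nf : ℕ} (hd : 2 ≤ d) (hn : 0 < n) (hev : Even (n * d)) (hf : Even nf)
    (hn₁ : 0 < n₁) (h₀ : n₁ + nf < n) (hR : 2 * (d * n₁) + nf ≤ n * d) {x : ℝ} (hx : 0 < x) :
    ((Finset.univ.filter fun σ : Fin n → LocalState d =>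
      spinCount σ .one = n₁ ∧ spinCount σ .free = nf ∧ ∑ v, (σ v).tokens = d * n₁).card : ℝ) *
      ((d * n₁).factorial * matchingCount nf * matchingCount (n * d - 2 * (d * n₁) - nf)
        / matchingCount (n * d)) ≤
      Real.exp (n * frozenRate d (n₁ / n) (nf / n) x + 8 * Real.log (n * d + 1)) := by
  have hn' : (0 : ℝ) < n := by exact_mod_cast hn
  have hd' : (0 : ℝ) < d := by exact_mod_cast (by omega : 0 < d)
  have hn₁' : (0 : ℝ) < n₁ := by exact_mod_cast hn₁
  have h₀' : (0 : ℝ) < n - n₁ - nf := by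
    have : (n₁ : ℝ) + nf < n := by exact_mod_cast h₀
    linarith
  have hg := tokenPoly_pos hd hx
  obtain ⟨n0, rfl⟩ : ∃ n0, n = n0 + n₁ + nf := ⟨n - n₁ - nf, by omega⟩
  set n := n0 + n₁ + nf with hndef
  have hn0 : (n0 : ℝ) = n - n₁ - nf := by rw [hndef]; push_cast; ring
  obtain ⟨R, hRdef⟩ : ∃ R, n * d = R + 2 * (d * n₁) + nf := ⟨n * d - 2 * (d * n₁) - nf, by omega⟩
  have hRsub : n * d - 2 * (d * n₁) - nf = R := by omega
  have hReal : (R : ℝ) = n * d - 2 * (d * n₁) - nf := by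
    have : ((n * d : ℕ) : ℝ) = (R + 2 * (d * n₁) + nf : ℕ) := by rw [hRdef]
    push_cast at this; linarith
  have hRev : Even R := by
    have h2 : Even (2 * (d * n₁)) := even_two_mul _
    have h3 : Even (R + 2 * (d * n₁) + nf) := hRdef ▸ hev
    have h4 := (Nat.even_add.1 h3).2 hf
    exact (Nat.even_add.1 h4).2 h2
  -- Weights of total one that give each spin its empirical frequency; only the token parameter `x`
  -- is left free.
  have key := card_mul_weight_le (n := n) (d := d) n₁ nf (d * n₁) (w₁ := n₁ / n)
    (w₀ := (n0 / n) / tokenPoly d x) (wf := (nf / n) / d) (x := x) (by positivity)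
    (by positivity) (by positivity) hx.le
  have hone : (n₁ / n + (n0 / n) / tokenPoly d x * tokenPoly d x + d * ((nf / n) / d) : ℝ) = 1 := by
    rw [hn0]
    field_simp
    ring
  rw [hone, one_pow, show n - n₁ - nf = n0 by omega] at key
  rw [hn0] at key
  rw [pow_eq_exp_mul_log (w := (n₁ : ℝ) / n) (by positivity) (fun h => by
      rw [div_eq_zero_iff] at h; rcases h with h | h <;> linarith),
    pow_eq_exp_mul_log (w := ((n - n₁ - nf : ℝ) / n / tokenPoly d x)) (by positivity) (fun h => by
      have : 0 < (n - n₁ - nf : ℝ) / n / tokenPoly d x := by positivity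
      linarith),
    pow_eq_exp_mul_log (w := ((nf : ℝ) / n / d)) (by positivity) (fun h => by
      rw [div_eq_zero_iff, div_eq_zero_iff] at h
      rcases h with (h | h) | h
      · exact_mod_cast h
      · linarith
      · linarith),
    pow_eq_exp_mul_log hx.le (fun h => by linarith), ← Real.exp_add, ← Real.exp_add,
    ← Real.exp_add] at key
  set c := ((Finset.univ.filter fun σ : Fin n → LocalState d =>
      spinCount σ .one = n₁ ∧ spinCount σ .free = nf ∧ ∑ v, (σ v).tokens = d * n₁).card : ℝ)
  set E₁ := (n₁ : ℝ) * Real.log (n₁ / n) + n0 * Real.log ((n - n₁ - nf : ℝ) / n / tokenPoly d x)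
    + nf * Real.log (nf / n / d) + (d * n₁ : ℕ) * Real.log x with hE₁
  have hc : c ≤ Real.exp (-E₁) := by
    rw [Real.exp_neg, ← one_div, le_div_iff₀ (Real.exp_pos _)]
    exact key
  have hpos1 : (0 : ℝ) < matchingCount nf := by exact_mod_cast matchingCount_pos hf
  have hpos2 : (0 : ℝ) < matchingCount R := by exact_mod_cast matchingCount_pos hRev
  have hpos3 : (0 : ℝ) < matchingCount (n * d) := by exact_mod_cast matchingCount_pos hev
  rw [hRsub]
  set Q : ℝ := (d * n₁).factorial * matchingCount nf * matchingCount R / matchingCount (n * d)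
    with hQ
  have hQpos : 0 < Q := by positivity
  have hQlog : Real.log Q = Real.log (d * n₁).factorial + Real.log (matchingCount nf) +
      Real.log (matchingCount R) - Real.log (matchingCount (n * d)) := by
    rw [hQ, Real.log_div (by positivity) hpos3.ne', Real.log_mul (by positivity) hpos2.ne',
      Real.log_mul (by positivity) hpos1.ne']
  calc c * Q ≤ Real.exp (-E₁) * Q := by gcongr
    _ = Real.exp (-E₁ + Real.log Q) := by rw [Real.exp_add, Real.exp_log hQpos]
    _ ≤ _ := by
      apply Real.exp_le_exp.2
      rw [hQlog, mul_frozenRate hd hn]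
      -- The linear Stirling terms cancel, as `d * n₁ + (nf + R) / 2 = n * d / 2`. Each of the four
      -- logarithmic errors is at most `2 log (n d + 1)`.
      have b1 := log_factorial_le (d * n₁)
      have b2 := log_matchingCount_le hf
      have b3 := log_matchingCount_le hRev
      have b4 := le_log_matchingCount hev
      have mono : ∀ m : ℕ, m ≤ n * d → Real.log ((m : ℝ) + 1) ≤ Real.log (n * d + 1) := by
        intro m hm
        apply Real.log_le_log (by positivity)
        have : (m : ℝ) ≤ (n * d : ℕ) := by exact_mod_cast hm
        push_cast at this
        linarith
      have m1 := mono (d * n₁) (by omega)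
      have m2 := mono nf (by omega)
      have m3 := mono R (by omega)
      have l1 := mul_log_div_eq (m := (n₁ : ℝ)) hn'.ne'
      have l2 := mul_log_div_eq (m := (n - n₁ - nf : ℝ)) hn'.ne'
      have l3 := mul_log_div_eq (m := (nf : ℝ)) hn'.ne'
      have l4 : (nf : ℝ) * Real.log (nf / n / d) = nf * Real.log (nf / n) - nf * Real.log d := by
        rcases Nat.eq_zero_or_pos nf with h | h
        · simp [h]
        · have : (0 : ℝ) < nf := by exact_mod_cast h
          rw [Real.log_div (by positivity) hd'.ne']; ring
      have l5 : Real.log ((n - n₁ - nf : ℝ) / n / tokenPoly d x) =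
          Real.log ((n - n₁ - nf : ℝ) / n) - Real.log (tokenPoly d x) :=
        Real.log_div (by positivity) hg.ne'
      rw [hE₁, l5, l4, l1, l3, hn0, mul_sub, l2]
      rw [hReal] at b3 m3
      push_cast at *
      linarith

/-- For fixed `k` the number of free vertices determines the number of occupied ones. At most `n +
1` values occur, whence the term `log (n + 1)`. -/
theorem expectedFrozenPartition_le {d n k : ℕ} (hd : 2 ≤ d) (hn : 0 < n) (hev : Even (n * d))
    (B : ℝ) (h : ∀ n₁ nf : ℕ, 2 * n₁ + nf = 2 * k → (nf : ℝ) ≤ (d : ℝ) ^ (-(3 / 2) : ℝ) * n →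
      0 < n₁ ∧ n₁ + nf < n ∧ 2 * (d * n₁) + nf ≤ n * d ∧
      ∃ x : ℝ, 0 < x ∧ frozenRate d (n₁ / n) (nf / n) x ≤ B) :
    expectedFrozenPartition d n k ≤
      Real.exp (n * B + 8 * Real.log (n * d + 1) + Real.log (n + 1)) := by
  classical
  have hpos3 : (0 : ℝ) < matchingCount (n * d) := by exact_mod_cast matchingCount_pos hev
  unfold expectedFrozenPartition
  rw [sum_frozenPartition, card_configGraph, Finset.sum_div,
    ← Finset.sum_fiberwise_of_maps_to (s := admissibleStates n d k) (t := Finset.range (n + 1))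
      (g := fun σ => spinCount σ .free)
      (fun σ _ => by
        have := spinCount_add σ
        simp only [Finset.mem_range]; omega)]
  have main : ∀ nf ∈ Finset.range (n + 1),
      ∑ σ ∈ (admissibleStates n d k).filter fun σ => spinCount σ .free = nf,
        (Nat.card (LabelledMatching (edgeLabels σ)) : ℝ) / matchingCount (n * d) ≤
      Real.exp (n * B + 8 * Real.log (n * d + 1)) := by
    intro nf _
    rcases Finset.eq_empty_or_nonempty
      ((admissibleStates n d k).filter fun σ => spinCount σ .free = nf) with he | ⟨σ₀, hσ₀⟩
    · rw [he, Finset.sum_empty]; positivity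
    have hmem : ∀ σ ∈ (admissibleStates n d k).filter fun σ => spinCount σ .free = nf,
        2 * spinCount σ .one + nf = 2 * k ∧ (nf : ℝ) ≤ (d : ℝ) ^ (-(3 / 2) : ℝ) * n ∧
          spinCount σ .free = nf := by
      intro σ hσ
      simp only [admissibleStates, Finset.mem_filter, Finset.mem_univ, true_and] at hσ
      obtain ⟨⟨h1, h2⟩, h3⟩ := hσ
      refine ⟨?_, ?_, h3⟩
      · rw [← h3]; exact h1
      · rw [← h3]; exact h2
    set n₁ := spinCount σ₀ .one with hn₁
    obtain ⟨h1, h2, -⟩ := hmem σ₀ hσ₀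
    obtain ⟨p1, p2, p3, x, hx, hB⟩ := h n₁ nf h1 h2
    refine le_trans ?_ ((term_le hd hn hev ⟨k - n₁, by omega⟩ p1 p2 p3 hx).trans
      (Real.exp_le_exp.2 (by gcongr)))
    rw [← nsmul_eq_mul, ← Finset.sum_const]
    rw [← Finset.sum_filter_add_sum_filter_not _
      (fun σ : Fin n → LocalState d => ∑ v, (σ v).tokens = d * n₁)]
    have hone : ∀ σ ∈ (admissibleStates n d k).filter fun σ => spinCount σ .free = nf,
        spinCount σ .one = n₁ := by
      intro σ hσ
      have := (hmem σ hσ).1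
      omega
    rw [Finset.sum_eq_zero (s := Finset.filter (fun σ => ¬ _) _), add_zero]
    · refine (Finset.sum_le_sum (g := fun _ => ((d * n₁).factorial * matchingCount nf *
        matchingCount (n * d - 2 * (d * n₁) - nf) / matchingCount (n * d) : ℝ)) ?_).trans
        (Finset.sum_le_sum_of_subset_of_nonneg ?_ fun _ _ _ => by positivity)
      · intro σ hσ
        obtain ⟨hσ, hT⟩ := Finset.mem_filter.1 hσ
        rw [card_labelledMatching_edgeLabels, hone σ hσ, if_pos hT, (hmem σ hσ).2.2]
        push_cast
        exact le_rfl
      · intro σ hσ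
        obtain ⟨hσ, hT⟩ := Finset.mem_filter.1 hσ
        simp only [Finset.mem_filter, Finset.mem_univ, true_and]
        exact ⟨hone σ hσ, (hmem σ hσ).2.2, hT⟩
    · intro σ hσ
      obtain ⟨hσ, hT⟩ := Finset.mem_filter.1 hσ
      rw [card_labelledMatching_edgeLabels, hone σ hσ, if_neg hT]
      simp
  refine (Finset.sum_le_sum main).trans ?_
  rw [Finset.sum_const, Finset.card_range, nsmul_eq_mul, Real.exp_add _ (Real.log _),
    Real.exp_log (by positivity), mul_comm]
  push_cast
  exact le_rfl

/-! ### Lower bound from a single type class. -/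

/-- Permutations of the indices act on the class: each fibre of `g ↦ σ₀ ∘ g` is a coset of the
stabilizer of `σ₀`, which has `∏ (N s)!` elements. -/
theorem factorial_le_card_typeClass {n : ℕ} {S : Type*} [Fintype S] [DecidableEq S] (N : S → ℕ)
    (hN : ∑ s, N s = n) :
    n.factorial ≤ (Finset.univ.filter fun σ : Fin n → S =>
      ∀ s, (Finset.univ.filter fun v => σ v = s).card = N s).card * ∏ s, (N s).factorial := by
  classical
  obtain ⟨σ₀, hσ₀⟩ : ∃ σ₀ : Fin n → S,
      ∀ s, (Finset.univ.filter fun v => σ₀ v = s).card = N s := by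
    have hc : Fintype.card (Fin n) = Fintype.card (Σ s, Fin (N s)) := by simp [hN]
    let e := Fintype.equivOfCardEq hc
    refine ⟨fun v => (e v).1, fun s => ?_⟩
    rw [← Fintype.card_subtype, Fintype.card_congr (e.subtypeEquiv (q := fun z => z.1 = s)
      (fun _ => Iff.rfl)), Fintype.card_congr (Equiv.sigmaSubtype s), Fintype.card_fin]
  have hstab : ∀ g : Equiv.Perm (Fin n),
      (Finset.univ.filter fun g' : Equiv.Perm (Fin n) => σ₀ ∘ g' = σ₀ ∘ g).card =
        ∏ s, (N s).factorial := by
    intro g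
    have h1 := DomMulAct.stabilizer_card σ₀
    simp only [Fintype.card_subtype, hσ₀] at h1
    rw [← h1]
    refine Finset.card_bij (fun g' _ => g' * g⁻¹) ?_ ?_ ?_
    · intro g' hg'
      simp only [Finset.mem_filter, Finset.mem_univ, true_and] at hg' ⊢
      funext v
      have := congrFun hg' (g⁻¹ v)
      simpa using this
    · intro a _ b _ h
      exact mul_right_cancel h
    · intro b hb
      refine ⟨b * g, ?_, by simp⟩
      simp only [Finset.mem_filter, Finset.mem_univ, true_and] at hb ⊢
      funext v
      exact congrFun hb (g v)
  have h2 := Finset.card_le_mul_card_image (f := fun g : Equiv.Perm (Fin n) => σ₀ ∘ g)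
    Finset.univ (∏ s, (N s).factorial) (by
      intro b hb
      obtain ⟨g, -, rfl⟩ := Finset.mem_image.1 hb
      exact (hstab g).le)
  rw [Finset.card_univ, Fintype.card_perm, Fintype.card_fin, mul_comm] at h2
  refine h2.trans (Nat.mul_le_mul_right _ (Finset.card_le_card ?_))
  intro τ hτ
  obtain ⟨g, -, rfl⟩ := Finset.mem_image.1 hτ
  simp only [Finset.mem_filter, Finset.mem_univ, true_and, Function.comp]
  intro s
  rw [← hσ₀ s, ← Fintype.card_subtype, ← Fintype.card_subtype]
  exact Fintype.card_congr (g.subtypeEquiv fun _ => Iff.rfl)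

theorem sum_comp_eq_sum_count {n : ℕ} {S : Type*} [Fintype S] [DecidableEq S] (σ : Fin n → S)
    (f : S → ℕ) : ∑ v, f (σ v) = ∑ s, (Finset.univ.filter fun v => σ v = s).card * f s := by
  rw [← Finset.sum_fiberwise (s := Finset.univ) (g := σ)]
  refine Finset.sum_congr rfl fun s _ => ?_
  rw [Finset.sum_congr rfl (g := fun _ => f s) (fun v hv => by rw [(Finset.mem_filter.1 hv).2]),
    Finset.sum_const, smul_eq_mul]

/-- One type class bounds the first moment from below. -/
theorem le_expectedFrozenPartition {d n k n₁ nf : ℕ} (hev : Even (n * d)) (N : LocalState d → ℕ)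
    (hN : ∑ s, N s = n) (h₁ : N (.inl ()) = n₁) (hf : ∑ i, N (.inr (.inr i)) = nf)
    (hT : ∑ A, N (.inr (.inl A)) * A.1.card = d * n₁) (hk : 2 * n₁ + nf = 2 * k)
    (hb : (nf : ℝ) ≤ (d : ℝ) ^ (-(3 / 2) : ℝ) * n) :
    (n.factorial : ℝ) / (∏ s, ((N s).factorial : ℝ)) * ((d * n₁).factorial * matchingCount nf *
      matchingCount (n * d - 2 * (d * n₁) - nf) / matchingCount (n * d)) ≤
      expectedFrozenPartition d n k := by
  classical
  have hpos3 : (0 : ℝ) < matchingCount (n * d) := by exact_mod_cast matchingCount_pos hev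
  have hty := factorial_le_card_typeClass N hN
  set 𝒯 := Finset.univ.filter fun σ : Fin n → LocalState d =>
    ∀ s, (Finset.univ.filter fun v => σ v = s).card = N s with h𝒯
  have hty' : (n.factorial : ℝ) / (∏ s, ((N s).factorial : ℝ)) ≤ 𝒯.card := by
    rw [div_le_iff₀ (Finset.prod_pos fun s _ => by positivity)]
    exact_mod_cast hty
  have hprop : ∀ σ ∈ 𝒯, spinCount σ .one = n₁ ∧ spinCount σ .free = nf ∧
      ∑ v, (σ v).tokens = d * n₁ := by
    intro σ hσ
    have hσ := (Finset.mem_filter.1 hσ).2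
    refine ⟨?_, ?_, ?_⟩
    · have := sum_comp_eq_sum_count σ (fun s => if s.spin = .one then 1 else 0)
      rw [spinCount, Finset.card_filter, this]
      simp [hσ, LocalState.spin, h₁]
    · have := sum_comp_eq_sum_count σ (fun s => if s.spin = .free then 1 else 0)
      rw [spinCount, Finset.card_filter, this]
      simp [hσ, LocalState.spin, hf]
    · rw [sum_comp_eq_sum_count σ LocalState.tokens]
      simp [hσ, LocalState.tokens, hT]
  unfold expectedFrozenPartition
  rw [sum_frozenPartition, card_configGraph, Finset.sum_div]
  refine le_trans (mul_le_mul_of_nonneg_right hty' (by positivity)) ?_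
  rw [← nsmul_eq_mul, ← Finset.sum_const]
  refine le_trans (Finset.sum_le_sum (g := fun σ =>
    (Nat.card (LabelledMatching (edgeLabels σ)) : ℝ) / matchingCount (n * d)) ?_)
    (Finset.sum_le_sum_of_subset_of_nonneg ?_ fun _ _ _ => by positivity)
  · intro σ hσ
    obtain ⟨p1, p2, p3⟩ := hprop σ hσ
    rw [card_labelledMatching_edgeLabels, p1, p2, p3, if_pos rfl]
    push_cast
    exact le_rfl
  · intro σ hσ
    obtain ⟨p1, p2, p3⟩ := hprop σ hσ
    simp only [admissibleStates, Finset.mem_filter, Finset.mem_univ, true_and]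
    refine ⟨?_, ?_⟩
    · rw [← p1, ← p2] at hk; exact hk
    · rw [← p2] at hb; exact hb

/-! ### Limits of normalized log-factorials. -/

section Asymptotics

variable {ι : Type*} {F : Filter ι} {n : ι → ℕ}

theorem tendsto_log_succ_div (d : ℕ) (hn : Tendsto n F atTop) :
    Tendsto (fun p => Real.log (n p * d + 1) / n p) F (𝓝 0) := by
  have h1 : Tendsto (fun x : ℝ => Real.log x / x) atTop (𝓝 0) := by
    simpa using Real.isLittleO_log_id_atTop.tendsto_div_nhds_zero
  have hn' : Tendsto (fun p => (n p : ℝ)) F atTop := tendsto_natCast_atTop_atTop.comp hn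
  have h2 : Tendsto (fun p => (n p : ℝ) * (d + 1)) F atTop :=
    hn'.atTop_mul_const (by positivity)
  have h3 := (h1.comp h2).mul_const ((d : ℝ) + 1)
  rw [zero_mul] at h3
  refine tendsto_of_tendsto_of_tendsto_of_le_of_le' tendsto_const_nhds h3 ?_ ?_
  · exact Eventually.of_forall fun p => div_nonneg (Real.log_nonneg (by
      have : (0 : ℝ) ≤ n p * d := by positivity
      linarith)) (by positivity)
  · filter_upwards [hn'.eventually_ge_atTop 1] with p hp
    have hp0 : (0 : ℝ) < n p := by linarith
    have : (Real.log ((n p : ℝ) * (d + 1)) / ((n p : ℝ) * (d + 1))) * (d + 1) =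
        Real.log ((n p : ℝ) * (d + 1)) / n p := by
      field_simp
    simp only [Function.comp]
    rw [this]
    gcongr
    linarith

/-- Subtracting `m log n` makes the limit finite; these corrections cancel when the factors of the
first moment are combined. -/
theorem tendsto_mul_log_div {m : ι → ℕ} {t : ℝ} (hn : Tendsto n F atTop)
    (hm : Tendsto (fun p => (m p : ℝ) / n p) F (𝓝 t)) :
    Tendsto (fun p => (m p * Real.log (m p) - m p - m p * Real.log (n p)) / n p) F
      (𝓝 (t * Real.log t - t)) := by
  have h1 := ((Real.continuous_mul_log.tendsto t).comp hm).sub hm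
  refine h1.congr' ?_
  filter_upwards [hn.eventually_gt_atTop 0] with p hp
  have hp' : (n p : ℝ) ≠ 0 := by exact_mod_cast hp.ne'
  have := mul_log_div_eq (m := (m p : ℝ)) hp'
  simp only [Function.comp]
  rw [div_mul_eq_mul_div, this]
  field_simp
  ring

theorem tendsto_log_error {m : ι → ℕ} {t : ℝ} (hn : Tendsto n F atTop)
    (hm : Tendsto (fun p => (m p : ℝ) / n p) F (𝓝 t)) :
    Tendsto (fun p => 2 * Real.log (m p + 1) / n p) F (𝓝 0) := by
  obtain ⟨D, hD⟩ := exists_nat_gt t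
  have h := (tendsto_log_succ_div D hn).const_mul 2
  rw [mul_zero] at h
  refine tendsto_of_tendsto_of_tendsto_of_le_of_le' tendsto_const_nhds h ?_ ?_
  · exact Eventually.of_forall fun p => div_nonneg (mul_nonneg zero_le_two (Real.log_nonneg (by
      have : (0 : ℝ) ≤ m p := by positivity
      linarith))) (by positivity)
  · filter_upwards [hn.eventually_gt_atTop 0, hm.eventually (gt_mem_nhds hD)] with p hp h2
    have hp' : (0 : ℝ) < n p := by exact_mod_cast hp
    rw [div_lt_iff₀ hp'] at h2
    rw [mul_div_assoc]
    gcongr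
    linarith

theorem tendsto_log_factorial {m : ι → ℕ} {t : ℝ} (hn : Tendsto n F atTop)
    (hm : Tendsto (fun p => (m p : ℝ) / n p) F (𝓝 t)) :
    Tendsto (fun p => (Real.log (m p).factorial - m p * Real.log (n p)) / n p) F
      (𝓝 (t * Real.log t - t)) := by
  have h1 := tendsto_mul_log_div hn hm
  have h2 := h1.add (tendsto_log_error hn hm)
  rw [add_zero] at h2
  refine tendsto_of_tendsto_of_tendsto_of_le_of_le h1 h2 (fun p => ?_) (fun p => ?_)
  · have := le_log_factorial (m p)
    dsimp only
    gcongr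
  · have := log_factorial_le (m p)
    dsimp only
    rw [← add_div]
    gcongr
    linarith

theorem tendsto_log_matchingCount {m : ι → ℕ} {t : ℝ} (hn : Tendsto n F atTop)
    (hm : Tendsto (fun p => (m p : ℝ) / n p) F (𝓝 t)) (hev : ∀ᶠ p in F, Even (m p)) :
    Tendsto (fun p => (Real.log (matchingCount (m p)) - m p / 2 * Real.log (n p)) / n p) F
      (𝓝 ((t * Real.log t - t) / 2)) := by
  have h1 := (tendsto_mul_log_div hn hm).div_const 2
  have h2 := h1.add (tendsto_log_error hn hm)
  have h3 := h1.sub (tendsto_log_error hn hm)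
  rw [add_zero] at h2
  rw [sub_zero] at h3
  refine tendsto_of_tendsto_of_tendsto_of_le_of_le' h3 h2 ?_ ?_
  · filter_upwards [hev] with p hp
    have := le_log_matchingCount hp
    rw [div_right_comm, ← sub_div]
    refine div_le_div_of_nonneg_right ?_ (Nat.cast_nonneg _)
    linarith
  · filter_upwards [hev] with p hp
    have := log_matchingCount_le hp
    rw [div_right_comm, ← add_div]
    refine div_le_div_of_nonneg_right ?_ (Nat.cast_nonneg _)
    linarith

theorem tendsto_floor_mul_div (t : ℝ) (hn : Tendsto n F atTop) :
    Tendsto (fun p => (⌊(n p : ℝ) * t⌋ : ℝ) / n p) F (𝓝 t) := by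
  have hn' : Tendsto (fun p => (n p : ℝ)) F atTop := tendsto_natCast_atTop_atTop.comp hn
  have h1 : Tendsto (fun p => t - 1 / (n p : ℝ)) F (𝓝 t) := by
    have := (tendsto_const_nhds (x := t)).sub (tendsto_const_nhds (x := (1 : ℝ)).div_atTop hn')
    rwa [sub_zero] at this
  refine tendsto_of_tendsto_of_tendsto_of_le_of_le' h1 tendsto_const_nhds ?_ ?_
  · filter_upwards [hn'.eventually_gt_atTop 0] with p hp
    rw [le_div_iff₀ hp, sub_mul, one_div, inv_mul_cancel₀ hp.ne']
    linarith [Int.lt_floor_add_one ((n p : ℝ) * t)]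
  · filter_upwards [hn'.eventually_gt_atTop 0] with p hp
    rw [div_le_iff₀ hp]
    linarith [Int.floor_le ((n p : ℝ) * t)]

end Asymptotics

/-! ### Rounding a law of local states to integer counts. -/

/-- The linear constraints must hold exactly. Flooring leaves `o(n)` defects in the numbers of
vertices and tokens, repaired on two states; strict positivity of `P` keeps the corrected counts
nonnegative eventually. -/
theorem exists_rounding {ι : Type*} {F : Filter ι} {n k : ι → ℕ} {d : ℕ} (hd : 3 ≤ d)
    (hn : Tendsto n F atTop) (P : LocalState d → ℝ) (hP : ∀ s, 0 < P s) (hsum : ∑ s, P s = 1)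
    {b : ℝ} (hfree : ∀ i, P (.inr (.inr i)) = b / d)
    (htok : ∑ A, P (.inr (.inl A)) * A.1.card = d * P (.inl ()))
    (hk : Tendsto (fun p => (k p : ℝ) / n p) F (𝓝 (P (.inl ()) + b / 2))) :
    ∃ N : ι → LocalState d → ℕ, (∀ s, Tendsto (fun p => (N p s : ℝ) / n p) F (𝓝 (P s))) ∧
      (∀ᶠ p in F, ∑ s, N p s = n p ∧ ∑ A, N p (.inr (.inl A)) * A.1.card = d * N p (.inl ()) ∧
        2 * N p (.inl ()) + ∑ i, N p (.inr (.inr i)) = 2 * k p ∧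
        Even (∑ i, N p (.inr (.inr i)))) := by
  classical
  have hd0 : (0 : ℝ) < d := by exact_mod_cast (by omega : 0 < d)
  obtain ⟨A₂, hA₂⟩ : ∃ A : {A : Finset (Fin d) // 2 ≤ A.card}, A.1.card = 2 := by
    obtain ⟨A, -, hA⟩ := Finset.exists_subset_card_eq (s := (Finset.univ : Finset (Fin d)))
      (n := 2) (by simp; omega)
    exact ⟨⟨A, hA.ge⟩, hA⟩
  obtain ⟨A₃, hA₃⟩ : ∃ A : {A : Finset (Fin d) // 2 ≤ A.card}, A.1.card = 3 := by
    obtain ⟨A, -, hA⟩ := Finset.exists_subset_card_eq (s := (Finset.univ : Finset (Fin d)))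
      (n := 3) (by simpa using hd)
    exact ⟨⟨A, by omega⟩, hA⟩
  -- All `d` free states receive the same even count `2 m`: the free total is even and `n₁ = k - d
  -- m` is an integer.
  let m : ι → ℤ := fun p => ⌊(n p : ℝ) * (b / d / 2)⌋
  let z : ι → {A : Finset (Fin d) // 2 ≤ A.card} → ℤ :=
    fun p A => ⌊(n p : ℝ) * P (.inr (.inl A))⌋
  let n₁ : ι → ℤ := fun p => k p - d * m p
  let r₀ : ι → ℤ := fun p => n p - n₁ p - d * (2 * m p) - ∑ A, z p A
  let r₁ : ι → ℤ := fun p => d * n₁ p - ∑ A, z p A * (A.1.card : ℤ)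
  -- A state with two tokens and one with three count as `(1, 2)` and `(1, 3)` in (vertices,
  -- tokens), a basis of `ℤ²`. These multiples add exactly `r₀` vertices and `r₁` tokens.
  let Z : ι → LocalState d → ℤ := fun p s => match s with
    | .inl _ => n₁ p
    | .inr (.inl A) => z p A + (if A = A₃ then r₁ p - 2 * r₀ p else 0) +
        (if A = A₂ then 3 * r₀ p - r₁ p else 0)
    | .inr (.inr _) => 2 * m p
  have limm : Tendsto (fun p => (m p : ℝ) / n p) F (𝓝 (b / d / 2)) := tendsto_floor_mul_div _ hn
  have limz : ∀ A, Tendsto (fun p => (z p A : ℝ) / n p) F (𝓝 (P (.inr (.inl A)))) :=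
    fun A => tendsto_floor_mul_div _ hn
  have limn₁ : Tendsto (fun p => (n₁ p : ℝ) / n p) F (𝓝 (P (.inl ()))) := by
    have := hk.sub (limm.const_mul (d : ℝ))
    have e : P (.inl ()) + b / 2 - d * (b / d / 2) = P (.inl ()) := by field_simp; ring
    rw [e] at this
    refine this.congr fun p => ?_
    simp only [n₁]; push_cast; ring
  have hn1 : Tendsto (fun p => (n p : ℝ) / n p) F (𝓝 1) := by
    refine tendsto_const_nhds.congr' ?_
    filter_upwards [hn.eventually_gt_atTop 0] with p hp
    rw [div_self]; exact_mod_cast hp.ne'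
  have limr₀ : Tendsto (fun p => (r₀ p : ℝ) / n p) F (𝓝 0) := by
    have := ((hn1.sub limn₁).sub (limm.const_mul (d * 2 : ℝ))).sub
      (tendsto_finsetSum Finset.univ fun A _ => limz A)
    have e : 1 - P (.inl ()) - d * 2 * (b / d / 2) - ∑ A, P (.inr (.inl A)) = 0 := by
      rw [← hsum, Fintype.sum_sum_type, Fintype.sum_sum_type]
      simp only [hfree]
      simp
      field_simp
      ring
    rw [e] at this
    refine this.congr fun p => ?_
    simp only [r₀]; push_cast; rw [← Finset.sum_div]; ring
  have limr₁ : Tendsto (fun p => (r₁ p : ℝ) / n p) F (𝓝 0) := by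
    have := (limn₁.const_mul (d : ℝ)).sub
      (tendsto_finsetSum Finset.univ fun A _ => (limz A).mul_const (A.1.card : ℝ))
    rw [htok, sub_self] at this
    refine this.congr fun p => ?_
    simp only [r₁]; push_cast
    rw [sub_div, Finset.sum_div]
    congr 1
    · ring
    · exact Finset.sum_congr rfl fun A _ => by ring
  have limZ : ∀ s, Tendsto (fun p => (Z p s : ℝ) / n p) F (𝓝 (P s)) := by
    rintro (⟨⟩ | A | i)
    · exact limn₁
    · have h3 : Tendsto (fun p => ((if A = A₃ then r₁ p - 2 * r₀ p else 0 : ℤ) : ℝ) / n p) F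
          (𝓝 0) := by
        split_ifs
        · have := limr₁.sub (limr₀.const_mul 2)
          simp only [mul_zero, sub_zero] at this
          refine this.congr fun p => ?_
          push_cast; ring
        · simpa using tendsto_const_nhds
      have h2 : Tendsto (fun p => ((if A = A₂ then 3 * r₀ p - r₁ p else 0 : ℤ) : ℝ) / n p) F
          (𝓝 0) := by
        split_ifs
        · have := (limr₀.const_mul 3).sub limr₁
          simp only [mul_zero, sub_zero] at this
          refine this.congr fun p => ?_
          push_cast; ring
        · simpa using tendsto_const_nhds
      have := ((limz A).add h3).add h2
      simp only [add_zero] at this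
      refine this.congr fun p => ?_
      simp only [Z]; push_cast; ring
    · have := limm.const_mul 2
      have e : 2 * (b / d / 2) = P (.inr (.inr i)) := by rw [hfree]; ring
      rw [e] at this
      refine this.congr fun p => ?_
      simp only [Z]; push_cast; ring
  have hZsum : ∀ p, ∑ s, Z p s = n p := by
    intro p
    rw [Fintype.sum_sum_type, Fintype.sum_sum_type]
    simp only [Z, Finset.sum_add_distrib, Finset.sum_ite_eq', Finset.mem_univ, if_true]
    simp [r₀]
    ring
  have hZtok : ∀ p, ∑ A, Z p (.inr (.inl A)) * (A.1.card : ℤ) = d * Z p (.inl ()) := by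
    intro p
    simp only [Z, add_mul, Finset.sum_add_distrib, ite_mul, zero_mul, Finset.sum_ite_eq',
      Finset.mem_univ, if_true, hA₂, hA₃]
    simp only [r₁]
    push_cast
    ring
  have hpos : ∀ᶠ p in F, ∀ s, 0 ≤ Z p s := by
    rw [eventually_all]
    intro s
    filter_upwards [(limZ s).eventually (lt_mem_nhds (hP s)), hn.eventually_gt_atTop 0] with p h1 h2
    have h2' : (0 : ℝ) < n p := by exact_mod_cast h2
    have h3 := (div_pos_iff_of_pos_right h2').1 h1
    exact_mod_cast h3.le
  have hcast : ∀ᶠ p in F, ∀ s, ((Z p s).toNat : ℤ) = Z p s := by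
    filter_upwards [hpos] with p hp s
    exact Int.toNat_of_nonneg (hp s)
  refine ⟨fun p s => (Z p s).toNat, fun s => (limZ s).congr' ?_, ?_⟩
  · filter_upwards [hcast] with p hp
    congr 1
    exact_mod_cast (hp s).symm
  · filter_upwards [hcast] with p hp
    have e3 : ∑ i : Fin d, ((Z p (.inr (.inr i))).toNat : ℤ) = d * (2 * m p) := by
      simp only [hp]; simp [Z]
    refine ⟨?_, ?_, ?_, ?_⟩
    · zify
      simp only [hp, hZsum]
    · zify
      simp only [hp, hZtok]
    · zify
      have h₁ : ((Z p (.inl ())).toNat : ℤ) = k p - d * m p := hp (.inl ())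
      rw [e3]
      linarith
    · have : Even (((∑ i : Fin d, (Z p (.inr (.inr i))).toNat : ℕ)) : ℤ) := by
        push_cast
        rw [e3]
        exact ⟨d * m p, by ring⟩
      exact_mod_cast this

/-- `ℓ` is the normalized logarithm of the contribution of one type class. The strict bound on `b`
leaves room for the rounding. -/
theorem exists_lower_bound {ι : Type*} {F : Filter ι} {n k : ι → ℕ} {d : ℕ} (hd : 3 ≤ d)
    (hn : Tendsto n F atTop) (hev : ∀ᶠ p in F, Even (n p * d)) (P : LocalState d → ℝ)
    (hP : ∀ s, 0 < P s) (hsum : ∑ s, P s = 1)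
    {b : ℝ} (hfree : ∀ i, P (.inr (.inr i)) = b / d) (hb : b < (d : ℝ) ^ (-(3 / 2) : ℝ))
    (htok : ∑ A, P (.inr (.inl A)) * A.1.card = d * P (.inl ()))
    (hR : 0 < d * (1 - 2 * P (.inl ())) - b)
    (hk : Tendsto (fun p => (k p : ℝ) / n p) F (𝓝 (P (.inl ()) + b / 2))) :
    ∃ ℓ : ι → ℝ, Tendsto ℓ F (𝓝 (-(∑ s, P s * Real.log (P s))
        + d * P (.inl ()) * Real.log (d * P (.inl ())) + b * Real.log b / 2
        + (d * (1 - 2 * P (.inl ())) - b) * Real.log (d * (1 - 2 * P (.inl ())) - b) / 2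
        - d * Real.log d / 2)) ∧
      ∀ᶠ p in F, 0 < expectedFrozenPartition d (n p) (k p) ∧
        ℓ p ≤ Real.log (expectedFrozenPartition d (n p) (k p)) / n p := by
  classical
  have hd0 : (0 : ℝ) < d := by exact_mod_cast (by omega : 0 < d)
  obtain ⟨N, hNlim, hN⟩ := exists_rounding hd hn P hP hsum hfree htok hk
  set a := P (.inl ()) with ha
  let n₁ : ι → ℕ := fun p => N p (.inl ())
  let nf : ι → ℕ := fun p => ∑ i, N p (.inr (.inr i))
  have hn1 : Tendsto (fun p => (n p : ℝ) / n p) F (𝓝 1) := by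
    refine tendsto_const_nhds.congr' ?_
    filter_upwards [hn.eventually_gt_atTop 0] with p hp
    rw [div_self]; exact_mod_cast hp.ne'
  have lim₁ : Tendsto (fun p => (n₁ p : ℝ) / n p) F (𝓝 a) := hNlim _
  have lim₁' : Tendsto (fun p => ((d * n₁ p : ℕ) : ℝ) / n p) F (𝓝 (d * a)) := by
    refine (lim₁.const_mul (d : ℝ)).congr fun p => ?_
    push_cast; ring
  have limf : Tendsto (fun p => (nf p : ℝ) / n p) F (𝓝 b) := by
    have := tendsto_finsetSum Finset.univ fun i (_ : i ∈ Finset.univ) => hNlim (.inr (.inr i))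
    simp only [hfree, Finset.sum_const, Finset.card_univ, Fintype.card_fin, nsmul_eq_mul] at this
    rw [mul_div_cancel₀ _ hd0.ne'] at this
    refine this.congr fun p => ?_
    simp only [nf]; push_cast; rw [Finset.sum_div]
  have limnd : Tendsto (fun p => ((n p * d : ℕ) : ℝ) / n p) F (𝓝 d) := by
    have := hn1.mul_const (d : ℝ)
    rw [one_mul] at this
    refine this.congr fun p => ?_
    push_cast; ring
  have limR' : Tendsto (fun p => ((n p * d : ℕ) - 2 * (d * n₁ p : ℕ) - nf p : ℝ) / n p) F
      (𝓝 (d * (1 - 2 * a) - b)) := by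
    have := (limnd.sub (lim₁'.const_mul 2)).sub limf
    rw [show (d : ℝ) - 2 * (d * a) - b = d * (1 - 2 * a) - b by ring] at this
    refine this.congr fun p => ?_
    push_cast; ring
  have hRpos : ∀ᶠ p in F, 2 * (d * n₁ p) + nf p ≤ n p * d := by
    filter_upwards [limR'.eventually (lt_mem_nhds hR), hn.eventually_gt_atTop 0] with p h1 h2
    have h2' : (0 : ℝ) < n p := by exact_mod_cast h2
    have h3 := (div_pos_iff_of_pos_right h2').1 h1
    have : ((2 * (d * n₁ p) + nf p : ℕ) : ℝ) ≤ (n p * d : ℕ) := by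
      push_cast at h3 ⊢
      linarith
    exact_mod_cast this
  let R : ι → ℕ := fun p => n p * d - 2 * (d * n₁ p) - nf p
  have hRcast : ∀ᶠ p in F, (R p : ℝ) = (n p * d : ℕ) - 2 * (d * n₁ p : ℕ) - nf p := by
    filter_upwards [hRpos] with p hp
    have h1 : R p + 2 * (d * n₁ p) + nf p = n p * d := by simp only [R]; omega
    have : ((R p + 2 * (d * n₁ p) + nf p : ℕ) : ℝ) = (n p * d : ℕ) := by rw [h1]
    rw [← this]; push_cast; ring
  have limR : Tendsto (fun p => (R p : ℝ) / n p) F (𝓝 (d * (1 - 2 * a) - b)) := by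
    refine limR'.congr' ?_
    filter_upwards [hRcast] with p hp
    rw [hp]
  have hfev : ∀ᶠ p in F, Even (nf p) := hN.mono fun p hp => hp.2.2.2
  have hRev : ∀ᶠ p in F, Even (R p) := by
    filter_upwards [hRpos, hev, hfev] with p h1 h2 h3
    have h4 : R p + 2 * (d * n₁ p) + nf p = n p * d := by simp only [R]; omega
    rw [← h4] at h2
    exact (Nat.even_add.1 ((Nat.even_add.1 h2).2 h3)).2 (even_two_mul _)
  have hbn : ∀ᶠ p in F, (nf p : ℝ) ≤ (d : ℝ) ^ (-(3 / 2) : ℝ) * n p := by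
    filter_upwards [limf.eventually (gt_mem_nhds hb), hn.eventually_gt_atTop 0] with p h1 h2
    have h2' : (0 : ℝ) < n p := by exact_mod_cast h2
    rw [div_lt_iff₀ h2'] at h1
    exact h1.le
  let T : ι → ℝ := fun p => ((n p).factorial : ℝ) / (∏ s, ((N p s).factorial : ℝ)) *
    ((d * n₁ p).factorial * matchingCount (nf p) * matchingCount (R p) / matchingCount (n p * d))
  have hT : ∀ᶠ p in F, 0 < T p ∧ T p ≤ expectedFrozenPartition d (n p) (k p) := by
    filter_upwards [hN, hev, hfev, hRev, hbn] with p h1 h2 h3 h4 h5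
    have q1 : (0 : ℝ) < matchingCount (n p * d) := by exact_mod_cast matchingCount_pos h2
    have q2 : (0 : ℝ) < matchingCount (nf p) := by exact_mod_cast matchingCount_pos h3
    have q3 : (0 : ℝ) < matchingCount (R p) := by exact_mod_cast matchingCount_pos h4
    have q4 : (0 : ℝ) < ∏ s, ((N p s).factorial : ℝ) := Finset.prod_pos fun s _ => by positivity
    refine ⟨by positivity, ?_⟩
    exact le_expectedFrozenPartition h2 (N p) h1.1 rfl rfl h1.2.1 h1.2.2.1 h5
  refine ⟨fun p => Real.log (T p) / n p, ?_, ?_⟩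
  · have t0 := tendsto_log_factorial hn hn1
    have t1 := tendsto_finsetSum Finset.univ
      fun s (_ : s ∈ Finset.univ) => tendsto_log_factorial hn (hNlim s)
    have t2 := tendsto_log_factorial hn lim₁'
    have t3 := tendsto_log_matchingCount hn limf hfev
    have t4 := tendsto_log_matchingCount hn limR hRev
    have t5 := tendsto_log_matchingCount hn limnd hev
    -- The multiples of `log n` cancel: `n = ∑ N s` and `d n₁ + (nf + R) / 2 = n d / 2`.
    have t := ((((t0.sub t1).add t2).add t3).add t4).sub t5
    convert! t.congr' ?_ using 2
    · rw [Finset.sum_sub_distrib, hsum]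
      simp only [Real.log_one]
      ring
    · filter_upwards [hN, hev, hfev, hRev, hRcast] with p h1 h2 h3 h4 h5
      have q1 : (0 : ℝ) < matchingCount (n p * d) := by exact_mod_cast matchingCount_pos h2
      have q2 : (0 : ℝ) < matchingCount (nf p) := by exact_mod_cast matchingCount_pos h3
      have q3 : (0 : ℝ) < matchingCount (R p) := by exact_mod_cast matchingCount_pos h4
      have q4 : (0 : ℝ) < ∏ s, ((N p s).factorial : ℝ) := Finset.prod_pos fun s _ => by positivity
      simp only [T]
      rw [Real.log_mul (by positivity) (by positivity), Real.log_div (by positivity) q4.ne',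
        Real.log_prod (fun s _ => by positivity), Real.log_div (by positivity) q1.ne',
        Real.log_mul (by positivity) q3.ne', Real.log_mul (by positivity) q2.ne',
        ← Finset.sum_div, Finset.sum_sub_distrib, ← Finset.sum_mul]
      have hs : ∑ s, (N p s : ℝ) = n p := by exact_mod_cast h1.1
      rw [hs, h5]
      push_cast
      ring
  · filter_upwards [hT] with p hp
    refine ⟨hp.1.trans_le hp.2, ?_⟩
    gcongr
    · exact hp.1
    · exact hp.2

/-! The stationary point of the rate, parametrized by `q`. -/

/-- The odds of a token: weights `x ^ |A|` make the token set of an unoccupied vertex a binomial set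
of parameter `q`, conditioned on at least two elements. -/
noncomputable def starX (q : ℝ) : ℝ := q / (1 - q)

noncomputable def starK (d : ℕ) (q : ℝ) : ℝ := (1 + starX q) ^ (d - 1) - 1

/-- The normalization: with it the densities `starA`, `starB`, `starN` of the three spins add up to
one (`starN_eq`), and `starR` is the number of `bulk` half-edges per vertex (`starR_eq`). -/
noncomputable def starE (d : ℕ) (q : ℝ) : ℝ := 1 + 2 * starX q + starX q / starK d q

noncomputable def starA (d : ℕ) (q : ℝ) : ℝ := starX q / starE d q

noncomputable def starB (d : ℕ) (q : ℝ) : ℝ := d * starX q / (starK d q * starE d q)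

noncomputable def starN (d : ℕ) (q : ℝ) : ℝ := tokenPoly d (starX q) / (starK d q * starE d q)

noncomputable def starR (d : ℕ) (q : ℝ) : ℝ := d / starE d q

/-- The Legendre dual of the rate at the multiplier `log (lambdaOf d q)`. -/
noncomputable def starDual (d : ℕ) (q : ℝ) : ℝ :=
  Real.log (starK d q) - ((d : ℝ) / 2 - 1) * Real.log (starE d q)

section Star

variable {d : ℕ} {q : ℝ}

theorem starX_pos (h0 : 0 < q) (h1 : q < 1) : 0 < starX q := div_pos h0 (by linarith)

theorem one_add_starX (h1 : q < 1) : 1 + starX q = (1 - q)⁻¹ := by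
  unfold starX
  have : 1 - q ≠ 0 := by linarith
  field_simp
  ring

theorem starK_eq (h1 : q < 1) : starK d q = ((1 - q) ^ (d - 1))⁻¹ - 1 := by
  rw [starK, one_add_starX h1, inv_pow]

theorem starK_pos (hd : 2 ≤ d) (h0 : 0 < q) (h1 : q < 1) : 0 < starK d q := by
  have := one_lt_pow₀ (a := 1 + starX q) (by linarith [starX_pos h0 h1]) (n := d - 1) (by omega)
  unfold starK
  linarith

theorem starE_pos (hd : 2 ≤ d) (h0 : 0 < q) (h1 : q < 1) : 0 < starE d q := by
  have := starX_pos h0 h1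
  have := starK_pos hd h0 h1
  unfold starE
  positivity

theorem starA_pos (hd : 2 ≤ d) (h0 : 0 < q) (h1 : q < 1) : 0 < starA d q :=
  div_pos (starX_pos h0 h1) (starE_pos hd h0 h1)

theorem starB_pos (hd : 2 ≤ d) (h0 : 0 < q) (h1 : q < 1) : 0 < starB d q := by
  have := starX_pos h0 h1
  have := starK_pos hd h0 h1
  have := starE_pos hd h0 h1
  have : (0 : ℝ) < d := by exact_mod_cast (by omega : 0 < d)
  unfold starB
  positivity

theorem starN_pos (hd : 2 ≤ d) (h0 : 0 < q) (h1 : q < 1) : 0 < starN d q := by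
  have := tokenPoly_pos hd (starX_pos h0 h1)
  have := starK_pos hd h0 h1
  have := starE_pos hd h0 h1
  unfold starN
  positivity

theorem starR_pos (hd : 2 ≤ d) (h0 : 0 < q) (h1 : q < 1) : 0 < starR d q :=
  div_pos (by exact_mod_cast (by omega : 0 < d)) (starE_pos hd h0 h1)

theorem tokenPoly_starX (hd : 2 ≤ d) :
    tokenPoly d (starX q) = starK d q + starX q * starK d q + starX q - d * starX q := by
  obtain ⟨m, rfl⟩ : ∃ m, d = m + 1 := ⟨d - 1, by omega⟩
  unfold tokenPoly starK
  rw [Nat.add_sub_cancel, pow_succ]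
  ring

theorem starN_eq (hd : 2 ≤ d) (h0 : 0 < q) (h1 : q < 1) :
    1 - starA d q - starB d q = starN d q := by
  have hK := starK_pos hd h0 h1
  have hE := starE_pos hd h0 h1
  have e : starE d q * starK d q = starK d q + 2 * starX q * starK d q + starX q := by
    unfold starE; field_simp
  unfold starA starB starN
  rw [tokenPoly_starX hd]
  field_simp
  linarith

theorem starR_eq (hd : 2 ≤ d) (h0 : 0 < q) (h1 : q < 1) :
    d * (1 - 2 * starA d q) - starB d q = starR d q := by
  have hK := starK_pos hd h0 h1
  have hE := starE_pos hd h0 h1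
  have e : starE d q * starK d q = starK d q + 2 * starX q * starK d q + starX q := by
    unfold starE; field_simp
  unfold starA starB starR
  field_simp
  linarith

theorem starR_mul_starX (hd : 2 ≤ d) (h0 : 0 < q) (h1 : q < 1) :
    starR d q * starX q = d * starA d q := by
  have hE := starE_pos hd h0 h1
  unfold starA starR
  field_simp

theorem lambdaOf_eq (hd : 2 ≤ d) (h1 : q < 1) : lambdaOf d q = starX q * starK d q := by
  obtain ⟨m, rfl⟩ : ∃ m, d = m + 1 := ⟨d - 1, by omega⟩
  have : 1 - q ≠ 0 := by linarith
  rw [starK_eq h1, lambdaOf, starX]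
  simp only [Nat.add_sub_cancel, pow_succ]
  field_simp

/-- Identifies the intensity of the stationary point with the equation that determines `q` from `α`.
-/
theorem starA_add_starB (hd : 2 ≤ d) (h0 : 0 < q) (h1 : q < 1) :
    starA d q + starB d q / 2 = alphaOf d q := by
  have hK := starK_pos hd h0 h1
  have hE := starE_pos hd h0 h1
  have hq : 0 < 1 - q := by linarith
  have hy : 0 < (1 - q) ^ (d - 1) := by positivity
  have hKy : starK d q * (1 - q) ^ (d - 1) = 1 - (1 - q) ^ (d - 1) := by
    rw [starK_eq h1]; field_simp
  have hden : 0 < 1 + q - (1 - q) ^ (d - 1) := by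
    have : (1 - q) ^ (d - 1) < 1 := pow_lt_one₀ hq.le (by linarith) (by omega)
    linarith
  have e : starA d q + starB d q / 2 =
      starX q * (starK d q + d / 2) / (starK d q * starE d q) := by
    unfold starA starB; field_simp
  have e2 : starK d q * starE d q = starK d q + 2 * starX q * starK d q + starX q := by
    unfold starE; field_simp
  have hpos : 0 < starK d q * starE d q := by positivity
  rw [e, alphaOf, ← mul_div_assoc, div_eq_div_iff hpos.ne' hden.ne', e2]
  have hx : starX q * (1 - q) = q := by unfold starX; field_simp
  generalize starX q = x at *
  generalize starK d q = K at *
  generalize (1 - q) ^ (d - 1) = y at *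
  have hy' : y = 1 / (K + 1) := by field_simp; linarith
  subst hy'
  have hxq : x = q / (1 - q) := by field_simp; linarith
  subst hxq
  field_simp
  ring

theorem explicitExponent_eq (hd : 2 ≤ d) (h0 : 0 < q) (h1 : q < 1) (α : ℝ) :
    explicitExponent d q (lambdaOf d q) α = starDual d q - α * Real.log (lambdaOf d q) := by
  have hK := starK_pos hd h0 h1
  have hE := starE_pos hd h0 h1
  have hX := starX_pos h0 h1
  have hq : 0 < 1 - q := by linarith
  have hx : starX q = q / (1 - q) := rfl
  have e1 : 1 - q * (1 - 1 / lambdaOf d q) = (1 - q) * (starK d q + 1) / starK d q := by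
    rw [lambdaOf_eq hd h1]
    rw [hx]
    field_simp
    ring
  have e2 : 1 - q ^ 2 * (1 - 1 / lambdaOf d q) = (1 - q) ^ 2 * starE d q := by
    rw [lambdaOf_eq hd h1, starE, hx]
    field_simp
    ring
  have e3 : Real.log (starK d q + 1) = -((d : ℝ) - 1) * Real.log (1 - q) := by
    rw [starK, sub_add_cancel, one_add_starX h1, Real.log_pow, Real.log_inv,
      Nat.cast_sub (by omega)]
    push_cast; ring
  unfold explicitExponent starDual
  rw [e1, e2, Real.log_div (by positivity) hK.ne', Real.log_mul hq.ne' (by positivity),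
    Real.log_mul (by positivity) hE.ne', Real.log_pow, e3]
  push_cast
  ring

/-- The rate relative to the stationary point. -/
theorem frozenRate_eq (hd : 2 ≤ d) (h0 : 0 < q) (h1 : q < 1) {a b : ℝ} (ha : 0 < a) :
    frozenRate d a b (d * a / starR d q) =
      starDual d q - (a + b / 2) * Real.log (lambdaOf d q)
      - a * (Real.log a - Real.log (starA d q))
      - (1 - a - b) * (Real.log (1 - a - b) - Real.log (starN d q))
      - b / 2 * (Real.log b - Real.log (starB d q))
      + (d * (1 - 2 * a) - b) / 2 * (Real.log (d * (1 - 2 * a) - b) - Real.log (starR d q))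
      + (1 - a - b) * (Real.log (tokenPoly d (d * a / starR d q)) -
          Real.log (tokenPoly d (starX q))) := by
  have hK := starK_pos hd h0 h1
  have hE := starE_pos hd h0 h1
  have hX := starX_pos h0 h1
  have hR := starR_pos hd h0 h1
  have hg := tokenPoly_pos hd (starX_pos h0 h1)
  have hd0 : (0 : ℝ) < d := by exact_mod_cast (by omega : 0 < d)
  -- With this Chernoff parameter, `-d a log x + d a log (d a)` becomes `d a log (starR d q)`,
  -- linear in `a`. It need not be optimal away from the stationary point.
  have lx : Real.log (d * a / starR d q) = Real.log (d * a) - Real.log (starR d q) :=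
    Real.log_div (by positivity) hR.ne'
  have lA : Real.log (starA d q) = Real.log (starX q) - Real.log (starE d q) :=
    Real.log_div hX.ne' hE.ne'
  have lN : Real.log (starN d q) = Real.log (tokenPoly d (starX q)) -
      (Real.log (starK d q) + Real.log (starE d q)) := by
    rw [starN, Real.log_div hg.ne' (by positivity), Real.log_mul hK.ne' hE.ne']
  have lB : Real.log (starB d q) = Real.log d + Real.log (starX q) -
      (Real.log (starK d q) + Real.log (starE d q)) := by
    rw [starB, Real.log_div (by positivity) (by positivity), Real.log_mul hK.ne' hE.ne',
      Real.log_mul hd0.ne' hX.ne']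
  have lR : Real.log (starR d q) = Real.log d - Real.log (starE d q) :=
    Real.log_div hd0.ne' hE.ne'
  have lL : Real.log (lambdaOf d q) = Real.log (starX q) + Real.log (starK d q) := by
    rw [lambdaOf_eq hd h1, Real.log_mul hX.ne' hK.ne']
  unfold frozenRate starDual
  rw [lx, lA, lN, lB, lR, lL]
  ring

theorem frozenRate_star (hd : 2 ≤ d) (h0 : 0 < q) (h1 : q < 1) :
    frozenRate d (starA d q) (starB d q) (starX q) =
      starDual d q - alphaOf d q * Real.log (lambdaOf d q) := by
  have hx : starX q = d * starA d q / starR d q := by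
    rw [← starR_mul_starX hd h0 h1, mul_comm, mul_div_assoc, div_self (starR_pos hd h0 h1).ne',
      mul_one]
  conv_lhs => rw [hx]
  rw [frozenRate_eq hd h0 h1 (starA_pos hd h0 h1), starN_eq hd h0 h1, starR_eq hd h0 h1,
    starA_add_starB hd h0 h1, ← hx]
  ring

/-- The law of the local state at the stationary point. -/
noncomputable def starLaw (d : ℕ) (q : ℝ) : LocalState d → ℝ :=
  LocalState.weight (starA d q) (starN d q / tokenPoly d (starX q)) (starB d q / d) (starX q)

/-- The derivative of the generating polynomial, computed in two ways. -/
theorem sum_card_mul_pow_card (d : ℕ) (x : ℝ) :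
    ∑ A : {A : Finset (Fin d) // 2 ≤ A.card}, (A.1.card : ℝ) * x ^ (A.1.card - 1) =
      d * ((1 + x) ^ (d - 1) - 1) := by
  have h1 : HasDerivAt (fun x : ℝ => ∑ A : {A : Finset (Fin d) // 2 ≤ A.card}, x ^ A.1.card)
      (∑ A : {A : Finset (Fin d) // 2 ≤ A.card}, (A.1.card : ℝ) * x ^ (A.1.card - 1)) x :=
    HasDerivAt.fun_sum fun A _ => hasDerivAt_pow _ _
  have h2 : HasDerivAt (tokenPoly d) (d * ((1 + x) ^ (d - 1) - 1)) x := by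
    have := ((((hasDerivAt_id x).const_add 1).pow d).sub_const 1).sub
      ((hasDerivAt_id x).const_mul (d : ℝ))
    refine this.congr_deriv ?_
    simp; ring
  have h3 : (fun x : ℝ => ∑ A : {A : Finset (Fin d) // 2 ≤ A.card}, x ^ A.1.card) = tokenPoly d :=
    funext fun x => sum_pow_card_of_two_le d x
  rw [h3] at h1
  exact h1.unique h2

theorem sum_starLaw_tokens (hd : 2 ≤ d) (h0 : 0 < q) (h1 : q < 1) :
    ∑ A, starLaw d q (.inr (.inl A)) * A.1.card = d * starA d q := by
  have hg := tokenPoly_pos hd (starX_pos h0 h1)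
  have hK := starK_pos hd h0 h1
  have hE := starE_pos hd h0 h1
  have h := sum_card_mul_pow_card d (starX q)
  have : ∀ A : {A : Finset (Fin d) // 2 ≤ A.card}, starLaw d q (.inr (.inl A)) * A.1.card =
      (starN d q / tokenPoly d (starX q) * starX q) *
        ((A.1.card : ℝ) * starX q ^ (A.1.card - 1)) := by
    rintro ⟨A, hA⟩
    obtain ⟨m, hm⟩ : ∃ m, A.card = m + 1 := ⟨A.card - 1, by omega⟩
    simp only [starLaw, LocalState.weight, hm, Nat.add_sub_cancel, pow_succ]
    ring
  rw [Finset.sum_congr rfl fun A _ => this A, ← Finset.mul_sum, h]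
  change starN d q / tokenPoly d (starX q) * starX q * (d * starK d q) = _
  unfold starN starA
  field_simp

theorem starLaw_pos (hd : 2 ≤ d) (h0 : 0 < q) (h1 : q < 1) (s : LocalState d) :
    0 < starLaw d q s := by
  have := tokenPoly_pos hd (starX_pos h0 h1)
  have := starX_pos h0 h1
  have := starA_pos hd h0 h1
  have := starN_pos hd h0 h1
  have := starB_pos hd h0 h1
  have : (0 : ℝ) < d := by exact_mod_cast (by omega : 0 < d)
  rcases s with _ | A | j <;> simp only [starLaw, LocalState.weight] <;> positivity

theorem sum_starLaw (hd : 2 ≤ d) (h0 : 0 < q) (h1 : q < 1) : ∑ s, starLaw d q s = 1 := by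
  have hg := tokenPoly_pos hd (starX_pos h0 h1)
  have hd0 : (0 : ℝ) < d := by exact_mod_cast (by omega : 0 < d)
  unfold starLaw
  rw [LocalState.sum_weight, div_mul_cancel₀ _ hg.ne', mul_div_cancel₀ _ hd0.ne',
    ← starN_eq hd h0 h1]
  ring

/-- On unoccupied states the logarithm of the law is affine in the number of tokens, so the entropy
involves only the mean number of tokens. -/
theorem sum_starLaw_mul_log (hd : 2 ≤ d) (h0 : 0 < q) (h1 : q < 1) :
    ∑ s, starLaw d q s * Real.log (starLaw d q s) =
      starA d q * Real.log (starA d q) + starN d q * (Real.log (starN d q) -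
        Real.log (tokenPoly d (starX q))) + d * starA d q * Real.log (starX q) +
        starB d q * (Real.log (starB d q) - Real.log d) := by
  have hg := tokenPoly_pos hd (starX_pos h0 h1)
  have hd0 : (0 : ℝ) < d := by exact_mod_cast (by omega : 0 < d)
  have hX := starX_pos h0 h1
  have hN := starN_pos hd h0 h1
  have hB := starB_pos hd h0 h1
  have htok := sum_starLaw_tokens hd h0 h1
  have hsum := sum_starLaw hd h0 h1
  rw [Fintype.sum_sum_type, Fintype.sum_sum_type] at hsum ⊢
  have hvac : ∀ A : {A : Finset (Fin d) // 2 ≤ A.card}, starLaw d q (.inr (.inl A)) *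
      Real.log (starLaw d q (.inr (.inl A))) =
      starLaw d q (.inr (.inl A)) * (Real.log (starN d q) - Real.log (tokenPoly d (starX q))) +
      starLaw d q (.inr (.inl A)) * A.1.card * Real.log (starX q) := by
    intro A
    have : Real.log (starLaw d q (.inr (.inl A))) = Real.log (starN d q) -
        Real.log (tokenPoly d (starX q)) + A.1.card * Real.log (starX q) := by
      simp only [starLaw, LocalState.weight]
      rw [Real.log_mul (by positivity) (by positivity), Real.log_div hN.ne' hg.ne', Real.log_pow]
    rw [this]; ring
  rw [Finset.sum_congr rfl fun A _ => hvac A, Finset.sum_add_distrib, ← Finset.sum_mul,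
    ← Finset.sum_mul, htok]
  have hvs : ∑ A, starLaw d q (.inr (.inl A)) = starN d q := by
    have e : ∑ i : Fin d, starLaw d q (.inr (.inr i)) = starB d q := by
      simp only [starLaw, LocalState.weight, Finset.sum_const, Finset.card_univ,
        Fintype.card_fin, nsmul_eq_mul]
      field_simp
    have e' : ∑ u : Unit, starLaw d q (.inl u) = starA d q := by
      simp [starLaw, LocalState.weight]
    rw [e, e'] at hsum
    rw [← starN_eq hd h0 h1]
    linarith
  rw [hvs]
  simp only [starLaw, LocalState.weight, Finset.sum_const, Finset.card_univ,
        Fintype.card_fin, nsmul_eq_mul, Fintype.card_unit]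
  rw [Real.log_div hB.ne' hd0.ne']
  field_simp
  ring

/-- For this law of exponential form, the entropy of the type class equals the Chernoff bound, so
the lower exponent is the rate at the stationary point. -/
theorem exists_lower_bound_star {ι : Type*} {F : Filter ι} {n k : ι → ℕ} (hd : 3 ≤ d)
    (hn : Tendsto n F atTop) (hev : ∀ᶠ p in F, Even (n p * d)) (h0 : 0 < q) (h1 : q < 1)
    (hb : starB d q < (d : ℝ) ^ (-(3 / 2) : ℝ))
    (hk : Tendsto (fun p => (k p : ℝ) / n p) F (𝓝 (alphaOf d q))) :
    ∃ ℓ : ι → ℝ,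
      Tendsto ℓ F (𝓝 (starDual d q - alphaOf d q * Real.log (lambdaOf d q))) ∧
      ∀ᶠ p in F, 0 < expectedFrozenPartition d (n p) (k p) ∧
        ℓ p ≤ Real.log (expectedFrozenPartition d (n p) (k p)) / n p := by
  have hd2 : 2 ≤ d := by omega
  have hR := starR_pos hd2 h0 h1
  rw [← starR_eq hd2 h0 h1] at hR
  rw [← starA_add_starB hd2 h0 h1] at hk
  obtain ⟨ℓ, h2, h3⟩ := exists_lower_bound hd hn hev (starLaw d q) (starLaw_pos hd2 h0 h1)
    (sum_starLaw hd2 h0 h1) (b := starB d q) (fun _ => rfl) hb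
    (sum_starLaw_tokens hd2 h0 h1) hR hk
  refine ⟨ℓ, ?_, h3⟩
  convert h2 using 2
  rw [← frozenRate_star hd2 h0 h1, sum_starLaw_mul_log hd2 h0 h1]
  change _ = -_ + d * starA d q * Real.log (d * starA d q) + _ +
    (d * (1 - 2 * starA d q) - starB d q) * Real.log (d * (1 - 2 * starA d q) - starB d q) / 2 - _
  unfold frozenRate
  rw [starN_eq hd2 h0 h1]
  ring

end Star

/-! ### Second-order bounds: the rate lies below an affine function of the intensity. -/

/-- The gap between `1/2` and `2/5` absorbs the cubic remainder. -/
theorem log_one_add_le_sub_sq {u : ℝ} (hu : |u| ≤ 1 / 20) :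
    Real.log (1 + u) ≤ u - 2 / 5 * u ^ 2 := by
  have h := Real.abs_log_sub_add_sum_range_le (x := -u) (by rw [abs_neg]; linarith) 2
  simp only [Finset.sum_range_succ, Finset.sum_range_zero, sub_neg_eq_add, abs_neg] at h
  norm_num at h
  have h1 := (abs_le.1 h).2
  have h2 : |u| ^ 3 / (1 - |u|) ≤ 1 / 10 * u ^ 2 := by
    rw [div_le_iff₀ (by linarith), ← sq_abs u]
    have h0 := abs_nonneg u
    nlinarith [mul_nonneg (sq_nonneg |u|) (by linarith : 0 ≤ 1 / 20 - |u|)]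
  linarith

/-- The probability that a binomial-type law gives at most one token. -/
noncomputable def fewTokens (d : ℕ) (x : ℝ) : ℝ := (1 + d * x) / (1 + x) ^ d

theorem hasDerivAt_fewTokens {d : ℕ} {x : ℝ} (hx : 0 ≤ x) :
    HasDerivAt (fewTokens d) (-(d * (d - 1)) * (x / (1 + x) ^ (d + 1))) x := by
  have h1 : (1 + x) ≠ 0 := by linarith
  have := (((hasDerivAt_id x).const_mul (d : ℝ)).const_add 1).div
    (((hasDerivAt_id x).const_add 1).pow d) (pow_ne_zero d h1)
  refine this.congr_deriv ?_
  rcases d with _ | m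
  · simp
  · simp only [id, Nat.add_sub_cancel, Pi.pow_apply]
    push_cast
    field_simp
    ring

/-- Bernoulli's inequality for `(1 + x) / (1 + z)`. It makes the derivative of `fewTokens`
increasing beyond `1 / d`. -/
theorem div_pow_succ_antitone {d : ℕ} (hd : 0 < d) {z x : ℝ} (hz : 1 / (d : ℝ) ≤ z) (hzx : z ≤ x) :
    x / (1 + x) ^ (d + 1) ≤ z / (1 + z) ^ (d + 1) := by
  have hd0 : (0 : ℝ) < d := by exact_mod_cast hd
  have hz0 : 0 < z := lt_of_lt_of_le (by positivity) hz
  have hx0 : 0 < x := by linarith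
  rw [div_le_iff₀ hd0] at hz
  rw [div_le_div_iff₀ (by positivity) (by positivity)]
  have h1 := one_add_mul_le_pow (a := (x - z) / (1 + z)) (by
    have : 0 ≤ (x - z) / (1 + z) := div_nonneg (by linarith) (by linarith)
    linarith) (d + 1)
  have e : 1 + (x - z) / (1 + z) = (1 + x) / (1 + z) := by field_simp; ring
  rw [e, div_pow, le_div_iff₀ (by positivity)] at h1
  have h2 : x ≤ z * (1 + ((d + 1 : ℕ) : ℝ) * ((x - z) / (1 + z))) := by
    have : z * (1 + ((d + 1 : ℕ) : ℝ) * ((x - z) / (1 + z))) - x =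
        (x - z) * (z * d - 1) / (1 + z) := by
      push_cast; field_simp; ring
    have h3 : 0 ≤ (x - z) * (z * d - 1) / (1 + z) :=
      div_nonneg (mul_nonneg (by linarith) (by linarith)) (by linarith)
    linarith
  calc x * (1 + z) ^ (d + 1) ≤ (z * (1 + ((d + 1 : ℕ) : ℝ) * ((x - z) / (1 + z)))) *
        (1 + z) ^ (d + 1) := by gcongr
    _ = z * ((1 + ((d + 1 : ℕ) : ℝ) * ((x - z) / (1 + z))) * (1 + z) ^ (d + 1)) := by ring
    _ ≤ z * (1 + x) ^ (d + 1) := by gcongr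

/-- Convexity beyond `1 / d`, through the mean value theorem. -/
theorem fewTokens_tangent {d : ℕ} (hd : 0 < d) {x z : ℝ} (hz : 1 / (d : ℝ) ≤ z)
    (hx : 1 / (d : ℝ) ≤ x) :
    fewTokens d z - d * (d - 1) * (z / (1 + z) ^ (d + 1)) * (x - z) ≤ fewTokens d x := by
  have hd0 : (0 : ℝ) < d := by exact_mod_cast hd
  have hd1 : (0 : ℝ) ≤ d * (d - 1) :=
    mul_nonneg hd0.le (by
      have : (1 : ℝ) ≤ d := by exact_mod_cast hd
      linarith)
  have hpos : 0 < 1 / (d : ℝ) := by positivity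
  rcases lt_trichotomy x z with h | h | h
  · obtain ⟨c, hc, hs⟩ := exists_hasDerivAt_eq_slope (fewTokens d)
      (fun x => -(d * (d - 1)) * (x / (1 + x) ^ (d + 1))) h
      (fun y hy => (hasDerivAt_fewTokens (by linarith [hy.1])).continuousAt.continuousWithinAt)
      (fun y hy => hasDerivAt_fewTokens (by linarith [hy.1]))
    rw [eq_div_iff (by linarith)] at hs
    have := mul_le_mul_of_nonneg_left
      (div_pow_succ_antitone hd (hx.trans hc.1.le) hc.2.le) hd1
    nlinarith
  · subst h; simp
  · obtain ⟨c, hc, hs⟩ := exists_hasDerivAt_eq_slope (fewTokens d)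
      (fun x => -(d * (d - 1)) * (x / (1 + x) ^ (d + 1))) h
      (fun y hy => (hasDerivAt_fewTokens (by linarith [hy.1])).continuousAt.continuousWithinAt)
      (fun y hy => hasDerivAt_fewTokens (by linarith [hy.1]))
    rw [eq_div_iff (by linarith)] at hs
    have := mul_le_mul_of_nonneg_left
      (div_pow_succ_antitone hd hz hc.1.le) hd1
    nlinarith

theorem tokenPoly_eq {d : ℕ} {x : ℝ} (hx : 0 < x) :
    tokenPoly d x = (1 + x) ^ d * (1 - fewTokens d x) := by
  unfold tokenPoly fewTokens
  have : (1 + x) ^ d ≠ 0 := by positivity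
  field_simp
  ring

theorem fewTokens_lt_one {d : ℕ} (hd : 2 ≤ d) {x : ℝ} (hx : 0 < x) : fewTokens d x < 1 := by
  have := tokenPoly_pos hd hx
  unfold fewTokens
  unfold tokenPoly at this
  rw [div_lt_one (by positivity)]
  linarith

/-- In `(1 + x) ^ d * (1 - fewTokens d x)` the first factor supplies the quadratic gain. The second
is concave beyond `1 / d`, so its logarithm stays below its tangent. -/
theorem log_tokenPoly_sub_le {d : ℕ} (hd : 2 ≤ d) {x z : ℝ} (hz : 1 / (d : ℝ) ≤ z)
    (hx : 1 / (d : ℝ) ≤ x) (hv : |(x - z) / (1 + z)| ≤ 1 / 20) :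
    Real.log (tokenPoly d x) - Real.log (tokenPoly d z) ≤
      d * ((1 + z) ^ (d - 1) - 1) / tokenPoly d z * (x - z)
        - 2 / 5 * d * ((x - z) / (1 + z)) ^ 2 := by
  have hd0 : (0 : ℝ) < d := by exact_mod_cast (by omega : 0 < d)
  have hpos : 0 < 1 / (d : ℝ) := by positivity
  have hz0 : 0 < z := by linarith
  have hx0 : 0 < x := by linarith
  have hgz := tokenPoly_pos hd hz0
  have h1 := fewTokens_lt_one hd hz0
  have h2 := fewTokens_lt_one hd hx0
  have h3 := log_one_add_le_sub_sq hv
  have e : 1 + (x - z) / (1 + z) = (1 + x) / (1 + z) := by field_simp; ring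
  rw [e, Real.log_div (by positivity) (by positivity)] at h3
  have h4 := log_sub_log_le (sub_pos.2 h2) (sub_pos.2 h1)
  have h5 := fewTokens_tangent (by omega) hz hx
  have h6 : (1 - fewTokens d x) / (1 - fewTokens d z) - 1 ≤
      d * (d - 1) * (z / (1 + z) ^ (d + 1)) * (x - z) / (1 - fewTokens d z) := by
    rw [div_sub_one (by linarith)]
    apply div_le_div_of_nonneg_right _ (by linarith)
    linarith
  have h7 : d * ((1 + z) ^ (d - 1) - 1) / tokenPoly d z * (x - z) =
      d * ((x - z) / (1 + z)) +
        d * (d - 1) * (z / (1 + z) ^ (d + 1)) * (x - z) / (1 - fewTokens d z) := by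
    have hfz : 1 - fewTokens d z = tokenPoly d z / (1 + z) ^ d := by
      rw [tokenPoly_eq hz0]; field_simp
    rw [hfz]
    have hg : tokenPoly d z = (1 + z) * (1 + z) ^ (d - 1) - 1 - d * z := by
      rw [← pow_succ', Nat.sub_add_cancel (by omega)]; rfl
    have hp : (1 + z) ^ d = (1 + z) * (1 + z) ^ (d - 1) := by
      rw [← pow_succ', Nat.sub_add_cancel (by omega)]
    have hp1 : (1 + z) ^ (d + 1) = (1 + z) * ((1 + z) * (1 + z) ^ (d - 1)) := by
      rw [pow_succ', hp]
    rw [hp1, hp]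
    have hP : 0 < (1 + z) ^ (d - 1) := by positivity
    field_simp
    rw [hg]
    ring
  rw [tokenPoly_eq hx0, tokenPoly_eq hz0, Real.log_mul (by positivity) (by linarith),
    Real.log_mul (by positivity) (by linarith), Real.log_pow, Real.log_pow, ← tokenPoly_eq hz0, h7]
  have h8 := mul_le_mul_of_nonneg_left h3 hd0.le
  linarith

/-- With `b = s²` and `c = t²` the left side is at most `s (t - s) = -(b - c)/2 - (s - t)²/2`, and
`(s + t)² ≤ 4β`. The square roots also cover `b = 0`. -/
theorem neg_mul_log_le_sub_sq {b c β : ℝ} (hb : 0 ≤ b) (hc : 0 < c) (hbβ : b ≤ β) (hcβ : c ≤ β) :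
    -(b / 2 * (Real.log b - Real.log c)) ≤ -(b - c) / 2 - (b - c) ^ 2 / (8 * β) := by
  have hβ : 0 < β := by linarith
  obtain ⟨s, hs, rfl⟩ : ∃ s, 0 ≤ s ∧ b = s ^ 2 := ⟨√b, by positivity, (Real.sq_sqrt hb).symm⟩
  obtain ⟨t, ht, rfl⟩ : ∃ t, 0 < t ∧ c = t ^ 2 := ⟨√c, by positivity, (Real.sq_sqrt hc.le).symm⟩
  have h1 : -(s ^ 2 / 2 * (Real.log (s ^ 2) - Real.log (t ^ 2))) ≤ s * (t - s) := by
    rcases hs.eq_or_lt with h | h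
    · subst h; simp
    · rw [Real.log_pow, Real.log_pow]
      have := log_sub_log_le ht h
      have h2 := mul_le_mul_of_nonneg_left this (sq_nonneg s)
      have h3 : s ^ 2 * (t / s - 1) = s * (t - s) := by field_simp
      push_cast
      linarith
  refine h1.trans ?_
  have h2 : (s ^ 2 - t ^ 2) ^ 2 / (8 * β) ≤ (s - t) ^ 2 / 2 := by
    rw [div_le_iff₀ (by positivity)]
    have h3 : (s + t) ^ 2 ≤ 4 * β := by nlinarith [sq_nonneg (s - t)]
    calc (s ^ 2 - t ^ 2) ^ 2 = (s - t) ^ 2 * (s + t) ^ 2 := by ring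
      _ ≤ (s - t) ^ 2 * (4 * β) := by gcongr
      _ = _ := by ring
  linarith

/-- The first term is the dangerous one, the convex entropy of the `bulk` half-edges: since `u ≈
-2e`, it is about `1.2 D e²`. The next two give about `-1.4 D e²`, and the `δ` terms are absorbed by
`δ² / (8β) ≥ 12 D δ²`, as `β D ≤ 1/100`. -/
theorem quadratic_form_nonpos {D e δ β r R N n v u : ℝ} (hD : 10 ≤ D) (hβ : 0 < β)
    (hβD : β * D ≤ 1 / 100) (hr : 97 / 100 * D ≤ r) (hr1 : r ≤ D) (hR : 97 / 100 * D ≤ R)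
    (hN : 97 / 100 ≤ N) (hN1 : N ≤ 1) (hn : 97 / 100 ≤ n) (hv : e ^ 2 ≤ v ^ 2)
    (hu : r * u = -(2 * D * e + δ)) :
    u ^ 2 * (r / 2 - R / 5) - (e + δ) * (D * e) / N - 2 / 5 * n * D * v ^ 2
      - δ ^ 2 / (8 * β) ≤ 0 := by
  have hr0 : 0 < r := by linarith
  set w := 2 * e + δ / D with hw
  have hDw : r * u = -(D * w) := by rw [hu, hw]; field_simp
  have h1 : r * u ^ 2 ≤ D * w ^ 2 / (97 / 100) := by
    have : r * (r * u ^ 2) = D ^ 2 * w ^ 2 := by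
      have : r * (r * u ^ 2) = (r * u) ^ 2 := by ring
      rw [this, hDw]; ring
    rw [le_div_iff₀ (by norm_num)]
    have h3 : 97 / 100 * D * (r * u ^ 2) ≤ r * (r * u ^ 2) := by gcongr
    rw [this] at h3
    have : D * (r * u ^ 2 * (97 / 100)) ≤ D * (D * w ^ 2) := by linarith
    exact le_of_mul_le_mul_left this (by linarith)
  have h2 : w ^ 2 ≤ u ^ 2 := by
    have h4 : D ^ 2 * w ^ 2 = r ^ 2 * u ^ 2 := by
      have : (r * u) ^ 2 = (D * w) ^ 2 := by rw [hDw]; ring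
      linarith
    have h5 : r ^ 2 * u ^ 2 ≤ D ^ 2 * u ^ 2 := by gcongr
    rw [← h4] at h5
    exact le_of_mul_le_mul_left h5 (by positivity)
  have h3 : u ^ 2 * (r / 2 - R / 5) ≤ 322 / 1000 * D * w ^ 2 := by
    have : u ^ 2 * (97 / 100 * D) ≤ u ^ 2 * R := by gcongr
    have : w ^ 2 * (97 / 100 * D) ≤ u ^ 2 * (97 / 100 * D) := by gcongr
    have : 0 ≤ D * w ^ 2 := by positivity
    rw [le_div_iff₀ (by norm_num)] at h1
    nlinarith
  have h4 : -((e + δ) * (D * e) / N) ≤ -(D * e ^ 2) + 104 / 100 * D * |e * δ| := by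
    have i1 : D * e ^ 2 ≤ D * e ^ 2 / N := by
      rw [le_div_iff₀ (by linarith)]
      have : 0 ≤ D * e ^ 2 := by positivity
      nlinarith
    have i2 : -(D * (e * δ) / N) ≤ 104 / 100 * D * |e * δ| := by
      rw [← neg_div, div_le_iff₀ (by linarith)]
      have i3 : -(e * δ) ≤ |e * δ| := neg_le_abs _
      have i4 : 0 ≤ |e * δ| := abs_nonneg _
      have i5 : D * |e * δ| * (97 / 100) ≤ D * |e * δ| * N := by gcongr
      have i6 : D * -(e * δ) ≤ D * |e * δ| := by gcongr
      nlinarith [mul_nonneg (by linarith : 0 ≤ D) i4]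
    have : (e + δ) * (D * e) / N = D * e ^ 2 / N + D * (e * δ) / N := by ring
    rw [this]; linarith
  have h5 : 388 / 1000 * D * e ^ 2 ≤ 2 / 5 * n * D * v ^ 2 := by
    calc 388 / 1000 * D * e ^ 2 = 2 / 5 * (97 / 100) * D * e ^ 2 := by ring
      _ ≤ 2 / 5 * n * D * v ^ 2 := by gcongr
  have h6 : 12 * D * δ ^ 2 ≤ δ ^ 2 / (8 * β) := by
    rw [le_div_iff₀ (by positivity)]
    have : 0 ≤ δ ^ 2 := by positivity
    nlinarith
  have h7 : D * w ^ 2 ≤ D * (4 * e ^ 2 + 2 / 5 * |e * δ| + δ ^ 2 / 100) := by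
    have i1 : δ / D * e ≤ |e * δ| / 10 := by
      rw [div_mul_eq_mul_div, div_le_div_iff₀ (by linarith) (by norm_num)]
      have i3 : e * δ ≤ |e * δ| := le_abs_self _
      have i4 : 0 ≤ |e * δ| := abs_nonneg _
      nlinarith
    have i2 : (δ / D) ^ 2 ≤ δ ^ 2 / 100 := by
      rw [div_pow]
      apply div_le_div_of_nonneg_left (by positivity) (by norm_num)
      nlinarith
    have : w ^ 2 = 4 * e ^ 2 + 4 * (δ / D * e) + (δ / D) ^ 2 := by rw [hw]; ring
    rw [this]
    refine mul_le_mul_of_nonneg_left ?_ (by linarith)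
    linarith
  have h8 : |e * δ| = |e| * |δ| := abs_mul _ _
  have hst : 0 ≤ D * (|e| * |δ|) := by positivity
  have hs : 0 ≤ D * |e| ^ 2 := by positivity
  have ht : 0 ≤ D * |δ| ^ 2 := by positivity
  have h9 : D * (9 / 100 * |e| ^ 2 - 12 / 10 * (|e| * |δ|) + 11 * |δ| ^ 2) ≥ 0 := by
    apply mul_nonneg (by linarith)
    linarith [sq_nonneg (|e| - 20 / 3 * |δ|), sq_nonneg |δ|]
  rw [h8] at h4 h7
  rw [← sq_abs e] at h4 h5 h7
  rw [← sq_abs δ] at h6 h7 ⊢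
  linarith

/-- The rate lies below its affine majorant at the stationary point. -/
theorem frozenRate_le {d : ℕ} {q a b β : ℝ} (hd : 10 ≤ d) (h0 : 0 < q) (h1 : q < 1)
    (hβd : β * d ≤ 1 / 100) (hA : 1 / (d : ℝ) ≤ starA d q) (hA1 : starA d q ≤ 1 / 100)
    (hB : starB d q ≤ β) (ha : 1 / (d : ℝ) ≤ a) (ha1 : a ≤ 1 / 100) (hb : 0 ≤ b) (hbβ : b ≤ β) :
    frozenRate d a b (d * a / starR d q) ≤
      starDual d q - (a + b / 2) * Real.log (lambdaOf d q) := by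
  have hd2 : 2 ≤ d := by omega
  have hD : (10 : ℝ) ≤ d := by exact_mod_cast hd
  have hd0 : (0 : ℝ) < d := by linarith
  have hid : 0 < 1 / (d : ℝ) := by positivity
  have ha0 : 0 < a := by linarith
  have hB0 := starB_pos hd2 h0 h1
  have hA0 := starA_pos hd2 h0 h1
  have hN0 := starN_pos hd2 h0 h1
  have hR0 := starR_pos hd2 h0 h1
  have hX0 := starX_pos h0 h1
  have hE0 := starE_pos hd2 h0 h1
  have hK0 := starK_pos hd2 h0 h1
  have hg0 := tokenPoly_pos hd2 hX0
  have hN := starN_eq hd2 h0 h1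
  have hR := starR_eq hd2 h0 h1
  have hRX := starR_mul_starX hd2 h0 h1
  rw [frozenRate_eq hd2 h0 h1 ha0]
  have hβ0 : 0 < β := by linarith
  have hβ1 : β ≤ 1 / 1000 := by
    have : β * 10 ≤ β * d := by gcongr
    linarith
  set A := starA d q with hAdef
  set B := starB d q with hBdef
  set N := starN d q with hNdef
  set R := starR d q with hRdef
  set X := starX q with hXdef
  set e := a - A with he
  set δ := b - B with hδ
  have hAd : 0 ≤ A * d := by positivity
  have had : 0 ≤ a * d := by positivity
  have hAd1 : A * d ≤ 1 / 100 * d := by gcongr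
  have had1 : a * d ≤ 1 / 100 * d := by gcongr
  have hRlo : 97 / 100 * (d : ℝ) ≤ R := by
    rw [← hR]; linarith
  have hRd : R ≤ d := by rw [← hR]; linarith
  have hrlo : 97 / 100 * (d : ℝ) ≤ d * (1 - 2 * a) - b := by linarith
  have hrd : d * (1 - 2 * a) - b ≤ d := by linarith
  set r := (d : ℝ) * (1 - 2 * a) - b with hr
  have hnlo : 97 / 100 ≤ 1 - a - b := by linarith
  have hNlo : 97 / 100 ≤ N := by rw [← hN]; linarith
  have hN1 : N ≤ 1 := by rw [← hN]; linarith
  set n := 1 - a - b with hn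
  set u := (r - R) / R with hu
  have hRu : R * u = -(2 * d * e + δ) := by
    rw [hu, mul_div_cancel₀ _ hR0.ne', hr, ← hR]; ring
  have hr0 : 0 < r := by linarith
  have hux : |u| ≤ 1 / 20 := by
    rw [hu, abs_div, abs_of_pos hR0, div_le_iff₀ hR0, abs_le]
    constructor <;> linarith
  -- the four logarithmic bounds
  have t1 : -(a * (Real.log a - Real.log A)) ≤ -e := by
    have := mul_le_mul_of_nonneg_left (log_sub_log_le hA0 ha0) ha0.le
    have h2 : a * (A / a - 1) = A - a := by field_simp
    linarith
  have hn0 : 0 < n := by linarith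
  have t2 : -(n * (Real.log n - Real.log N)) ≤ e + δ := by
    have := mul_le_mul_of_nonneg_left (log_sub_log_le hN0 hn0) hn0.le
    have h2 : n * (N / n - 1) = N - n := by field_simp
    have h3 : N - n = e + δ := by rw [← hN]; ring
    linarith
  have t3 := neg_mul_log_le_sub_sq hb hB0 hbβ hB
  have t4 : r / 2 * (Real.log r - Real.log R) ≤ -(2 * d * e + δ) / 2 +
      u ^ 2 * (R / 2 - r / 5) := by
    have h3 := log_one_add_le_sub_sq hux
    have e1 : 1 + u = r / R := by rw [hu]; field_simp; ring
    rw [e1, Real.log_div hr0.ne' hR0.ne'] at h3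
    have h4 := mul_le_mul_of_nonneg_left h3 (by linarith : 0 ≤ r / 2)
    have e2 : r = R + R * u := by rw [hu]; field_simp; ring
    have e3 : r / 2 * (u - 2 / 5 * u ^ 2) = R * u / 2 + u ^ 2 * (R / 2 - r / 5) := by
      rw [e2]; ring
    rw [e3, hRu] at h4
    exact h4
  set x := (d : ℝ) * a / R with hx
  set v := (x - X) / (1 + X) with hvdef
  have hXe : X = d * A / R := by rw [← hRX]; field_simp
  have hxX : x - X = d * e / R := by rw [hXe, hx]; ring
  have hv : v = d * e / (R + d * A) := by
    rw [hvdef, hxX, hXe]; field_simp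
  have hle : ∀ {y : ℝ}, 0 ≤ y → y ≤ d * y / R := by
    intro y hy
    rw [le_div_iff₀ hR0, mul_comm]
    gcongr
  have hpos : 0 < R + d * A := by positivity
  have hve : e ^ 2 ≤ v ^ 2 := by
    have h3 : R + d * A ≤ d := by rw [← hR]; linarith
    have h4 : e ^ 2 * (R + d * A) ^ 2 ≤ e ^ 2 * d ^ 2 := by gcongr
    rw [hv, div_pow, le_div_iff₀ (by positivity)]
    linarith
  have hvx : |v| ≤ 1 / 20 := by
    have h3 : 97 / 100 * (d : ℝ) ≤ R + d * A := by linarith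
    rw [hv, abs_div, abs_of_pos hpos, div_le_iff₀ hpos, abs_mul, abs_of_pos hd0]
    have h4 : |e| ≤ 1 / 100 := by rw [abs_le]; constructor <;> linarith
    have : d * |e| ≤ d * (1 / 100) := by gcongr
    linarith
  have t5 := log_tokenPoly_sub_le hd2 (z := X) (x := x) (by rw [hXe]; exact hA.trans (hle hA0.le))
    (ha.trans (hle ha0.le)) hvx
  have hslope : d * ((1 + X) ^ (d - 1) - 1) / tokenPoly d X * (x - X) = d * e / N := by
    change d * starK d q / tokenPoly d X * (x - X) = d * e / N
    rw [hxX, hRdef, hNdef, starR, starN, ← hXdef]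
    field_simp
  rw [hslope] at t5
  have t6 := mul_le_mul_of_nonneg_left t5 hn0.le
  have e4 : n * (d * e / N - 2 / 5 * d * v ^ 2) =
      d * e - (e + δ) * (d * e) / N - 2 / 5 * n * d * v ^ 2 := by
    have : n = N - e - δ := by rw [← hN]; ring
    have h3 : n * (d * e / N) = d * e - (e + δ) * (d * e) / N := by
      rw [this]; field_simp; ring
    linarith
  rw [e4] at t6
  -- The linear terms `-e`, `e + δ`, `-δ/2`, `-(2de + δ)/2` and `de` of the five bounds add up to
  -- zero. The letters `r` and `R` exchange roles in this call.
  have t7 := quadratic_form_nonpos (n := n) hD hβ0 hβd hRlo hRd hrlo hNlo hN1 hnlo hve hRu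
  linarith

/-! ### Numerical estimates for large degree. -/

/-- Numerical conditions satisfied by all large degrees. -/
structure LargeDegree (d : ℕ) : Prop where
  log_ge : 1000 ≤ Real.log d
  log_le : 1000 * Real.log d ≤ (d : ℝ) ^ (1 / 20 : ℝ)
  loglog_ge : 10 ≤ Real.log (Real.log d)
  loglog_le : 1000 * Real.log (Real.log d) ≤ Real.log d

theorem eventually_largeDegree : ∀ᶠ d : ℕ in atTop, LargeDegree d := by
  have h0 : Tendsto (fun d : ℕ => (d : ℝ)) atTop atTop := tendsto_natCast_atTop_atTop
  have h1 : Tendsto (fun d : ℕ => Real.log d) atTop atTop := Real.tendsto_log_atTop.comp h0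
  have h2 : Tendsto (fun d : ℕ => Real.log (Real.log d)) atTop atTop :=
    Real.tendsto_log_atTop.comp h1
  have e1 : ∀ᶠ x : ℝ in atTop, ‖Real.log x‖ ≤ 1 / 1000 * ‖x ^ (1 / 20 : ℝ)‖ :=
    (isLittleO_log_rpow_atTop (by norm_num)).bound (by norm_num)
  have e2 : ∀ᶠ x : ℝ in atTop, ‖Real.log x‖ ≤ 1 / 1000 * ‖x‖ :=
    Real.isLittleO_log_id_atTop.bound (by norm_num)
  filter_upwards [h1.eventually_ge_atTop 1000, h2.eventually_ge_atTop 10, h0.eventually e1,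
    h1.eventually e2] with d a b c e
  refine ⟨a, ?_, b, ?_⟩
  · have := le_abs_self (Real.log d)
    rw [Real.norm_eq_abs, Real.norm_eq_abs,
      abs_of_nonneg (Real.rpow_nonneg (Nat.cast_nonneg d) _)] at c
    linarith
  · have := le_abs_self (Real.log (Real.log d))
    rw [Real.norm_eq_abs, Real.norm_eq_abs, abs_of_nonneg (by linarith : 0 ≤ Real.log d)] at e
    linarith

/-- The twentieth root of the degree. -/
noncomputable def degRoot (d : ℕ) : ℝ := (d : ℝ) ^ (1 / 20 : ℝ)

theorem degRoot_pow (d : ℕ) : degRoot d ^ 20 = d := by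
  unfold degRoot
  rw [← Real.rpow_natCast, ← Real.rpow_mul (Nat.cast_nonneg d)]
  norm_num

namespace LargeDegree

variable {d : ℕ} (h : LargeDegree d)
include h

theorem log_pos : 0 < Real.log d := by linarith [h.log_ge]

theorem log_le_root : 1000 * Real.log d ≤ degRoot d := h.log_le

theorem root_ge : 1000000 ≤ degRoot d := by linarith [h.log_ge, h.log_le_root]

theorem root_pos : 0 < degRoot d := by linarith [h.root_ge]

theorem cast_pos : (0 : ℝ) < d := by
  rw [← degRoot_pow]; exact pow_pos h.root_pos _

theorem cast_ge : 1000000 ≤ (d : ℝ) := by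
  rw [← degRoot_pow]
  exact h.root_ge.trans (le_self_pow₀ (by linarith [h.root_ge]) (by norm_num))

theorem ge_ten : 10 ≤ d := by
  have := h.cast_ge
  have h2 : (10 : ℝ) ≤ d := by linarith
  exact_mod_cast h2

/-- Measuring everything in `w = d^(1/20)`, with `3000 log d ≤ 3w`, turns size comparisons into
comparisons of integer exponents. -/
theorem exp_neg_log_mul (m : ℕ) : Real.exp (-((m : ℝ) / 20 * Real.log d)) = 1 / degRoot d ^ m := by
  have h1 : Real.log d = 20 * Real.log (degRoot d) := by
    rw [← degRoot_pow, Real.log_pow]; norm_num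
  have h2 : (m : ℝ) / 20 * Real.log d = Real.log (degRoot d ^ m) := by
    rw [h1, Real.log_pow]; ring
  rw [h2, Real.exp_neg, Real.exp_log (pow_pos h.root_pos _), one_div]

theorem rpow_eq : (d : ℝ) ^ (-(3 / 2) : ℝ) = 1 / degRoot d ^ 30 := by
  rw [Real.rpow_def_of_pos h.cast_pos, ← h.exp_neg_log_mul]
  congr 1
  push_cast; ring

end LargeDegree

/-- `(1 - q) ^ (d - 1)`. -/
noncomputable def starY (d : ℕ) (q : ℝ) : ℝ := (1 - q) ^ (d - 1)

section Range

variable {d : ℕ} {q : ℝ} (h : LargeDegree d)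
include h

theorem LargeDegree.small_of_le (hq : q ≤ 3 * (Real.log d / d)) : q ≤ 1 / (100 * degRoot d ^ 19) := by
  refine hq.trans ?_
  have hw := h.root_pos
  have := h.log_le_root
  rw [← mul_div_assoc, ← degRoot_pow d, div_le_div_iff₀ (by positivity) (by positivity),
    degRoot_pow d]
  have : 3 * Real.log d * 100 ≤ degRoot d := by linarith [h.log_pos]
  calc 3 * Real.log d * (100 * degRoot d ^ 19) = (3 * Real.log d * 100) * degRoot d ^ 19 := by ring
    _ ≤ degRoot d * degRoot d ^ 19 := by gcongr
    _ = 1 * d := by rw [one_mul, ← degRoot_pow d]; ring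

theorem LargeDegree.small_of_le' (hq : q ≤ 3 * (Real.log d / d)) : q ≤ 1 / 1000000 := by
  refine (h.small_of_le hq).trans ?_
  have h1 := h.root_ge
  have h2 : degRoot d ≤ degRoot d ^ 19 := le_self_pow₀ (by linarith) (by norm_num)
  apply one_div_le_one_div_of_le (by norm_num)
  linarith

/-- `(1 - q) ^ (d - 1) ≤ e^q e^(-dq)`; the factor 2 covers `e^q`, due to the missing power. -/
theorem LargeDegree.starY_le (m : ℕ) (h0 : 0 < q) (hm : (m : ℝ) / 20 * (Real.log d / d) ≤ q)
    (hq : q ≤ 3 * (Real.log d / d)) : starY d q ≤ 2 / degRoot d ^ m := by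
  have hd := h.cast_pos
  have hs := h.small_of_le' hq
  have h1 : 1 - q ≤ Real.exp (-q) := by linarith [Real.add_one_le_exp (-q)]
  have h2 : starY d q ≤ Real.exp (-q) ^ (d - 1) := pow_le_pow_left₀ (by linarith) h1 _
  rw [← Real.exp_nat_mul, Nat.cast_sub (by have := h.ge_ten; omega)] at h2
  have h3 : ((d : ℝ) - (1 : ℕ)) * -q = q + -(q * d) := by push_cast; ring
  rw [h3, Real.exp_add] at h2
  have h4 : Real.exp (-(q * d)) ≤ 1 / degRoot d ^ m := by
    rw [← h.exp_neg_log_mul]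
    apply Real.exp_le_exp.2
    rw [← mul_div_assoc, div_le_iff₀ hd] at hm
    linarith
  have h5 : Real.exp q ≤ 2 := by
    have : Real.exp q ≤ 1 / (1 - q) := by
      rw [le_div_iff₀ (by linarith)]
      calc Real.exp q * (1 - q) ≤ Real.exp q * Real.exp (-q) := by gcongr
        _ = 1 := by rw [← Real.exp_add]; simp
    refine this.trans ?_
    rw [div_le_iff₀ (by linarith)]
    linarith
  calc starY d q ≤ Real.exp q * Real.exp (-(q * d)) := h2
    _ ≤ 2 * (1 / degRoot d ^ m) := by
      have := Real.exp_pos q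
      gcongr
    _ = _ := by ring

omit h in
theorem starY_pos (h1 : q < 1) : 0 < starY d q := pow_pos (by linarith) _

end Range

/-! ### Solving for `q`, and estimates at the stationary point. -/

theorem alphaOf_eq (d : ℕ) (q : ℝ) :
    alphaOf d q = q * ((1 + ((d : ℝ) / 2 - 1) * starY d q) / (1 + q - starY d q)) := rfl

/-- `alphaOf` is a small perturbation of the identity: by Bernoulli `y` varies by at most `2d(p -
q)y` between `q` and `p`, and `d² q y` is tiny because `y ≤ 2 d^(-8/5)`. -/
theorem alphaOf_lt_of_lt {d : ℕ} (h : LargeDegree d) {q p : ℝ}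
    (hq : 8 / 5 * (Real.log d / d) ≤ q) (hqp : q < p) (hp : p ≤ 3 * (Real.log d / d)) :
    alphaOf d q < alphaOf d p := by
  have hd := h.cast_pos
  have hℓ := h.log_pos
  have hw := h.root_pos
  have h0 : 0 < q := lt_of_lt_of_le (by positivity) hq
  have hp0 : 0 < p := h0.trans hqp
  have hqs := h.small_of_le' (hqp.le.trans hp)
  have hps := h.small_of_le' hp
  have hps' := h.small_of_le (hqp.le.trans hp)
  have hY := h.starY_le 32 h0 (by norm_num; linarith) (hqp.le.trans hp)
  have hY0 : 0 < starY d q := starY_pos (by linarith)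
  have hZ0 : 0 < starY d p := starY_pos (by linarith)
  have hZY : starY d p ≤ starY d q := pow_le_pow_left₀ (by linarith) (by linarith) _
  have hdw := degRoot_pow d
  have hdiff : starY d q - starY d p ≤ 2 * d * (p - q) * starY d q := by
    have hb := one_add_mul_le_pow (a := (1 - p) / (1 - q) - 1) (by
      have : 0 ≤ (1 - p) / (1 - q) := div_nonneg (by linarith) (by linarith)
      linarith) (d - 1)
    have e1 : 1 + ((1 - p) / (1 - q) - 1) = (1 - p) / (1 - q) := by ring
    have e2 : (1 - p) / (1 - q) - 1 = -((p - q) / (1 - q)) := by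
      have : 1 - q ≠ 0 := by linarith
      field_simp; ring
    rw [e1, div_pow, e2, le_div_iff₀ (by apply pow_pos; linarith)] at hb
    change (1 + ((d - 1 : ℕ) : ℝ) * -((p - q) / (1 - q))) * starY d q ≤ starY d p at hb
    have h2 : ((d - 1 : ℕ) : ℝ) * ((p - q) / (1 - q)) ≤ 2 * d * (p - q) := by
      have : ((d - 1 : ℕ) : ℝ) ≤ d := by exact_mod_cast Nat.sub_le d 1
      have h3 : (p - q) / (1 - q) ≤ 2 * (p - q) := by
        rw [div_le_iff₀ (by linarith)]; nlinarith
      calc ((d - 1 : ℕ) : ℝ) * ((p - q) / (1 - q)) ≤ d * (2 * (p - q)) := by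
            have : 0 ≤ (p - q) / (1 - q) := div_nonneg (by linarith) (by linarith)
            gcongr
        _ = _ := by ring
    nlinarith [mul_le_mul_of_nonneg_right h2 hY0.le]
  have hdY : (d : ℝ) * starY d q ≤ 2 / degRoot d ^ 12 := by
    rw [← hdw] at *
    calc degRoot d ^ 20 * starY d q ≤ degRoot d ^ 20 * (2 / degRoot d ^ 32) := by gcongr
      _ = _ := by field_simp
  have hw12 : 2 / degRoot d ^ 12 ≤ 1 / 100 := by
    have h2 : degRoot d ≤ degRoot d ^ 12 := le_self_pow₀ (by linarith [h.root_ge]) (by norm_num)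
    rw [div_le_div_iff₀ (by positivity) (by norm_num)]
    linarith [h.root_ge]
  have hd1 := h.cast_ge
  have hYs : starY d q ≤ 1 / 100 := by nlinarith
  rw [alphaOf_eq, alphaOf_eq, ← mul_div_assoc, ← mul_div_assoc,
    div_lt_div_iff₀ (by linarith) (by linarith)]
  -- the quadratic term `q * d² * y` is small
  have hqdd : q * d * (d * starY d q) ≤ 1 / 50 := by
    have h1 : q * d ≤ degRoot d / 100 := by
      rw [← hdw] at *
      calc q * degRoot d ^ 20 ≤ 1 / (100 * degRoot d ^ 19) * degRoot d ^ 20 := by gcongr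
        _ = _ := by field_simp
    calc q * d * (d * starY d q) ≤ degRoot d / 100 * (2 / degRoot d ^ 12) := by gcongr
      _ = 1 / 50 * (1 / degRoot d ^ 11) := by field_simp; norm_num
      _ ≤ 1 / 50 * 1 := by
        gcongr
        rw [div_le_one (by positivity)]
        exact one_le_pow₀ (by linarith [h.root_ge])
      _ = _ := by norm_num
  set y := starY d q
  set z := starY d p
  set c := (d : ℝ) / 2 - 1 with hc
  have hc0 : 0 < c := by rw [hc]; linarith
  have hcd : c ≤ d / 2 := by rw [hc]; linarith
  have hg : 0 < p - q := by linarith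
  have i1 : q * (c * (y - z)) ≤ (p - q) * (1 / 50) := by
    calc q * (c * (y - z)) ≤ q * (d / 2 * (2 * d * (p - q) * y)) := by
          have : 0 ≤ y - z := by linarith
          gcongr
      _ = (p - q) * (q * d * (d * y)) := by ring
      _ ≤ _ := by gcongr
  have i2 : q * (y - z) ≤ (p - q) * (1 / 50) := by
    have : q * (y - z) ≤ q * (c * (y - z)) := by
      have h3 : (1 : ℝ) ≤ c := by rw [hc]; linarith
      have : 0 ≤ y - z := by linarith
      have : y - z ≤ c * (y - z) := by nlinarith
      gcongr
    linarith
  have hcy : c * y ≤ 1 / 100 := by nlinarith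
  have hcy0 : 0 ≤ c * y := by positivity
  have hcz0 : 0 ≤ c * z := by positivity
  -- expand around the difference
  have key : p * (1 + c * z) * (1 + q - y) - q * (1 + c * y) * (1 + p - z) =
      (p - q) * (1 + c * z) * (1 + q - y) - q * (c * (y - z)) * (1 + q - y)
        - q * (p - q) * (1 + c * y) - q * (y - z) * (1 + c * y) := by ring
  have j1 : (p - q) * (98 / 100) ≤ (p - q) * (1 + c * z) * (1 + q - y) := by
    rw [mul_assoc]
    apply mul_le_mul_of_nonneg_left _ hg.le
    nlinarith
  have j2 : q * (c * (y - z)) * (1 + q - y) ≤ (p - q) * (1 / 50) * 2 := by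
    apply mul_le_mul i1 (by linarith) (by linarith) (by positivity)
  have j3 : q * (p - q) * (1 + c * y) ≤ 1 / 100 * (p - q) * 2 := by
    apply mul_le_mul _ (by linarith) (by linarith) (by positivity)
    gcongr; linarith
  have j4 : q * (y - z) * (1 + c * y) ≤ (p - q) * (1 / 50) * 2 := by
    apply mul_le_mul i2 (by linarith) (by linarith) (by positivity)
  linarith

/-- The range of the solutions `q`. -/
structure GoodQ (d : ℕ) (q : ℝ) : Prop where
  ge : 33 / 20 * (Real.log d / d) ≤ q
  le : q ≤ 3 * (Real.log d / d)

section GoodRange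

variable {d : ℕ} {q : ℝ}

namespace GoodQ

variable (h : LargeDegree d) (hq : GoodQ d q)
include h hq

theorem pos : 0 < q := by
  have := h.cast_pos
  have := h.log_pos
  exact lt_of_lt_of_le (by positivity) hq.ge

theorem le_small : q ≤ 1 / 1000000 := h.small_of_le' hq.le

theorem lt_one : q < 1 := by linarith [hq.le_small h]

theorem starY_pos : 0 < starY d q := _root_.starY_pos (hq.lt_one h)

theorem starY_le : starY d q ≤ 2 / degRoot d ^ 33 :=
  h.starY_le 33 (hq.pos h) (by have := hq.ge; norm_num at this ⊢; linarith) hq.le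

theorem mul_ge : 33 / 20 * Real.log d ≤ d * q := by
  have := hq.ge
  rw [← mul_div_assoc, div_le_iff₀ h.cast_pos] at this
  linarith

theorem mul_le : d * q ≤ 3 * Real.log d := by
  have := hq.le
  rw [← mul_div_assoc, le_div_iff₀ h.cast_pos] at this
  linarith

theorem d_mul_starY_le : d * starY d q ≤ 2 / degRoot d ^ 13 := by
  have hw := h.root_pos
  have := hq.starY_le h
  have hd := degRoot_pow d
  calc d * starY d q ≤ d * (2 / degRoot d ^ 33) := by gcongr
    _ = degRoot d ^ 20 * (2 / degRoot d ^ 33) := by rw [hd]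
    _ = _ := by field_simp

theorem d_mul_starY_le' : d * starY d q ≤ 1 / 100000 := by
  refine (hq.d_mul_starY_le h).trans ?_
  have hw := h.root_pos
  have h2 : degRoot d ≤ degRoot d ^ 13 := le_self_pow₀ (by linarith [h.root_ge]) (by norm_num)
  rw [div_le_div_iff₀ (by positivity) (by norm_num)]
  linarith [h.root_ge]

theorem starY_le' : starY d q ≤ 1 / 1000000 := by
  have h1 := hq.d_mul_starY_le' h
  have h2 := h.cast_ge
  have h3 := hq.starY_pos h
  nlinarith

theorem inv_starK : 1 / starK d q = starY d q / (1 - starY d q) := by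
  have h1 := hq.lt_one h
  have h2 := hq.starY_pos h
  have h3 := hq.starY_le' h
  have h4 : 1 - starY d q ≠ 0 := by linarith
  rw [starK_eq h1]
  change 1 / ((starY d q)⁻¹ - 1) = _
  have : (starY d q)⁻¹ - 1 = (1 - starY d q) / starY d q := by field_simp
  rw [this, one_div_div]

theorem inv_starK_le : 1 / starK d q ≤ 2 * starY d q := by
  rw [hq.inv_starK h, div_le_iff₀ (by linarith [hq.starY_le' h])]
  have h2 := hq.starY_pos h
  have h3 := hq.starY_le' h
  nlinarith

theorem starA_eq : starA d q = q / (1 + q + q * (1 / starK d q)) := by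
  have hd2 : 2 ≤ d := by have := h.ge_ten; omega
  have h1 := hq.lt_one h
  have h0 := hq.pos h
  have hK := starK_pos hd2 h0 h1
  have h4 : 0 < 1 - q := by linarith
  unfold starA starE starX
  field_simp
  congr 1
  ring

theorem starA_le : starA d q ≤ q := by
  have hd2 : 2 ≤ d := by have := h.ge_ten; omega
  have h0 := hq.pos h
  have hK := starK_pos hd2 h0 (hq.lt_one h)
  rw [hq.starA_eq h]
  apply div_le_self h0.le
  have : 0 ≤ q * (1 / starK d q) := by positivity
  linarith

theorem le_starA : q - 2 * q ^ 2 ≤ starA d q := by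
  have hd2 : 2 ≤ d := by have := h.ge_ten; omega
  have h0 := hq.pos h
  have hK := starK_pos hd2 h0 (hq.lt_one h)
  have h1 := hq.inv_starK_le h
  have h2 := hq.starY_le' h
  have h3 : 0 < 1 / starK d q := by positivity
  rw [hq.starA_eq h, le_div_iff₀ (by positivity)]
  have h4 := hq.le_small h
  have h5 : q * (1 / starK d q) ≤ q * (1 / 2) :=
    mul_le_mul_of_nonneg_left (by linarith) h0.le
  have h6 : (1 - 2 * q) * (1 + q + q * (1 / starK d q)) ≤ 1 := by
    nlinarith [mul_pos h0 h3]
  calc (q - 2 * q ^ 2) * (1 + q + q * (1 / starK d q)) =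
      q * ((1 - 2 * q) * (1 + q + q * (1 / starK d q))) := by ring
    _ ≤ q * 1 := by gcongr
    _ = q := mul_one q

theorem starA_ge : q / 2 ≤ starA d q := by
  have h1 := hq.le_starA h
  have h0 := hq.pos h
  have h4 := hq.le_small h
  nlinarith

theorem inv_le_starA : 1 / (d : ℝ) ≤ starA d q := by
  refine le_trans ?_ (hq.starA_ge h)
  have h1 := hq.mul_ge h
  have h2 := h.log_ge
  rw [div_le_iff₀ h.cast_pos]
  linarith

theorem starB_eq : starB d q = d * starA d q * (1 / starK d q) := by
  have hd2 : 2 ≤ d := by have := h.ge_ten; omega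
  have h1 := hq.lt_one h
  have h0 := hq.pos h
  have hK := starK_pos hd2 h0 h1
  have hE := starE_pos hd2 h0 h1
  unfold starB starA
  field_simp

theorem starB_le : starB d q ≤ 1 / (25 * degRoot d ^ 32) := by
  have hw := h.root_pos
  have hd := h.cast_pos
  have h0 := hq.pos h
  have hd2 : 2 ≤ d := by have := h.ge_ten; omega
  have hK := starK_pos hd2 h0 (hq.lt_one h)
  have hY := hq.starY_pos h
  have hA := starA_pos hd2 h0 (hq.lt_one h)
  rw [hq.starB_eq h]
  calc d * starA d q * (1 / starK d q) ≤ d * q * (2 * starY d q) := by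
        gcongr
        · exact hq.starA_le h
        · exact hq.inv_starK_le h
    _ = 2 * q * (d * starY d q) := by ring
    _ ≤ 2 * (1 / (100 * degRoot d ^ 19)) * (2 / degRoot d ^ 13) := by
        gcongr
        · exact h.small_of_le hq.le
        · exact hq.d_mul_starY_le h
    _ = _ := by field_simp; norm_num

/-- The stationary point lies strictly inside the truncation, since `w^(-32)/25 < w^(-30) =
d^(-3/2)`. -/
theorem starB_lt : starB d q < (d : ℝ) ^ (-(3 / 2) : ℝ) := by
  refine (hq.starB_le h).trans_lt ?_
  rw [h.rpow_eq]
  have hw := h.root_pos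
  have h1 := h.root_ge
  apply one_div_lt_one_div_of_lt (by positivity)
  have h2 : degRoot d ^ 30 ≤ degRoot d ^ 32 := pow_le_pow_right₀ (by linarith) (by norm_num)
  have : 0 < degRoot d ^ 32 := by positivity
  linarith

end GoodQ

/-- `-log λ` is the slope of the affine majorant. Here `λ = x K ≥ q / (2y)`, and `y` is far smaller
than `q`. -/
theorem one_lt_lambdaOf (h : LargeDegree d) (hq : GoodQ d q) : 1 < lambdaOf d q := by
  have hd2 : 2 ≤ d := by have := h.ge_ten; omega
  have h1 := hq.lt_one h
  have h0 := hq.pos h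
  have hK := starK_pos hd2 h0 h1
  have hX : q ≤ starX q := by
    unfold starX; rw [le_div_iff₀ (by linarith)]; nlinarith
  have h2 := hq.inv_starK_le h
  have hY := hq.starY_pos h
  rw [lambdaOf_eq hd2 h1]
  rw [div_le_iff₀ hK] at h2
  have h3 : 2 * starY d q < q := by
    have h4 := hq.d_mul_starY_le' h
    have h5 := hq.mul_ge h
    have h6 := h.log_ge
    have : d * (2 * starY d q) < d * q := by linarith
    exact lt_of_mul_lt_mul_left this h.cast_pos.le
  calc 1 ≤ 2 * starY d q * starK d q := h2
    _ < q * starK d q := by gcongr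
    _ ≤ starX q * starK d q := by gcongr

theorem continuousOn_alphaOf (h : LargeDegree d) :
    ContinuousOn (alphaOf d) (Set.Icc (33 / 20 * (Real.log d / d)) (3 * (Real.log d / d))) := by
  unfold alphaOf
  refine ContinuousOn.mul continuousOn_id (ContinuousOn.div (by fun_prop) (by fun_prop) ?_)
  intro q hq
  have hg : GoodQ d q := ⟨hq.1, hq.2⟩
  have h1 := hg.starY_le' h
  have h2 := hg.pos h
  unfold starY at h1
  linarith

/-- Existence comes from the intermediate value theorem on the range starting at `33/20`, uniqueness
from monotonicity on the whole range starting at `8/5`. -/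
theorem exists_goodQ (h : LargeDegree d) {α : ℝ} (hα : α ∈ Set.Icc (alphaLbd d) (alphaUbd d)) :
    ∃ q, GoodQ d q ∧ α = alphaOf d q ∧ ∀ q', IsSolutionQ d α q' → q' = q := by
  have hd := h.cast_pos
  have hℓ := h.log_pos
  have hr : 0 < Real.log d / d := by positivity
  set q₀ := 33 / 20 * (Real.log d / d) with hq₀
  set q₁ := 3 * (Real.log d / d) with hq₁
  have g₀ : GoodQ d q₀ := ⟨le_rfl, by rw [hq₀]; linarith⟩
  have g₁ : GoodQ d q₁ := ⟨by rw [hq₁]; linarith, le_rfl⟩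
  have b₀ : alphaOf d q₀ ≤ α := by
    refine le_trans ?_ hα.1
    have h1 := g₀.d_mul_starY_le' h
    have h2 := g₀.starY_le' h
    have h3 := g₀.pos h
    have h4 := g₀.starY_pos h
    -- `33/20 · 101/100` is just below `5/3`; this fixes the left end of the range.
    have h5 : (1 + ((d : ℝ) / 2 - 1) * starY d q₀) / (1 + q₀ - starY d q₀) ≤ 101 / 100 := by
      rw [div_le_iff₀ (by linarith)]
      linarith
    rw [alphaOf_eq]
    calc q₀ * ((1 + ((d : ℝ) / 2 - 1) * starY d q₀) / (1 + q₀ - starY d q₀)) ≤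
        q₀ * (101 / 100) := by gcongr
      _ ≤ _ := by rw [hq₀]; unfold alphaLbd; rw [mul_div_assoc]; linarith
  have b₁ : α ≤ alphaOf d q₁ := by
    refine le_trans hα.2 ?_
    have h2 := g₁.starY_le' h
    have h3 := g₁.pos h
    have h4 := g₁.starY_pos h
    have h6 := g₁.le_small h
    have h7 := h.cast_ge
    have h5 : 99 / 100 ≤ (1 + ((d : ℝ) / 2 - 1) * starY d q₁) / (1 + q₁ - starY d q₁) := by
      rw [le_div_iff₀ (by linarith)]
      have : 0 ≤ ((d : ℝ) / 2 - 1) * starY d q₁ := mul_nonneg (by linarith) h4.le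
      linarith
    rw [alphaOf_eq]
    calc _ ≤ q₁ * (99 / 100) := by rw [hq₁]; unfold alphaUbd; rw [mul_div_assoc]; linarith
      _ ≤ _ := by gcongr
  obtain ⟨q, hq, hqα⟩ := intermediate_value_Icc (by linarith)
    (continuousOn_alphaOf h) ⟨b₀, b₁⟩
  refine ⟨q, ⟨hq.1, hq.2⟩, hqα.symm, fun q' ⟨h1, h2, h3⟩ => ?_⟩
  have h16 : 8 / 5 * (Real.log d / d) ≤ q' := by norm_num at h1 ⊢; exact h1
  rcases lt_trichotomy q' q with hlt | heq | hgt
  · have := alphaOf_lt_of_lt h h16 hlt hq.2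
    rw [hqα, ← h3] at this
    exact absurd this (lt_irrefl _)
  · exact heq
  · have := alphaOf_lt_of_lt h (by linarith [hq.1]) hgt h2
    rw [hqα, ← h3] at this
    exact absurd this (lt_irrefl _)

/-! ### Existence, affine majorants and monotonicity of the exponent. -/

theorem tendsto_intensityFilter_fst (d : ℕ) (α : ℝ) :
    Tendsto (fun p : ℕ × ℕ => p.1) (intensityFilter d α) atTop :=
  (tendsto_fst.comp (tendsto_comap (f := fun p : ℕ × ℕ => (p.1, (p.2 : ℝ) / (p.1 : ℝ))))).mono_left
    inf_le_left

theorem tendsto_intensityFilter_div (d : ℕ) (α : ℝ) :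
    Tendsto (fun p : ℕ × ℕ => (p.2 : ℝ) / p.1) (intensityFilter d α) (𝓝 α) :=
  (tendsto_snd.comp (tendsto_comap (f := fun p : ℕ × ℕ => (p.1, (p.2 : ℝ) / (p.1 : ℝ))))).mono_left
    inf_le_left

theorem eventually_even_intensityFilter (d : ℕ) (α : ℝ) :
    ∀ᶠ p in intensityFilter d α, Even (p.1 * d) :=
  mem_inf_of_right (mem_principal_self _)

/-- Needed for `limUnder` to return the limit; the even `n = 2m` with `k = ⌊αn⌋` are witnesses. -/
theorem intensityFilter_neBot (d : ℕ) {α : ℝ} (hα : 0 ≤ α) : (intensityFilter d α).NeBot := by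
  have h1 : Tendsto (fun m : ℕ => ((2 * m, ⌊α * (2 * m : ℕ)⌋₊) : ℕ × ℕ)) atTop
      (intensityFilter d α) := by
    refine tendsto_inf.2 ⟨tendsto_comap_iff.2 (Tendsto.prodMk ?_ ?_), tendsto_principal.2 ?_⟩
    · exact tendsto_id.const_mul_atTop' (by norm_num)
    · have h2 : Tendsto (fun m : ℕ => ((2 * m : ℕ) : ℝ)) atTop atTop :=
        tendsto_natCast_atTop_atTop.comp (tendsto_id.const_mul_atTop' (by norm_num))
      exact (tendsto_nat_floor_mul_div_atTop hα).comp h2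
    · exact Eventually.of_forall fun m => by
        simp only [Set.mem_ofPred_eq, mul_assoc]
        exact even_two_mul _
  exact h1.neBot

/-- `α` is not tied to `q`. This freedom yields a whole family of affine majorants of the exponent.
-/
theorem eventually_expected_le (h : LargeDegree d) (hq : GoodQ d q) {α : ℝ}
    (hα : α ∈ Set.Icc (alphaLbd d) (alphaUbd d)) :
    ∀ᶠ p in intensityFilter d α, expectedFrozenPartition d p.1 p.2 ≤
      Real.exp (p.1 * (starDual d q - (p.2 : ℝ) / p.1 * Real.log (lambdaOf d q)) +
        8 * Real.log (p.1 * d + 1) + Real.log (p.1 + 1)) := by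
  have hd := h.cast_pos
  have hℓ := h.log_pos
  have hr : 0 < Real.log d / d := by positivity
  have hw := h.root_pos
  have hd2 : 2 ≤ d := by have := h.ge_ten; omega
  have a1 : 8 / 5 * (Real.log d / d) < α := by
    have := hα.1
    unfold alphaLbd at this
    rw [mul_div_assoc] at this
    linarith
  have a2 : α < 5 / 2 * (Real.log d / d) := by
    have := hα.2
    unfold alphaUbd at this
    rw [mul_div_assoc] at this
    linarith
  have hβd : (1 / degRoot d ^ 30) * d ≤ 1 / 100 := by
    have hd20 := degRoot_pow d
    have : degRoot d ≤ degRoot d ^ 10 := le_self_pow₀ (by linarith [h.root_ge]) (by norm_num)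
    calc (1 / degRoot d ^ 30) * d = (1 / degRoot d ^ 30) * degRoot d ^ 20 := by rw [hd20]
      _ = 1 / degRoot d ^ 10 := by field_simp
      _ ≤ _ := by
        apply one_div_le_one_div_of_le (by norm_num)
        linarith [h.root_ge]
  have hℓd : Real.log d / d ≤ 1 / 1000 := by
    have := (⟨by linarith, le_rfl⟩ : GoodQ d (3 * (Real.log d / d))).le_small h
    linarith
  filter_upwards [(tendsto_intensityFilter_fst d α).eventually_gt_atTop 0,
    (tendsto_intensityFilter_div d α).eventually (lt_mem_nhds a1),
    (tendsto_intensityFilter_div d α).eventually (gt_mem_nhds a2),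
    eventually_even_intensityFilter d α] with p hn hk1 hk2 hev
  have hn' : (0 : ℝ) < p.1 := by exact_mod_cast hn
  refine expectedFrozenPartition_le hd2 hn hev _ fun n₁ nf h1 h2 => ?_
  rw [h.rpow_eq] at h2
  have hb : (nf : ℝ) / p.1 ≤ 1 / degRoot d ^ 30 := by rwa [div_le_iff₀ hn']
  have hb0 : (0 : ℝ) ≤ (nf : ℝ) / p.1 := by positivity
  have hab : (n₁ : ℝ) / p.1 + nf / p.1 / 2 = p.2 / p.1 := by
    have : (2 * n₁ + nf : ℝ) = 2 * p.2 := by exact_mod_cast h1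
    field_simp
    linarith
  -- The truncation enters here: the free density is far below `1 / d`, so the occupied density is
  -- close to the intensity.
  have hbd : (nf : ℝ) / p.1 ≤ 1 / 100 * (1 / d) := by
    refine hb.trans ?_
    have e : 1 / 100 * (1 / (d : ℝ)) = 1 / 100 / d := by ring
    rw [e, le_div_iff₀ hd]
    exact hβd
  have hdi : 1 / (d : ℝ) ≤ 1 / 1000 * (Real.log d / d) := by
    have := h.log_ge
    rw [← mul_div_assoc]
    gcongr
    linarith
  have hA1 : 1 / (d : ℝ) ≤ (n₁ : ℝ) / p.1 := by linarith
  have hA2 : (n₁ : ℝ) / p.1 ≤ 1 / 100 := by linarith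
  have hn1 : 0 < n₁ := by
    have : 0 < (n₁ : ℝ) / p.1 := lt_of_lt_of_le (by positivity) hA1
    have := (div_pos_iff_of_pos_right hn').1 this
    exact_mod_cast this
  have hA2' : (n₁ : ℝ) ≤ 1 / 100 * p.1 := by rwa [div_le_iff₀ hn'] at hA2
  have hB2' : (nf : ℝ) ≤ 1 / 100 * p.1 := by
    have : (nf : ℝ) / p.1 ≤ 1 / 100 := by
      have : 1 / (d : ℝ) ≤ 1 := by
        rw [div_le_one hd]; linarith [h.cast_ge]
      linarith
    rwa [div_le_iff₀ hn'] at this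
  refine ⟨hn1, ?_, ?_, d * (n₁ / p.1) / starR d q, ?_, ?_⟩
  · have : (n₁ : ℝ) + nf < p.1 := by linarith
    exact_mod_cast this
  · have : (2 * (d * n₁) + nf : ℝ) ≤ p.1 * d := by
      have h3 : (d : ℝ) * n₁ ≤ d * (1 / 100 * p.1) := by gcongr
      have h4 : (p.1 : ℝ) ≤ p.1 * d := le_mul_of_one_le_right hn'.le (by linarith [h.cast_ge])
      linarith
    exact_mod_cast this
  · have := starR_pos hd2 (hq.pos h) (hq.lt_one h)
    have h3 : (0 : ℝ) < n₁ := by exact_mod_cast hn1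
    positivity
  · have := frozenRate_le (a := n₁ / p.1) (b := nf / p.1) h.ge_ten (hq.pos h) (hq.lt_one h) hβd
      (hq.inv_le_starA h)
      (by linarith [hq.starA_le h, hq.le_small h]) ((hq.starB_lt h).le.trans h.rpow_eq.le)
      hA1 hA2 hb0 hb
    rwa [hab] at this

/-- The first moment exponent exists. -/
theorem tendsto_logFirstMoment (h : LargeDegree d) (hq : GoodQ d q)
    (hα : alphaOf d q ∈ Set.Icc (alphaLbd d) (alphaUbd d)) :
    Tendsto (logFirstMoment d) (intensityFilter d (alphaOf d q))
      (𝓝 (starDual d q - alphaOf d q * Real.log (lambdaOf d q))) := by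
  have hn := tendsto_intensityFilter_fst d (alphaOf d q)
  have hk := tendsto_intensityFilter_div d (alphaOf d q)
  obtain ⟨ℓ, h1, h2⟩ := exists_lower_bound_star (by have := h.ge_ten; omega) hn
    (eventually_even_intensityFilter d _) (hq.pos h) (hq.lt_one h) (hq.starB_lt h) hk
  have h3 : Tendsto (fun p : ℕ × ℕ => starDual d q - (p.2 : ℝ) / p.1 * Real.log (lambdaOf d q) +
      (8 * (Real.log (p.1 * d + 1) / p.1) + Real.log (p.1 * (1 : ℕ) + 1) / p.1))
      (intensityFilter d (alphaOf d q))
      (𝓝 (starDual d q - alphaOf d q * Real.log (lambdaOf d q))) := by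
    have := ((hk.mul_const (Real.log (lambdaOf d q))).const_sub (starDual d q)).add
      (((tendsto_log_succ_div d hn).const_mul 8).add (tendsto_log_succ_div 1 hn))
    simpa using this
  refine tendsto_of_tendsto_of_tendsto_of_le_of_le' h1 h3 (h2.mono fun p hp => hp.2) ?_
  filter_upwards [h2, eventually_expected_le h hq hα, hn.eventually_gt_atTop 0] with p hp hE hn0
  have hn' : (0 : ℝ) < p.1 := by exact_mod_cast hn0
  have h4 := Real.log_le_log hp.1 hE
  rw [Real.log_exp] at h4
  unfold logFirstMoment
  rw [div_le_iff₀ hn']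
  refine h4.trans (le_of_eq ?_)
  push_cast
  field_simp
  ring

theorem PhiStar_alphaOf (h : LargeDegree d) (hq : GoodQ d q)
    (hα : alphaOf d q ∈ Set.Icc (alphaLbd d) (alphaUbd d)) :
    PhiStar d (alphaOf d q) = starDual d q - alphaOf d q * Real.log (lambdaOf d q) := by
  have : (intensityFilter d (alphaOf d q)).NeBot := intensityFilter_neBot d (by
    refine le_trans ?_ hα.1
    have := h.cast_pos
    have := h.log_pos
    unfold alphaLbd
    positivity)
  exact (tendsto_logFirstMoment h hq hα).limUnder_eq

theorem alphaOf_pos_of_mem (h : LargeDegree d) {α : ℝ}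
    (hα : α ∈ Set.Icc (alphaLbd d) (alphaUbd d)) : 0 < α := by
  refine lt_of_lt_of_le ?_ hα.1
  have := h.cast_pos
  have := h.log_pos
  unfold alphaLbd
  positivity

/-- The exponent lies below all its affine majorants. -/
theorem PhiStar_le (h : LargeDegree d) (hq : GoodQ d q) {α : ℝ}
    (hα : α ∈ Set.Icc (alphaLbd d) (alphaUbd d)) :
    PhiStar d α ≤ starDual d q - α * Real.log (lambdaOf d q) := by
  obtain ⟨q', hq', rfl, -⟩ := exists_goodQ h hα
  have : (intensityFilter d (alphaOf d q')).NeBot :=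
    intensityFilter_neBot d (alphaOf_pos_of_mem h hα).le
  have hn := tendsto_intensityFilter_fst d (alphaOf d q')
  have hk := tendsto_intensityFilter_div d (alphaOf d q')
  have h3 : Tendsto (fun p : ℕ × ℕ => starDual d q - (p.2 : ℝ) / p.1 * Real.log (lambdaOf d q) +
      (8 * (Real.log (p.1 * d + 1) / p.1) + Real.log (p.1 * (1 : ℕ) + 1) / p.1))
      (intensityFilter d (alphaOf d q'))
      (𝓝 (starDual d q - alphaOf d q' * Real.log (lambdaOf d q))) := by
    have := ((hk.mul_const (Real.log (lambdaOf d q))).const_sub (starDual d q)).add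
      (((tendsto_log_succ_div d hn).const_mul 8).add (tendsto_log_succ_div 1 hn))
    simpa using this
  obtain ⟨ℓ, -, h2⟩ := exists_lower_bound_star (by have := h.ge_ten; omega) hn
    (eventually_even_intensityFilter d _) (hq'.pos h) (hq'.lt_one h) (hq'.starB_lt h) hk
  rw [PhiStar_alphaOf h hq' hα]
  refine le_of_tendsto_of_tendsto (tendsto_logFirstMoment h hq' hα) h3 ?_
  filter_upwards [h2, eventually_expected_le h hq hα, hn.eventually_gt_atTop 0] with p hp hE hn0
  have hn' : (0 : ℝ) < p.1 := by exact_mod_cast hn0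
  have h4 := Real.log_le_log hp.1 hE
  rw [Real.log_exp] at h4
  unfold logFirstMoment
  rw [div_le_iff₀ hn']
  refine h4.trans (le_of_eq ?_)
  push_cast
  field_simp
  ring

/-- The majorant that touches at `α` has negative slope and bounds the value at every larger
intensity. -/
theorem strictAntiOn_PhiStar (h : LargeDegree d) :
    StrictAntiOn (PhiStar d) (Set.Icc (alphaLbd d) (alphaUbd d)) := by
  intro α hα α' hα' hlt
  obtain ⟨q, hq, rfl, -⟩ := exists_goodQ h hα
  have h1 := PhiStar_le h hq hα'
  rw [PhiStar_alphaOf h hq hα]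
  have h2 := mul_pos (sub_pos.2 hlt) (Real.log_pos (one_lt_lambdaOf h hq))
  linarith

theorem log_lambdaOf_le (h : LargeDegree d) (hq : GoodQ d q) : Real.log (lambdaOf d q) ≤ d := by
  have hd2 : 2 ≤ d := by have := h.ge_ten; omega
  have h0 := hq.pos h
  have h1 := hq.lt_one h
  have h2 := hq.le_small h
  have hX := starX_pos h0 h1
  have hX1 : starX q ≤ 1 := by
    unfold starX; rw [div_le_one (by linarith)]; linarith
  have hK := starK_pos hd2 h0 h1
  have hK1 : starK d q ≤ 2 ^ d := by
    have h3 : (1 + starX q) ^ (d - 1) ≤ 2 ^ (d - 1) := pow_le_pow_left₀ (by linarith)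
      (by linarith) _
    have h4 : (2 : ℝ) ^ (d - 1) ≤ 2 ^ d := pow_le_pow_right₀ (by norm_num) (Nat.sub_le _ _)
    unfold starK
    linarith
  rw [lambdaOf_eq hd2 h1]
  calc Real.log (starX q * starK d q) ≤ Real.log (2 ^ d) := by
        apply Real.log_le_log (by positivity)
        nlinarith
    _ = d * Real.log 2 := Real.log_pow _ _
    _ ≤ d * 1 := by
      have := Real.log_two_lt_d9
      gcongr
      linarith
    _ = d := mul_one _

/-- Touching majorants with slopes in `[-d, 0]` make the exponent `d`-Lipschitz. -/
theorem continuousOn_PhiStar (h : LargeDegree d) :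
    ContinuousOn (PhiStar d) (Set.Icc (alphaLbd d) (alphaUbd d)) := by
  have key : ∀ α ∈ Set.Icc (alphaLbd d) (alphaUbd d), ∀ α' ∈ Set.Icc (alphaLbd d) (alphaUbd d),
      PhiStar d α - PhiStar d α' ≤ d * |α - α'| := by
    intro α hα α' hα'
    obtain ⟨q, hq, rfl, -⟩ := exists_goodQ h hα'
    have h1 := PhiStar_le h hq hα
    rw [PhiStar_alphaOf h hq hα']
    have h2 := Real.log_pos (one_lt_lambdaOf h hq)
    calc PhiStar d α - (starDual d q - alphaOf d q * Real.log (lambdaOf d q)) ≤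
          Real.log (lambdaOf d q) * -(α - alphaOf d q) := by linarith
      _ ≤ Real.log (lambdaOf d q) * |α - alphaOf d q| := by
          gcongr; exact neg_le_abs _
      _ ≤ _ := by gcongr; exact log_lambdaOf_le h hq
  have : LipschitzOnWith (d : NNReal) (PhiStar d) (Set.Icc (alphaLbd d) (alphaUbd d)) := by
    refine LipschitzOnWith.of_dist_le_mul fun x hx y hy => ?_
    rw [Real.dist_eq, Real.dist_eq, NNReal.coe_natCast, abs_le]
    have h1 := key x hx y hy
    have h2 := key y hy x hx
    rw [abs_sub_comm] at h2
    constructor <;> linarith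
  exact this.continuousOn

end GoodRange

/-! ### Comparison with the exponent of independent sets. -/

section Comparison

variable {d : ℕ} {q : ℝ}

theorem GoodQ.one_add_mul_le (h : LargeDegree d) (hq : GoodQ d q) : 1 + d * q ≤ degRoot d := by
  have h1 := hq.mul_le h
  have h2 := h.log_le_root
  have h3 := h.log_ge
  linarith

theorem GoodQ.sq_mul_starY_le (h : LargeDegree d) (hq : GoodQ d q) :
    (1 + d * q) ^ 2 * (d * starY d q) ≤ 1 / 1000 := by
  have hw := h.root_pos
  have h0 := hq.pos h
  have hd := h.cast_pos
  have hy := hq.starY_pos h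
  have h2 : degRoot d ≤ degRoot d ^ 11 := le_self_pow₀ (by linarith [h.root_ge]) (by norm_num)
  calc (1 + d * q) ^ 2 * (d * starY d q) ≤ degRoot d ^ 2 * (2 / degRoot d ^ 13) := by
        gcongr
        · exact hq.one_add_mul_le h
        · exact hq.d_mul_starY_le h
    _ = 2 / degRoot d ^ 11 := by field_simp
    _ ≤ _ := by
        rw [div_le_div_iff₀ (by positivity) (by norm_num)]
        linarith [h.root_ge]

theorem GoodQ.mul_mul_le (h : LargeDegree d) (hq : GoodQ d q) : (1 + d * q) * q ≤ 1 / 1000000 := by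
  have hw := h.root_pos
  have h0 := hq.pos h
  have hd := h.cast_pos
  have h2 : degRoot d ≤ degRoot d ^ 18 := le_self_pow₀ (by linarith [h.root_ge]) (by norm_num)
  calc (1 + d * q) * q ≤ degRoot d * (1 / (100 * degRoot d ^ 19)) := by
        gcongr
        · exact hq.one_add_mul_le h
        · exact h.small_of_le hq.le
    _ = 1 / (100 * degRoot d ^ 18) := by field_simp
    _ ≤ _ := by
        apply one_div_le_one_div_of_le (by norm_num)
        linarith [h.root_ge]

theorem fewTokens_starX (hd : 2 ≤ d) (h1 : q < 1) :
    fewTokens d (starX q) = starY d q * (1 - q + d * q) := by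
  obtain ⟨m, rfl⟩ : ∃ m, d = m + 1 := ⟨d - 1, by omega⟩
  have : 1 - q ≠ 0 := by linarith
  unfold fewTokens starY
  rw [one_add_starX h1, starX, Nat.add_sub_cancel, inv_pow, pow_succ]
  field_simp

/-- The exponents of independent sets and of the frozen model. -/
theorem PhiIS_sub_eq (hd : 2 ≤ d) (h0 : 0 < q) (h1 : q < 1) {α : ℝ} (hα : 0 < α)
    (hα' : α < 1 / 2) :
    PhiIS d α - (starDual d q - α * Real.log (lambdaOf d q)) =
      α * (Real.log (starA d q) - Real.log α)
      + (1 - α) * (Real.log (starN d q) - Real.log (1 - α))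
      + d * (1 - 2 * α) / 2 * (Real.log (starR d q) - Real.log (d * (1 - 2 * α)))
      + d * (1 - α) * (Real.log (d * (1 - α)) - Real.log (starR d q + d * starA d q))
      - (1 - α) * Real.log (1 - fewTokens d (starX q)) := by
  have hK := starK_pos hd h0 h1
  have hE := starE_pos hd h0 h1
  have hX := starX_pos h0 h1
  have hR := starR_pos hd h0 h1
  have hg := tokenPoly_pos hd (starX_pos h0 h1)
  have hd0 : (0 : ℝ) < d := by exact_mod_cast (by omega : 0 < d)
  have hf := fewTokens_lt_one hd hX
  have lA : Real.log (starA d q) = Real.log (starX q) - Real.log (starE d q) :=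
    Real.log_div hX.ne' hE.ne'
  have lN : Real.log (starN d q) = Real.log (tokenPoly d (starX q)) -
      (Real.log (starK d q) + Real.log (starE d q)) := by
    rw [starN, Real.log_div hg.ne' (by positivity), Real.log_mul hK.ne' hE.ne']
  have lg : Real.log (tokenPoly d (starX q)) =
      d * Real.log (1 + starX q) + Real.log (1 - fewTokens d (starX q)) := by
    rw [tokenPoly_eq hX, Real.log_mul (by positivity) (by linarith), Real.log_pow]
  have lR : Real.log (starR d q) = Real.log d - Real.log (starE d q) :=
    Real.log_div hd0.ne' hE.ne'
  have lL : Real.log (lambdaOf d q) = Real.log (starX q) + Real.log (starK d q) := by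
    rw [lambdaOf_eq hd h1, Real.log_mul hX.ne' hK.ne']
  have lS : Real.log (starR d q + d * starA d q) =
      Real.log d - Real.log (starE d q) + Real.log (1 + starX q) := by
    rw [← starR_mul_starX hd h0 h1, ← mul_one_add, Real.log_mul hR.ne' (by linarith), lR]
  have l1 : Real.log (d * (1 - 2 * α)) = Real.log d + Real.log (1 - 2 * α) :=
    Real.log_mul hd0.ne' (by linarith)
  have l2 : Real.log (d * (1 - α)) = Real.log d + Real.log (1 - α) :=
    Real.log_mul hd0.ne' (by linarith)
  unfold PhiIS starDual Real.binEntropy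
  rw [Real.log_inv, Real.log_inv, lL, lA, lN, lS, l1, l2, lR, lg]
  ring

theorem log_one_sub_bounds {t : ℝ} (ht1 : t ≤ 1 / 2) :
    t ≤ -Real.log (1 - t) ∧ -Real.log (1 - t) ≤ t + 2 * t ^ 2 := by
  have h1 := Real.log_le_sub_one_of_pos (x := 1 - t) (by linarith)
  have h2 := Real.one_sub_inv_le_log_of_pos (x := 1 - t) (by linarith)
  refine ⟨by linarith, ?_⟩
  have h3 : (1 - t)⁻¹ ≤ 1 + t + 2 * t ^ 2 := by
    rw [inv_le_iff_one_le_mul₀ (by linarith)]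
    nlinarith [mul_nonneg (sq_nonneg t) (by linarith : 0 ≤ 1 - 2 * t)]
  linarith

theorem mul_log_sub_log_bounds {u v : ℝ} (hu : 0 < u) (hv : 0 < v) :
    v - u - (v - u) ^ 2 / v ≤ u * (Real.log v - Real.log u) ∧
      u * (Real.log v - Real.log u) ≤ v - u := by
  have h1 := mul_le_mul_of_nonneg_left (log_sub_log_le hv hu) hu.le
  have h2 := mul_le_mul_of_nonneg_left (one_sub_inv_le_log_div hv hu) hu.le
  have e1 : u * (v / u - 1) = v - u := by field_simp
  have e2 : u * (1 - u / v) = v - u - (v - u) ^ 2 / v := by field_simp; ring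
  exact ⟨e2 ▸ h2, e1 ▸ h1⟩

/-- The cost of moving the four densities of the frozen model by a density `b` of free vertices. -/
theorem entropy_shift_bounds {d A b α N R : ℝ} (hd : 1000 ≤ d) (hA : 1 / d ≤ A) (hb : 0 ≤ b)
    (hα1 : α ≤ 1 / 100) (hα : A + b / 2 = α) (hN : 1 - A - b = N)
    (hR : d * (1 - 2 * A) - b = R) :
    -b / 2 - 2 * (d * b ^ 2) ≤
        α * (Real.log A - Real.log α) + (1 - α) * (Real.log N - Real.log (1 - α))
        + d * (1 - 2 * α) / 2 * (Real.log R - Real.log (d * (1 - 2 * α)))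
        + d * (1 - α) * (Real.log (d * (1 - α)) - Real.log (R + d * A)) ∧
      α * (Real.log A - Real.log α) + (1 - α) * (Real.log N - Real.log (1 - α))
        + d * (1 - 2 * α) / 2 * (Real.log R - Real.log (d * (1 - 2 * α)))
        + d * (1 - α) * (Real.log (d * (1 - α)) - Real.log (R + d * A)) ≤
      -b / 2 + 2 * (d * b ^ 2) := by
  have hd0 : 0 < d := by linarith
  have hA0 : 0 < A := lt_of_lt_of_le (by positivity) hA
  have hα0 : 0 < α := by linarith
  have hN0 : 1 / 2 ≤ N := by linarith
  have hu3 : 0 < d * (1 - 2 * α) := mul_pos hd0 (by linarith)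
  have hu4 : 0 < d * (1 - α) := mul_pos hd0 (by linarith)
  -- To first order the four terms are `-b/2`, `-b/2`, `(d - 1)b/2` and `-(d/2 - 1)b`, with sum
  -- `-b/2`. The rest is of order `d b²`.
  have e1 : A - α = -b / 2 := by linarith
  have e2 : N - (1 - α) = -b / 2 := by linarith
  have e3 : R - d * (1 - 2 * α) = (d - 1) * b := by rw [← hR, ← hα]; ring
  have e4 : R + d * A - d * (1 - α) = (d / 2 - 1) * b := by rw [← hR, ← hα]; ring
  have hb3 : 0 ≤ (d - 1) * b := mul_nonneg (by linarith) hb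
  have hb4 : 0 ≤ (d / 2 - 1) * b := mul_nonneg (by linarith) hb
  have hR0 : 1 / 2 * d ≤ R := by
    have : d * (1 / 2) ≤ d * (1 - 2 * α) := by gcongr; linarith
    linarith
  have hS0 : 1 / 2 * d ≤ R + d * A := by
    have : 0 ≤ d * A := by positivity
    linarith
  have sq1 : (-b / 2) ^ 2 / A ≤ d * b ^ 2 / 4 := by
    have : 1 ≤ d * A := by rwa [div_le_iff₀ hd0, mul_comm] at hA
    rw [div_le_iff₀ hA0]
    have := mul_le_mul_of_nonneg_left this (sq_nonneg b)
    linarith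
  have sq2 : (-b / 2) ^ 2 / N ≤ d * b ^ 2 / 4 := by
    have : 1 ≤ d * N := by
      have : d * (1 / 2) ≤ d * N := by gcongr
      linarith
    rw [div_le_iff₀ (by linarith)]
    have := mul_le_mul_of_nonneg_left this (sq_nonneg b)
    linarith
  have sq3 : ((d - 1) * b) ^ 2 / R ≤ 2 * (d * b ^ 2) := by
    calc ((d - 1) * b) ^ 2 / R ≤ (d * b) ^ 2 / (1 / 2 * d) := by
          gcongr
          linarith
      _ = _ := by field_simp
  have sq4 : ((d / 2 - 1) * b) ^ 2 / (R + d * A) ≤ d * b ^ 2 / 2 := by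
    calc ((d / 2 - 1) * b) ^ 2 / (R + d * A) ≤ (d / 2 * b) ^ 2 / (1 / 2 * d) := by
          gcongr
          linarith
      _ = _ := by field_simp
  obtain ⟨l1, u1⟩ := mul_log_sub_log_bounds hα0 hA0
  obtain ⟨l2, u2⟩ := mul_log_sub_log_bounds (by linarith : 0 < 1 - α) (by linarith : 0 < N)
  obtain ⟨l3, u3⟩ := mul_log_sub_log_bounds hu3 (by linarith : 0 < R)
  obtain ⟨l4, u4⟩ := mul_log_sub_log_bounds hu4 (by linarith : 0 < R + d * A)
  rw [e1] at l1 u1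
  rw [e2] at l2 u2
  rw [e3] at l3 u3
  rw [e4] at l4 u4
  have f3 : d * (1 - 2 * α) / 2 * (Real.log R - Real.log (d * (1 - 2 * α))) =
    d * (1 - 2 * α) * (Real.log R - Real.log (d * (1 - 2 * α))) / 2 := by ring
  have f4 : d * (1 - α) * (Real.log (d * (1 - α)) - Real.log (R + d * A)) =
    -(d * (1 - α) * (Real.log (R + d * A) - Real.log (d * (1 - α)))) := by ring
  have hq := mul_nonneg hd0.le (sq_nonneg b)
  rw [f3, f4]
  constructor <;> linarith only [l1, u1, l2, u2, l3, u3, l4, u4, sq1, sq2, sq3, sq4, hq]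

theorem GoodQ.starB_le_mul (h : LargeDegree d) (hq : GoodQ d q) :
    starB d q ≤ 2 * (d * q) * starY d q := by
  have hd2 : 2 ≤ d := by have := h.ge_ten; omega
  have h0 := hq.pos h
  have hA := starA_pos hd2 h0 (hq.lt_one h)
  have hK := starK_pos hd2 h0 (hq.lt_one h)
  rw [hq.starB_eq h]
  calc d * starA d q * (1 / starK d q) ≤ d * q * (2 * starY d q) := by
        gcongr
        · exact hq.starA_le h
        · exact hq.inv_starK_le h
    _ = _ := by ring

theorem GoodQ.sq_mul_starY_le' (h : LargeDegree d) (hq : GoodQ d q) :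
    (1 + d * q) ^ 2 * starY d q ≤ 1 / 1000 := by
  have hy := hq.starY_pos h
  refine le_trans ?_ (hq.sq_mul_starY_le h)
  gcongr
  exact le_mul_of_one_le_left hy.le (by linarith [h.cast_ge])

/-- From `B = d A / K` with `A ≈ q` and `1 / K ≈ y`. -/
theorem GoodQ.starB_bounds (h : LargeDegree d) (hq : GoodQ d q) :
    |starB d q - d * q * starY d q| ≤ 2 / 1000 * starY d q := by
  have hd := h.cast_pos
  have h0 := hq.pos h
  have hy := hq.starY_pos h
  have hys := hq.starY_le' h
  have hsm := hq.mul_mul_le h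
  have hA := hq.starA_le h
  have hA' := hq.le_starA h
  have hyq := hq.sq_mul_starY_le' h
  rw [hq.starB_eq h, hq.inv_starK h]
  generalize starY d q = y at *
  generalize starA d q = A at *
  have hqs := hq.le_small h
  have hA0 : 0 ≤ A := by nlinarith only [hA', hqs, h0]
  have hdq : 0 < d * q := by positivity
  have i1 : y ≤ y / (1 - y) := by
    rw [le_div_iff₀ (by linarith)]; nlinarith
  have i2 : y / (1 - y) ≤ y + 2 * y ^ 2 := by
    rw [div_le_iff₀ (by linarith)]
    nlinarith only [mul_nonneg (sq_nonneg y) (by linarith : 0 ≤ 1 - 2 * y)]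
  have j1 : d * (q - 2 * q ^ 2) * y ≤ d * A * (y / (1 - y)) := by gcongr
  have i3 : 0 ≤ y / (1 - y) := hy.le.trans i1
  have j2 : d * A * (y / (1 - y)) ≤ d * q * (y + 2 * y ^ 2) := by gcongr
  have j3 : (d * q * q) * y ≤ 1 / 1000000 * y := by
    gcongr
    nlinarith only [hsm, h0]
  have j4 : (d * q * y) * y ≤ 1 / 1000 * y := by
    gcongr
    nlinarith only [hyq, hdq, hy, mul_pos hdq hy, mul_pos hdq (mul_pos hdq hy)]
  rw [abs_le]
  constructor <;> linarith only [j1, j2, j3, j4, hy]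

theorem GoodQ.alphaOf_le (h : LargeDegree d) (hq : GoodQ d q) : alphaOf d q ≤ 2 * q := by
  have hd2 : 2 ≤ d := by have := h.ge_ten; omega
  have h0 := hq.pos h
  have i1 : d * starY d q ≤ 1 := (hq.d_mul_starY_le' h).trans (by norm_num)
  have i3 := mul_le_mul_of_nonneg_left i1 h0.le
  rw [← starA_add_starB hd2 h0 (hq.lt_one h)]
  linarith [hq.starB_le_mul h, hq.starA_le h]

/-- At most one token occurs with probability `y(1 - q + dq)`, small enough to linearize the
logarithm. -/
theorem GoodQ.token_bounds (h : LargeDegree d) (hq : GoodQ d q) {α : ℝ} (hα0 : 0 < α)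
    (hα : α ≤ 2 * q) :
    |-((1 - α) * Real.log (1 - fewTokens d (starX q))) - starY d q * (1 + d * q)| ≤
      1 / 100 * starY d q := by
  have hd2 : 2 ≤ d := by have := h.ge_ten; omega
  have h0 := hq.pos h
  have hd := h.cast_pos
  have hy := hq.starY_pos h
  have hqs := hq.le_small h
  have hsm := hq.mul_mul_le h
  have hyq := hq.sq_mul_starY_le' h
  rw [fewTokens_starX hd2 (hq.lt_one h)]
  generalize starY d q = y at *
  have hdq : 0 < d * q := by positivity
  have hτ0 : 0 < y * (1 - q + d * q) := mul_pos hy (by linarith)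
  have hτ1 : y * (1 - q + d * q) ≤ y * (1 + d * q) := by gcongr; linarith
  have hτ3 : y * (1 + d * q) - 1 / 1000000 * y ≤ y * (1 - q + d * q) := by nlinarith only [hqs, hy]
  have hτ4 : y * (1 + d * q) ≤ 1 / 1000 := by
    nlinarith only [hyq, hdq, hy, mul_pos hdq hy, mul_pos hdq (mul_pos hdq hy)]
  have hτ2 : (y * (1 - q + d * q)) ^ 2 ≤ 1 / 1000 * y := by
    calc (y * (1 - q + d * q)) ^ 2 ≤ (y * (1 + d * q)) ^ 2 := by gcongr
      _ = ((1 + d * q) ^ 2 * y) * y := by ring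
      _ ≤ _ := by gcongr
  have hατ : α * (y * (1 - q + d * q)) ≤ 1 / 1000 * y := by
    calc α * (y * (1 - q + d * q)) ≤ (2 * q) * (y * (1 + d * q)) := by gcongr
      _ = 2 * ((1 + d * q) * q) * y := by ring
      _ ≤ 2 * (1 / 1000000) * y := by gcongr
      _ ≤ _ := by linarith
  generalize y * (1 - q + d * q) = τ at *
  obtain ⟨hl1, hl2⟩ := log_one_sub_bounds (t := τ) (by linarith)
  have i1 : (1 - α) * τ ≤ (1 - α) * -Real.log (1 - τ) :=
    mul_le_mul_of_nonneg_left hl1 (by linarith)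
  have i2 : (1 - α) * -Real.log (1 - τ) ≤ 1 * -Real.log (1 - τ) :=
    mul_le_mul_of_nonneg_right (by linarith) (by linarith)
  rw [abs_le]
  constructor <;> linarith only [hl1, hl2, i1, i2, hτ1, hτ2, hτ3, hατ, hy]

/-- The loss `y(1 + dq)` from requiring two tokens, less half the free density `B ≈ dq·y`, leaves
`y(1 + dq/2)` up to small multiples of `y`. -/
theorem PhiIS_sub_bounds (h : LargeDegree d) (hq : GoodQ d q)
    (hα : alphaOf d q ∈ Set.Icc (alphaLbd d) (alphaUbd d)) :
    |PhiIS d (alphaOf d q) - PhiStar d (alphaOf d q) - starY d q * (d * q / 2)| ≤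
      2 * starY d q := by
  have hd2 : 2 ≤ d := by have := h.ge_ten; omega
  have h0 := hq.pos h
  have h1 := hq.lt_one h
  have hd := h.cast_pos
  have hy := hq.starY_pos h
  have hqs := hq.le_small h
  have hαpos := alphaOf_pos_of_mem h hα
  have hαle := hq.alphaOf_le h
  have hB0 := starB_pos hd2 h0 h1
  have hBub := hq.starB_le_mul h
  have hyq := hq.sq_mul_starY_le h
  have hdq : 0 < d * q := by positivity
  have hdb2 : d * starB d q ^ 2 ≤ 4 / 1000 * starY d q := by
    calc d * starB d q ^ 2 ≤ d * (2 * (d * q) * starY d q) ^ 2 := by gcongr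
      _ = 4 * ((d * q) ^ 2 * (d * starY d q)) * starY d q := by ring
      _ ≤ 4 * ((1 + d * q) ^ 2 * (d * starY d q)) * starY d q := by gcongr; linarith
      _ ≤ 4 * (1 / 1000) * starY d q := by gcongr
      _ = _ := by ring
  obtain ⟨l1, u1⟩ := entropy_shift_bounds (by linarith [h.cast_ge]) (hq.inv_le_starA h) hB0.le
    (by linarith) (starA_add_starB hd2 h0 h1) (starN_eq hd2 h0 h1) (starR_eq hd2 h0 h1)
  have ht := abs_le.1 (hq.token_bounds h hαpos hαle)
  have hb := abs_le.1 (hq.starB_bounds h)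
  rw [PhiStar_alphaOf h hq hα, PhiIS_sub_eq hd2 h0 h1 hαpos (by linarith), abs_le]
  constructor <;> linarith only [l1, u1, ht.1, ht.2, hb.1, hb.2, hdb2, hy]

end Comparison

/-! ### Asymptotics near the first moment threshold of independent sets. -/

section Gap

variable {d : ℕ} {q : ℝ}

theorem LargeDegree.inv_root_le (h : LargeDegree d) {c : ℝ} {m : ℕ} (hc : c ≤ 1) (hm : m ≠ 0) :
    c / degRoot d ^ m ≤ 1 / (1000 * Real.log d) := by
  have hw := h.root_pos
  have h1 := h.log_le_root
  have h2 := h.log_pos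
  have h3 : degRoot d ≤ degRoot d ^ m := le_self_pow₀ (by linarith [h.root_ge]) hm
  gcongr
  exact h1.trans h3

theorem GoodQ.mul_mul_le_inv_log (h : LargeDegree d) (hq : GoodQ d q) :
    (1 + d * q) * q ≤ 1 / (1000 * Real.log d) := by
  have hw := h.root_pos
  have h0 := hq.pos h
  have hd := h.cast_pos
  refine le_trans ?_ (h.inv_root_le (c := 1 / 100) (m := 18) (by norm_num) (by norm_num))
  calc (1 + d * q) * q ≤ degRoot d * (1 / (100 * degRoot d ^ 19)) := by
        gcongr
        · exact hq.one_add_mul_le h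
        · exact h.small_of_le hq.le
    _ = _ := by field_simp

theorem GoodQ.mul_starY_le_inv_log (h : LargeDegree d) (hq : GoodQ d q) :
    (1 + d * q) * (d * starY d q) ≤ 1 / (1000 * Real.log d) := by
  have hw := h.root_pos
  have h0 := hq.pos h
  have hd := h.cast_pos
  have hy := hq.starY_pos h
  have h1 : 2 / degRoot d ≤ 1 := by rw [div_le_one hw]; linarith [h.root_ge]
  refine le_trans ?_ (h.inv_root_le (m := 11) h1 (by norm_num))
  calc (1 + d * q) * (d * starY d q) ≤ degRoot d * (2 / degRoot d ^ 13) := by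
        gcongr
        · exact hq.one_add_mul_le h
        · exact hq.d_mul_starY_le h
    _ = _ := by field_simp

theorem GoodQ.abs_log_starY_add_le (h : LargeDegree d) (hq : GoodQ d q) :
    |Real.log (starY d q) + d * q| ≤ 1 / (100 * Real.log d) := by
  have h0 := hq.pos h
  have hd := h.cast_ge
  have hs := hq.mul_mul_le_inv_log h
  have he : 1 / (100 * Real.log d) = 10 * (1 / (1000 * Real.log d)) := by
    have := h.log_pos
    field_simp; norm_num
  have hdq : 0 < d * q := by have := h.cast_pos; positivity
  have hl : Real.log (starY d q) = -((d - 1) * -Real.log (1 - q)) := by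
    have := h.ge_ten
    rw [starY, Real.log_pow, Nat.cast_sub (by omega)]
    push_cast; ring
  obtain ⟨l, u⟩ := log_one_sub_bounds (t := q) (by linarith [hq.le_small h])
  have l' := mul_le_mul_of_nonneg_left l (by linarith : (0 : ℝ) ≤ d - 1)
  have u' := mul_le_mul_of_nonneg_left u (by linarith : (0 : ℝ) ≤ d - 1)
  have := mul_nonneg hdq.le h0.le
  have := sq_nonneg q
  rw [hl, he, abs_le]
  constructor <;> linarith

theorem GoodQ.abs_log_lambdaOf_sub_le (h : LargeDegree d) (hq : GoodQ d q) :
    |Real.log (lambdaOf d q) - (Real.log q + d * q)| ≤ 1 / (100 * Real.log d) := by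
  have h0 := hq.pos h
  have h1 := hq.lt_one h
  have hd := h.cast_ge
  have hy := hq.starY_pos h
  have hy1 := hq.starY_le' h
  have hs := hq.mul_mul_le_inv_log h
  have ht := hq.mul_starY_le_inv_log h
  have he : 1 / (100 * Real.log d) = 10 * (1 / (1000 * Real.log d)) := by
    have := h.log_pos
    field_simp; norm_num
  have hdq : 0 < d * q := by have := h.cast_pos; positivity
  have hl : Real.log (lambdaOf d q) =
      Real.log q + (Real.log (1 - starY d q) + d * -Real.log (1 - q)) := by
    have : (0 : ℝ) < (1 - q) ^ d := pow_pos (by linarith) _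
    change Real.log (q * ((1 - starY d q) / (1 - q) ^ d)) = _
    rw [Real.log_mul h0.ne' (div_pos (by linarith) this).ne',
      Real.log_div (by linarith) this.ne', Real.log_pow]
    ring
  obtain ⟨l, u⟩ := log_one_sub_bounds (t := q) (by linarith [hq.le_small h])
  obtain ⟨l2, u2⟩ := log_one_sub_bounds (t := starY d q) (by linarith)
  have l' := mul_le_mul_of_nonneg_left l (by linarith : (0 : ℝ) ≤ d)
  have u' := mul_le_mul_of_nonneg_left u (by linarith : (0 : ℝ) ≤ d)
  have i1 : starY d q ^ 2 ≤ starY d q := by nlinarith only [hy, hy1]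
  have i2 : starY d q ≤ d * starY d q := le_mul_of_one_le_left hy.le (by linarith)
  have i3 : 0 ≤ d * q * (d * starY d q) := by positivity
  rw [hl, he, abs_le]
  constructor <;> linarith

theorem GoodQ.abs_mul_sub_alphaOf_le (h : LargeDegree d) (hq : GoodQ d q) :
    |d * q - d * alphaOf d q| ≤ 1 / (100 * Real.log d) := by
  have hd2 : 2 ≤ d := by have := h.ge_ten; omega
  have h0 := hq.pos h
  have hd := h.cast_pos
  have hB := starB_pos hd2 h0 (hq.lt_one h)
  have hs := hq.mul_mul_le_inv_log h
  have ht := hq.mul_starY_le_inv_log h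
  have he : 1 / (100 * Real.log d) = 10 * (1 / (1000 * Real.log d)) := by
    have := h.log_pos
    field_simp; norm_num
  have hy := hq.starY_pos h
  have l := mul_le_mul_of_nonneg_left (hq.le_starA h) hd.le
  have u := mul_le_mul_of_nonneg_left (hq.starA_le h) hd.le
  have u2 := mul_le_mul_of_nonneg_left (hq.starB_le_mul h) hd.le
  have := mul_pos hd hB
  have := mul_pos hd hy
  rw [← starA_add_starB hd2 h0 (hq.lt_one h), he, abs_le]
  constructor <;> linarith

theorem abs_one_sub_mul_log_le {t : ℝ} (h0 : 0 ≤ t) (h1 : t ≤ 1 / 2) :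
    |(1 - t) * Real.log (1 - t) + t - t ^ 2 / 2| ≤ 2 * t ^ 3 := by
  have h2 := Real.abs_log_sub_add_sum_range_le (x := t) (by rw [abs_of_nonneg h0]; linarith) 2
  rw [abs_of_nonneg h0, le_div_iff₀ (by linarith), ← abs_of_pos (by linarith : 0 < 1 - t)]
    at h2
  simp only [Finset.sum_range_succ, Finset.sum_range_zero] at h2
  norm_num at h2
  rw [← abs_mul] at h2
  have := pow_nonneg h0 3
  rw [abs_le] at h2 ⊢
  constructor <;> nlinarith only [h2.1, h2.2, this]

/-- Insert `(1 - t) log (1 - t) = -t + t²/2 + O(t³)` at `t = α` and `t = 2α`. -/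
theorem abs_PhiIS_sub_le (d : ℕ) {α : ℝ} (h0 : 0 ≤ α) (h1 : α ≤ 1 / 4) :
    |PhiIS d α - α * (1 - Real.log α - d * α / 2)| ≤ α * (α + 10 * (d * α) * α) := by
  have e1 := abs_le.1 (abs_one_sub_mul_log_le h0 (by linarith))
  have e2 := abs_le.1 (abs_one_sub_mul_log_le (t := 2 * α) (by linarith) (by linarith))
  have hd : (0 : ℝ) ≤ d := Nat.cast_nonneg d
  have hs : 2 * α ^ 3 ≤ α ^ 2 / 2 := by nlinarith [mul_nonneg (sq_nonneg α) (sub_nonneg.2 h1)]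
  unfold PhiIS Real.binEntropy
  rw [Real.log_inv, Real.log_inv]
  set L1 := (1 - α) * Real.log (1 - α)
  set L2 := (1 - 2 * α) * Real.log (1 - 2 * α)
  have f1 := mul_le_mul_of_nonneg_left e1.1 hd
  have f2 := mul_le_mul_of_nonneg_left e1.2 hd
  have f3 := mul_le_mul_of_nonneg_left e2.1 hd
  have f4 := mul_le_mul_of_nonneg_left e2.2 hd
  have e : α * -Real.log α + (1 - α) * -Real.log (1 - α)
      - d * (1 / 2 * (1 - 2 * α) * Real.log (1 - 2 * α) - L1) - α * (1 - Real.log α - d * α / 2)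
      = -L1 - d * (L2 / 2 - L1) - α + d * α ^ 2 / 2 := by
    simp only [L1, L2]; ring
  rw [e, abs_le]
  constructor <;> nlinarith only [e1.1, e1.2, f1, f2, f3, f4, hs]

theorem continuous_PhiIS (d : ℕ) : Continuous (PhiIS d) := by
  have h1 : Continuous fun α : ℝ => (1 - α) * Real.log (1 - α) :=
    Real.continuous_mul_log.comp (by fun_prop)
  have h2 : Continuous fun α : ℝ => (1 - 2 * α) * Real.log (1 - 2 * α) :=
    Real.continuous_mul_log.comp (by fun_prop)
  unfold PhiIS
  simp only [mul_assoc]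
  exact Real.binEntropy_continuous.sub
    (continuous_const.mul ((continuous_const.mul h2).sub h1))

/-- The error of the expansion of the exponent of independent sets near the threshold. -/
theorem LargeDegree.expansion_error_le (h : LargeDegree d) {α : ℝ} (h0 : 0 < α)
    (hα : d * α ≤ 2 * Real.log d) :
    α + 10 * (d * α) * α ≤ 1 / (100 * Real.log d) := by
  have hw := h.root_pos
  have hd := h.cast_pos
  have he : 1 / (100 * Real.log d) = 10 * (1 / (1000 * Real.log d)) := by
    have := h.log_pos
    field_simp; norm_num
  have hs : α ≤ 3 * (Real.log d / d) := by
    rw [← mul_div_assoc, le_div_iff₀ hd]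
    linarith [h.log_pos]
  have hdα : 0 < d * α := by positivity
  have : (1 + d * α) * α ≤ 1 / (1000 * Real.log d) := by
    refine le_trans ?_ (h.inv_root_le (c := 1 / 100) (m := 18) (by norm_num) (by norm_num))
    calc (1 + d * α) * α ≤ degRoot d * (1 / (100 * degRoot d ^ 19)) := by
          gcongr
          · linarith [h.log_le_root, h.log_ge]
          · exact h.small_of_le hs
      _ = _ := by field_simp
  rw [he]
  linarith

/-- For `dα ≤ (5/3) log d` the bracket `1 - log α - dα/2` of the expansion is at least `(1/6) log d
- log log d`. -/
theorem LargeDegree.PhiIS_pos (h : LargeDegree d) {α : ℝ} (h0 : 0 < α) (hα : α ≤ alphaLbd d) :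
    α * (Real.log d / 10) ≤ PhiIS d α := by
  have hd := h.cast_pos
  have hl := h.log_pos
  have hdα : d * α ≤ 5 / 3 * Real.log d := by
    rw [alphaLbd, le_div_iff₀ hd] at hα; linarith
  have hdα0 : 0 < d * α := by positivity
  have he := h.expansion_error_le h0 (by linarith)
  have he' : 1 / (100 * Real.log d) ≤ 1 := by
    rw [div_le_one (by positivity)]; linarith [h.log_ge]
  have hlog : Real.log α ≤ Real.log (Real.log d) + 1 - Real.log d := by
    have e : Real.log α = Real.log (d * α) - Real.log d := by
      rw [Real.log_mul hd.ne' h0.ne']; ring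
    have : Real.log (d * α) ≤ Real.log (5 / 3) + Real.log (Real.log d) := by
      rw [← Real.log_mul (by norm_num) hl.ne']
      exact Real.log_le_log hdα0 hdα
    have := Real.log_le_sub_one_of_pos (x := 5 / 3) (by norm_num)
    linarith
  have hb := (abs_le.1 (abs_PhiIS_sub_le d h0.le (by
    have : α ≤ 1 := by nlinarith only [he, he', hdα0, h0, mul_pos hdα0 h0]
    have h2 : α ≤ 3 * (Real.log d / d) := by
      rw [← mul_div_assoc, le_div_iff₀ hd]; linarith
    linarith [h.small_of_le' h2]))).1
  have : α * (α + 10 * (d * α) * α) ≤ α * 1 := by gcongr; linarith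
  have : α * (Real.log d / 10 + 1) ≤ α * (1 - Real.log α - d * α / 2) := by
    gcongr
    linarith [h.loglog_le, h.log_ge]
  linarith

theorem LargeDegree.alphaUbd_le (h : LargeDegree d) : alphaUbd d ≤ 1 / 1000000 := by
  apply h.small_of_le'
  have : 0 ≤ Real.log d / d := div_nonneg h.log_pos.le h.cast_pos.le
  rw [alphaUbd, mul_div_assoc]
  linarith

theorem LargeDegree.alphaLbd_pos (h : LargeDegree d) : 0 < alphaLbd d := by
  have := h.log_pos
  have := h.cast_pos
  unfold alphaLbd
  positivity

theorem LargeDegree.alphaLbd_le_alphaUbd (h : LargeDegree d) : alphaLbd d ≤ alphaUbd d := by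
  have := h.log_pos
  have := h.cast_pos
  unfold alphaLbd alphaUbd
  gcongr
  norm_num

theorem LargeDegree.PhiIS_alphaUbd_neg (h : LargeDegree d) : PhiIS d (alphaUbd d) < 0 := by
  have hd := h.cast_pos
  have hl := h.log_pos
  have h0 : 0 < alphaUbd d := h.alphaLbd_pos.trans_le h.alphaLbd_le_alphaUbd
  have hdα : d * alphaUbd d = 2 * Real.log d := by rw [alphaUbd]; field_simp
  have he := h.expansion_error_le h0 hdα.le
  have he' : 1 / (100 * Real.log d) ≤ 1 := by
    rw [div_le_one (by positivity)]; linarith [h.log_ge]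
  have hlog : Real.log (Real.log d) - Real.log d ≤ Real.log (alphaUbd d) := by
    rw [← Real.log_div hl.ne' hd.ne']
    apply Real.log_le_log (by positivity)
    rw [alphaUbd]
    gcongr
    linarith
  have hb := (abs_le.1 (abs_PhiIS_sub_le d h0.le (by linarith [h.alphaUbd_le]))).2
  rw [hdα] at hb he
  generalize alphaUbd d = α at *
  have : α * (α + 10 * (2 * Real.log d) * α) ≤ α * 1 := by gcongr; linarith
  have : α * (1 - Real.log α - 2 * Real.log d / 2) ≤ α * (-2) := by
    gcongr
    linarith [h.loglog_ge]
  linarith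

/-- The exponent is positive up to the left end of the window and negative at the right end. By
continuity it vanishes at the infimum. -/
theorem LargeDegree.alphaFM_mem_and_PhiIS_alphaFM (h : LargeDegree d) :
    alphaFM d ∈ Set.Icc (alphaLbd d) (alphaUbd d) ∧ PhiIS d (alphaFM d) = 0 := by
  set S := {α : ℝ | 0 < α ∧ α ≤ 1 / 2 ∧ PhiIS d α < 0} with hS
  have hu : alphaUbd d ∈ S := ⟨h.alphaLbd_pos.trans_le h.alphaLbd_le_alphaUbd,
    by linarith [h.alphaUbd_le], h.PhiIS_alphaUbd_neg⟩
  have hlb : alphaLbd d ∈ lowerBounds S := by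
    intro α hα
    by_contra! hlt
    have h1 := h.PhiIS_pos hα.1 hlt.le
    have h2 : 0 < α * (Real.log d / 10) := mul_pos hα.1 (by linarith [h.log_pos])
    linarith [hα.2.2]
  have hbdd : BddBelow S := ⟨_, hlb⟩
  have hA : alphaFM d = sInf S := rfl
  have h1 : alphaLbd d ≤ alphaFM d := hA ▸ le_csInf ⟨_, hu⟩ hlb
  have h2 : alphaFM d ≤ alphaUbd d := hA ▸ csInf_le hbdd hu
  refine ⟨⟨h1, h2⟩, le_antisymm ?_ ?_⟩
  · have : alphaFM d ∈ closure S := hA ▸ csInf_mem_closure ⟨_, hu⟩ hbdd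
    have hc : IsClosed {α | PhiIS d α ≤ 0} := isClosed_le (continuous_PhiIS d) continuous_const
    exact closure_minimal (fun α hα => hα.2.2.le) hc this
  · have hpos : 0 < alphaFM d := h.alphaLbd_pos.trans_le h1
    have ht : Tendsto (PhiIS d) (𝓝[<] alphaFM d) (𝓝 (PhiIS d (alphaFM d))) :=
      (continuous_PhiIS d).continuousAt.tendsto.mono_left nhdsWithin_le_nhds
    refine ge_of_tendsto ht ?_
    filter_upwards [Ioo_mem_nhdsLT hpos] with α hα
    by_contra! hlt
    have : α ∈ S := ⟨hα.1, by linarith [hα.2, h.alphaUbd_le], hlt⟩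
    exact absurd (csInf_le hbdd this) (not_le.2 (hA ▸ hα.2))

end Gap

/-! ### Location of the zero and size of the gap. -/

section Threshold

variable {d : ℕ} {q : ℝ}

/-- `d` times the independent-set exponent is at least of order `(log d)²` there, while `d` times
the difference of the exponents is below `1/100`. -/
theorem PhiStar_alphaLbd_pos (h : LargeDegree d) : 0 < PhiStar d (alphaLbd d) := by
  have hd := h.cast_pos
  have hl := h.log_ge
  have hmem : alphaLbd d ∈ Set.Icc (alphaLbd d) (alphaUbd d) :=
    ⟨le_rfl, h.alphaLbd_le_alphaUbd⟩
  obtain ⟨q, hq, hα, -⟩ := exists_goodQ h hmem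
  have h1 := (abs_le.1 (PhiIS_sub_bounds h hq (hα ▸ hmem))).2
  have h2 := h.PhiIS_pos h.alphaLbd_pos le_rfl
  rw [← hα] at h1
  have h0 := hq.pos h
  have hy := hq.starY_pos h
  have hdq : 0 < d * q := by positivity
  have hs := hq.sq_mul_starY_le h
  have h3 : d * alphaLbd d = 5 / 3 * Real.log d := by rw [alphaLbd]; field_simp
  have h4 : d * (starY d q * (d * q / 2 + 2)) ≤ 2 / 1000 := by
    have : (d * q / 2 + 2) ≤ 2 * (1 + d * q) ^ 2 := by nlinarith only [hdq, sq_nonneg (d * q : ℝ)]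
    have := mul_le_mul_of_nonneg_left this (mul_pos hd hy).le
    linarith
  have h5 : 1 ≤ d * (alphaLbd d * (Real.log d / 10)) := by
    rw [← mul_assoc, h3]
    nlinarith only [hl]
  have h6 : 0 < d * PhiStar d (alphaLbd d) := by
    have := mul_le_mul_of_nonneg_left h1 hd.le
    have := mul_le_mul_of_nonneg_left h2 hd.le
    linarith
  exact pos_of_mul_pos_right h6 hd.le

/-- The zero of the exponent of independent sets. -/
theorem LargeDegree.mul_alphaFM_eq (h : LargeDegree d) :
    |d * alphaFM d - (2 - 2 * Real.log (alphaFM d))| ≤ 1 / (50 * Real.log d) := by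
  obtain ⟨⟨hA1, hA2⟩, hA⟩ := h.alphaFM_mem_and_PhiIS_alphaFM
  have hd := h.cast_pos
  have hA0 := h.alphaLbd_pos.trans_le hA1
  have hu := h.alphaUbd_le
  rw [alphaUbd, le_div_iff₀ hd] at hA2
  have he := h.expansion_error_le hA0 (by linarith)
  have hA3 : alphaFM d ≤ 1 / 4 := by
    have := h.alphaFM_mem_and_PhiIS_alphaFM.1.2
    linarith
  have hb := abs_PhiIS_sub_le d hA0.le hA3
  rw [hA, zero_sub, abs_neg, abs_mul, abs_of_pos hA0] at hb
  have hb' := abs_le.1 (le_of_mul_le_mul_left hb hA0)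
  have h2 : 1 / (50 * Real.log d) = 2 * (1 / (100 * Real.log d)) := by
    have := h.log_pos
    field_simp; norm_num
  rw [h2, abs_le]
  constructor <;> linarith [hb'.1, hb'.2]

/-- Location of the first moment threshold of independent sets. -/
theorem LargeDegree.mul_alphaFM_bounds (h : LargeDegree d) :
    2 * Real.log d - 2 * Real.log (Real.log d) ≤ d * alphaFM d ∧
      d * alphaFM d ≤ 2 * Real.log d - 2 * Real.log (Real.log d) + 3 := by
  obtain ⟨⟨hA1, hA2⟩, -⟩ := h.alphaFM_mem_and_PhiIS_alphaFM
  have hd := h.cast_pos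
  have hl := h.log_pos
  have hA0 := h.alphaLbd_pos.trans_le hA1
  have hb := abs_le.1 h.mul_alphaFM_eq
  have he : 1 / (50 * Real.log d) ≤ 1 / 100 := by
    apply one_div_le_one_div_of_le (by norm_num); linarith [h.log_ge]
  have e : Real.log (alphaFM d) = Real.log (d * alphaFM d) - Real.log d := by
    rw [Real.log_mul hd.ne' hA0.ne']; ring
  rw [alphaUbd, le_div_iff₀ hd] at hA2
  rw [alphaLbd, div_le_iff₀ hd] at hA1
  have l1 : Real.log (Real.log d) ≤ Real.log (d * alphaFM d) :=
    Real.log_le_log hl (by linarith)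
  have l2 : Real.log (d * alphaFM d) ≤ Real.log 2 + Real.log (Real.log d) := by
    rw [← Real.log_mul (by norm_num) hl.ne']
    exact Real.log_le_log (by positivity) (by linarith)
  have := Real.log_two_lt_d9
  constructor <;> linarith [hb.1, hb.2]

/-- `log λ ≈ log q + dq`, where `dq ≈ dα` and `log q = log log d - log d + O(1)`. -/
theorem GoodQ.log_lambdaOf_bounds (h : LargeDegree d) (hq : GoodQ d q) :
    d * alphaOf d q - Real.log d + Real.log (Real.log d) ≤ Real.log (lambdaOf d q) ∧
      Real.log (lambdaOf d q) ≤ d * alphaOf d q - Real.log d + Real.log (Real.log d) + 3 := by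
  have hd := h.cast_pos
  have hl := h.log_pos
  have h0 := hq.pos h
  have h1 := abs_le.1 (hq.abs_log_lambdaOf_sub_le h)
  have h2 := abs_le.1 (hq.abs_mul_sub_alphaOf_le h)
  have he : 1 / (100 * Real.log d) ≤ 1 / 100 := by
    apply one_div_le_one_div_of_le (by norm_num); linarith [h.log_ge]
  have e : Real.log q = Real.log (d * q) - Real.log d := by
    rw [Real.log_mul hd.ne' h0.ne']; ring
  have l1 : Real.log (33 / 20) + Real.log (Real.log d) ≤ Real.log (d * q) := by
    rw [← Real.log_mul (by norm_num) hl.ne']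
    exact Real.log_le_log (by positivity) (hq.mul_ge h)
  have l2 : Real.log (d * q) ≤ Real.log 3 + Real.log (Real.log d) := by
    rw [← Real.log_mul (by norm_num) hl.ne']
    exact Real.log_le_log (by positivity) (hq.mul_le h)
  have l3 := Real.one_sub_inv_le_log_of_pos (x := 33 / 20) (by norm_num)
  have l4 := Real.log_le_sub_one_of_pos (x := 3) (by norm_num)
  norm_num at l3 l4
  constructor <;> linarith [h1.1, h1.2, h2.1, h2.2]

/-- The probability that a vertex sees no token, at the first moment threshold. -/
theorem abs_log_starY_sub_le (h : LargeDegree d) (hq : GoodQ d q) (hα : alphaOf d q = alphaFM d) :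
    |Real.log (starY d q) - Real.log ((2 * Real.log d / (Real.exp 1 * d)) ^ 2)| ≤
      5 * (Real.log (Real.log d) / Real.log d) := by
  have hd := h.cast_pos
  have hl := h.log_pos
  have hl' := h.loglog_ge
  have hA0 : 0 < alphaFM d := h.alphaLbd_pos.trans_le h.alphaFM_mem_and_PhiIS_alphaFM.1.1
  have h1 := abs_le.1 (hq.abs_log_starY_add_le h)
  have h2 := abs_le.1 (hq.abs_mul_sub_alphaOf_le h)
  have h3 := abs_le.1 h.mul_alphaFM_eq
  obtain ⟨h4, h5⟩ := h.mul_alphaFM_bounds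
  rw [hα] at h2
  -- `log y ≈ -dα ≈ 2 log α - 2`, so the difference to be bounded is about `2 (log (dα) - log (2 log
  -- d))`. It is `O(log log d / log d)` because `dα = 2 log d - O(log log d)`.
  have hT : Real.log ((2 * Real.log d / (Real.exp 1 * d)) ^ 2) =
      2 * (Real.log (2 * Real.log d) - 1 - Real.log d) := by
    have := Real.exp_pos 1
    rw [Real.log_pow, Real.log_div (by positivity) (by positivity),
      Real.log_mul (Real.exp_pos 1).ne' hd.ne', Real.log_exp]
    push_cast; ring
  have e : Real.log (alphaFM d) = Real.log (d * alphaFM d) - Real.log d := by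
    rw [Real.log_mul hd.ne' hA0.ne']; ring
  have h2l : 0 < 2 * Real.log d := by linarith
  have hdA : 0 < d * alphaFM d := by positivity
  have l1 := log_sub_log_le hdA h2l
  have l2 := one_sub_inv_le_log_div hdA h2l
  have r1 : d * alphaFM d / (2 * Real.log d) ≤ 1 := by
    rw [div_le_one h2l]; linarith
  have r2 : 2 * Real.log d / (d * alphaFM d) ≤ 1 + 3 / 2 * (Real.log (Real.log d) / Real.log d) := by
    have hr : Real.log (Real.log d) / Real.log d * Real.log d = Real.log (Real.log d) := by
      field_simp
    have hr0 : 0 ≤ Real.log (Real.log d) / Real.log d := by positivity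
    rw [div_le_iff₀ hdA]
    have : (1 + 3 / 2 * (Real.log (Real.log d) / Real.log d)) *
        (2 * Real.log d - 2 * Real.log (Real.log d)) ≤
        (1 + 3 / 2 * (Real.log (Real.log d) / Real.log d)) * (d * alphaFM d) := by gcongr
    refine le_trans ?_ this
    have hsm : Real.log (Real.log d) / Real.log d ≤ 1 / 1000 := by
      rw [div_le_iff₀ hl]; linarith [h.loglog_le]
    have := mul_le_mul_of_nonneg_right hsm (by linarith : 0 ≤ Real.log (Real.log d))
    nlinarith only [this, hr, hl']
  have i1 : 10 * (1 / Real.log d) ≤ Real.log (Real.log d) / Real.log d := by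
    rw [mul_one_div]; gcongr
  have i2 : 1 / (100 * Real.log d) = 1 / 100 * (1 / Real.log d) := by field_simp
  have i3 : 1 / (50 * Real.log d) = 1 / 50 * (1 / Real.log d) := by field_simp
  have i4 : 0 < 1 / Real.log d := by positivity
  rw [i2] at h1 h2
  rw [i3] at h3
  rw [hT, abs_le]
  constructor <;> linarith [h1.1, h1.2, h2.1, h2.2, h3.1, h3.2]

theorem abs_sub_le_of_abs_log_sub_le {y T s : ℝ} (hy : 0 < y) (hT : 0 < T) (hs : s ≤ 1 / 4)
    (h : |Real.log y - Real.log T| ≤ s) : (1 - s) * T ≤ y ∧ y ≤ (1 + 2 * s) * T := by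
  obtain ⟨h1, h2⟩ := abs_le.1 h
  have e : y = Real.exp (Real.log y - Real.log T) * T := by
    rw [Real.exp_sub, Real.exp_log hy, Real.exp_log hT]; field_simp
  have hs0 : 0 ≤ s := (abs_nonneg _).trans h
  rw [e]
  constructor
  · gcongr
    have := Real.add_one_le_exp (Real.log y - Real.log T)
    linarith
  · gcongr
    refine (Real.exp_le_exp.2 h2).trans ?_
    have := Real.add_one_le_exp (-s)
    have h4 : Real.exp s * Real.exp (-s) = 1 := by rw [← Real.exp_add]; simp
    nlinarith [Real.exp_pos s]

/-- The lines touching at `alphaFM d` and at the zero bound the gap times either slope by `-PhiStar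
d (alphaFM d)` from both sides. This value is about `y log d`, and both slopes are `log d` in size
to leading order. -/
theorem exists_threshold (h : LargeDegree d) :
    ∃ αs ∈ Set.Ioo (alphaLbd d) (alphaUbd d), PhiStar d αs = 0 ∧
      |(alphaFM d - αs) - (2 * Real.log d / (Real.exp 1 * d)) ^ 2| ≤
        20 * (Real.log (Real.log d) / Real.log d) * (2 * Real.log d / (Real.exp 1 * d)) ^ 2 := by
  have hd := h.cast_pos
  have hl := h.log_pos
  have hl1 := h.log_ge
  have hll := h.loglog_ge
  have hll' := h.loglog_le
  obtain ⟨hA, hA0⟩ := h.alphaFM_mem_and_PhiIS_alphaFM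
  obtain ⟨hb1, hb2⟩ := h.mul_alphaFM_bounds
  obtain ⟨q, hq, hαq, -⟩ := exists_goodQ h hA
  have h0 := hq.pos h
  have hy := hq.starY_pos h
  have hdq := abs_le.1 (hq.abs_mul_sub_alphaOf_le h)
  have hPhi := abs_le.1 (PhiIS_sub_bounds h hq (hαq ▸ hA))
  have hsm := hq.sq_mul_starY_le h
  have hdq0 : 0 < d * q := by positivity
  have hlogy := abs_log_starY_sub_le h hq hαq.symm
  have hstar := PhiStar_alphaOf h hq (hαq ▸ hA)
  have hL := hq.log_lambdaOf_bounds h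
  rw [← hαq] at hdq hPhi hstar hL
  rw [hA0] at hPhi
  have he : 1 / (100 * Real.log d) ≤ 1 / 100 := by
    apply one_div_le_one_div_of_le (by norm_num); linarith [h.log_ge]
  set ℓ := Real.log d
  set m := Real.log ℓ
  set y := starY d q
  set A := alphaFM d
  -- `dq/2 = ℓ - m + O(1)`; the spare `m ≥ 10` absorbs all constants, here and in the slope bounds
  -- below.
  have hE1 : y * (ℓ - 2 * m) ≤ -PhiStar d A := by
    have : y * (ℓ - 2 * m) ≤ y * (d * q / 2 - 2) :=
      mul_le_mul_of_nonneg_left (by linarith [hdq.1]) hy.le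
    linarith [hPhi.1]
  have hE2 : -PhiStar d A ≤ y * ℓ := by
    have : y * (d * q / 2 + 2) ≤ y * ℓ := by gcongr; linarith [hdq.2]
    linarith [hPhi.2]
  have hneg : PhiStar d A < 0 := by
    have : 0 < y * (ℓ - 2 * m) := mul_pos hy (by linarith)
    linarith
  obtain ⟨a, ha, ha0⟩ : ∃ a ∈ Set.Ioo (alphaLbd d) A, PhiStar d a = 0 := by
    have hc : ContinuousOn (PhiStar d) (Set.Icc (alphaLbd d) A) :=
      (continuousOn_PhiStar h).mono (Set.Icc_subset_Icc le_rfl hA.2)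
    exact intermediate_value_Ioo' hA.1 hc ⟨hneg, PhiStar_alphaLbd_pos h⟩
  have haI : a ∈ Set.Icc (alphaLbd d) (alphaUbd d) := ⟨ha.1.le, ha.2.le.trans hA.2⟩
  refine ⟨a, ⟨ha.1, ha.2.trans_le hA.2⟩, ha0, ?_⟩
  obtain ⟨p, hp, hαp, -⟩ := exists_goodQ h haI
  have hM := hp.log_lambdaOf_bounds h
  have hstar' := PhiStar_alphaOf h hp (hαp ▸ haI)
  rw [← hαp] at hM hstar'
  have k1 := PhiStar_le h hq haI
  have k2 := PhiStar_le h hp hA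
  set g := A - a
  have hg : 0 < g := sub_pos.2 ha.2
  -- two-sided bound of the gap through the slopes of the dual
  have g1 : -PhiStar d A ≤ g * Real.log (lambdaOf d q) := by
    have : g * Real.log (lambdaOf d q) = A * Real.log (lambdaOf d q)
      - a * Real.log (lambdaOf d q) := sub_mul _ _ _
    linarith
  have g2 : g * Real.log (lambdaOf d p) ≤ -PhiStar d A := by
    have : g * Real.log (lambdaOf d p) = A * Real.log (lambdaOf d p)
      - a * Real.log (lambdaOf d p) := sub_mul _ _ _
    linarith
  have lo : y * (ℓ - 2 * m) ≤ g * ℓ := by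
    have : g * Real.log (lambdaOf d q) ≤ g * ℓ := by gcongr; linarith
    linarith
  -- A crude bound that transfers the slope estimate from `A` to the zero `a`: `da` and `dA` differ
  -- by at most 1.
  have hdg : d * g ≤ 1 := by
    have i1 : (1 : ℝ) ≤ Real.log (lambdaOf d p) := by
      have := ha.1
      rw [alphaLbd, div_lt_iff₀ hd] at this
      linarith
    have i2 : g * 1 ≤ g * Real.log (lambdaOf d p) := by gcongr
    have i3 : d * g ≤ d * (y * (d * q / 2 + 2)) := by
      gcongr
      linarith [hPhi.2]
    have i4 : d * y * (d * q / 2 + 2) ≤ d * y * (2 * (1 + d * q) ^ 2) := by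
      gcongr
      nlinarith only [hdq0, sq_nonneg (d * q : ℝ)]
    linarith
  have hi : g * (ℓ - 2 * m) ≤ y * ℓ := by
    have : g * (ℓ - 2 * m) ≤ g * Real.log (lambdaOf d p) := by
      gcongr
      have : d * a = d * A - d * g := by simp only [g]; ring
      linarith
    linarith
  have hT0 : 0 < (2 * ℓ / (Real.exp 1 * d)) ^ 2 := by
    have := Real.exp_pos 1
    positivity
  set T := (2 * ℓ / (Real.exp 1 * d)) ^ 2
  have hm : m = m / ℓ * ℓ := by field_simp
  have hr0 : 0 < m / ℓ := by positivity
  have hr1 : m / ℓ ≤ 1 / 1000 := by rw [div_le_iff₀ hl]; linarith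
  generalize m / ℓ = r at *
  obtain ⟨t1, t2⟩ := abs_sub_le_of_abs_log_sub_le hy hT0 (by linarith) hlogy
  have lo' : y * (1 - 2 * r) ≤ g := by
    refine le_of_mul_le_mul_right ?_ hl
    have : y * (ℓ - 2 * m) = y * (1 - 2 * r) * ℓ := by rw [hm]; ring
    linarith
  have hi' : g * (1 - 2 * r) ≤ y := by
    refine le_of_mul_le_mul_right ?_ hl
    have : g * (ℓ - 2 * m) = g * (1 - 2 * r) * ℓ := by rw [hm]; ring
    linarith
  have rr : r ^ 2 ≤ 1 / 1000 * r := by nlinarith only [hr0, hr1]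
  have hrT : 0 < r * T := mul_pos hr0 hT0
  have rrT := mul_le_mul_of_nonneg_right rr hT0.le
  have lo2 : (1 - 5 * r) * T * (1 - 2 * r) ≤ y * (1 - 2 * r) :=
    mul_le_mul_of_nonneg_right t1 (by linarith)
  have hi2 : g ≤ (1 + 20 * r) * T := by
    -- `1 + 10r ≤ (1 + 20r)(1 - 2r)` for small `r`; this gives the constant 20.
    have j1 : (1 + 2 * (5 * r)) * T ≤ (1 + 20 * r) * T * (1 - 2 * r) := by
      linarith only [rrT, hrT]
    refine le_of_mul_le_mul_right ?_ (by linarith : 0 < 1 - 2 * r)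
    linarith
  have hr2T : 0 ≤ r ^ 2 * T := by positivity
  rw [abs_le]
  constructor
  · linarith only [lo', lo2, hrT, hr2T]
  · linarith only [hi2]

theorem GoodQ.isSolutionQ (h : LargeDegree d) (hq : GoodQ d q) :
    IsSolutionQ d (alphaOf d q) q := by
  refine ⟨le_trans ?_ hq.ge, hq.le, rfl⟩
  have : 0 ≤ Real.log d / d := div_nonneg h.log_pos.le h.cast_pos.le
  gcongr
  norm_num

end Threshold

theorem mainTheorem7 :
    ∃ (d₀ : ℕ) (C : ℝ), ∀ d : ℕ, d₀ ≤ d →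
      (∀ α ∈ Set.Icc (alphaLbd d) (alphaUbd d),
        Filter.Tendsto (logFirstMoment d) (intensityFilter d α) (nhds (PhiStar d α)) ∧
        ∃ q : ℝ, IsSolutionQ d α q ∧ (∀ q' : ℝ, IsSolutionQ d α q' → q' = q) ∧
          PhiStar d α = explicitExponent d q (lambdaOf d q) α) ∧
      StrictAntiOn (PhiStar d) (Set.Icc (alphaLbd d) (alphaUbd d)) ∧
      ∃ αs ∈ Set.Ioo (alphaLbd d) (alphaUbd d),
        PhiStar d αs = 0 ∧
        (∀ α ∈ Set.Icc (alphaLbd d) (alphaUbd d), PhiStar d α = 0 → α = αs) ∧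
        |(alphaFM d - αs) - (2 * Real.log d / (Real.exp 1 * d)) ^ 2|
          ≤ C * (Real.log (Real.log d) / Real.log d)
              * (2 * Real.log d / (Real.exp 1 * d)) ^ 2 := by
  obtain ⟨d₀, hd₀⟩ := eventually_atTop.1 eventually_largeDegree
  refine ⟨d₀, 20, fun d hd => ?_⟩
  have h := hd₀ d hd
  refine ⟨fun α hα => ?_, strictAntiOn_PhiStar h, ?_⟩
  · obtain ⟨q, hq, rfl, huniq⟩ := exists_goodQ h hα
    have hd2 : 2 ≤ d := by have := h.ge_ten; omega
    have hlim := PhiStar_alphaOf h hq hα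
    refine ⟨hlim ▸ tendsto_logFirstMoment h hq hα, q, hq.isSolutionQ h, huniq, ?_⟩
    rw [hlim, explicitExponent_eq hd2 (hq.pos h) (hq.lt_one h)]
  · obtain ⟨αs, hαs, h0, hgap⟩ := exists_threshold h
    exact ⟨αs, hαs, h0, fun α hα hα0 => (strictAntiOn_PhiStar h).injOn hα
      (Set.Ioo_subset_Icc_self hαs) (hα0.trans h0.symm), hgap⟩
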